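/- **Setting.** Fix an integer $D\ge 1$. Let $\mathcal D$ be the space of real smooth compactly supported functions on $\mathbb R^D$ and $\mathcal D'$ its dual, the space of distributions, with the weak-* topology. A function $F$ on $\mathcal D'$ is *cylindrical* if $F[T]=\tilde F(T(f_1),\dots,T(f_m))$ for some $f_1,\dots,f_m\in\mathcal D$ and some bounded continuous $\tilde F:\mathbb R^m\to\mathbb R$. For $R>0$ let $\mathbb S_R=\{(x,y)\in\mathbb R^D\times\mathbb R: x^2+(y-R)^2=R^2\}$, with surface measure $\Omega_R$, Laplace–Beltrami operator $\nabla^2$, and stereographic projection $\mathfrak s(x,y)=\frac{2R}{2R-y}x$. Let $\{Y_{l,m}\}$ be an $L^2(\Omega_R)$-orthonormal basis of the spherical harmonics on $\mathbb S_R$, $Y_{l,m}$ of degree $l$, so that $-\nabla^2Y_{l,m}=\lambda_lY_{l,m}$ with $\lambda_l=l(l+D-1)/R^2$. For a field $\phi=\{\phi_{l,m}\}$ and a function $u=\sum u_{l,m}Y_{l,m}$ put $\phi(u)=\sum\phi_{l,m}u_{l,m}$ and $\|\phi\|_{H^{-k}}^2=\sum(\lambda_l+1)^{-k}|\phi_{l,m}|^2$,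 where $k$ is a fixed real number with $k+1>D/2$. Let $\mu_R$ be the centred Gaussian measure (carried by $H^{-k}$) with covariance $(-\nabla^2+1)^{-1}$: the $\phi_{l,m}$ are independent, of variance $(\lambda_l+1)^{-1}$. Let $h\ge0$, $h\not\equiv0$, be a smooth, compactly supported, rotationally invariant function on $\mathbb R^D$; for $\Lambda>0$ let $h_\Lambda$ be the zonal function $x\mapsto h(\Lambda\,\mathfrak s(x))$ on $\mathbb S_R$ divided by its $\Omega_R$-integral, and $\phi_\Lambda=h_\Lambda*\phi$ the zonal convolution: $\phi_\Lambda(\theta)=\phi(h_\Lambda\circ g_\theta)$ for any isometry $g_\theta$ of $\mathbb S_R$ taking $\theta$ to the origin. Let $\mathcal L_n:\mathbb R^{N_n+1}\to\mathbb R$ ($n\in\mathbb N$) be bounded measurable functions and $\mathfrak M_n=\sup\mathcal L_n-\inf\mathcal L_n$ (that is, $\sup\mathcal L_n$ after the additive normalization $\inf\mathcal L_n=0$). Let $R_n,\Lambda_n>0$ be sequences with $R_n,\Lambda_n\to\infty$, and let $L$ be a positive norm-one functional on $\ell^\infty$ which extends the limit of convergent sequences (e.g. a Banach limit; shift invariance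 is not needed). For bounded measurable $G$ (possibly depending on $n$) put $$I(G)=L\left(\frac{\int G[\phi]\,e^{-\int_{\mathbb S_{R_n}}\mathcal L_n(\phi_{\Lambda_n},\nabla^2\phi_{\Lambda_n},\dots,(\nabla^2)^{N_n}\phi_{\Lambda_n})\,d\Omega_{R_n}}\,d\mu_{R_n}}{\int e^{-\int_{\mathbb S_{R_n}}\mathcal L_n(\phi_{\Lambda_n},\dots,(\nabla^2)^{N_n}\phi_{\Lambda_n})\,d\Omega_{R_n}}\,d\mu_{R_n}}\right),$$ and $I(G)=\sup_{M\in\mathbb N} I(\min(G,M))$ for measurable $G\ge 0$. For cylindrical $F$ put $\breve F[\phi]=\tilde F(\phi(f_1\circ\mathfrak s),\dots,\phi(f_m\circ\mathfrak s))$. **Theorem.** 1. There is a Hausdorff compactification $\mathring{\mathcal D'}$ of $\mathcal D'$ to which every cylindrical function $F$ extends continuously and in which these extensions separate points. It is unique up to a (unique) homeomorphism that is the identity on $\mathcal D'$, and the continuous extension $\mathring F$ of each cylindrical $F$ is unique. 2. For all $R_n,\Lambda_n$ as above, there is a unique regular Borel probability measure $\mathring\mu$ on $\mathring{\mathcal D'}$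 with $\int\mathring F\,d\mathring\mu=I(\breve F)$ for every cylindrical $F$. It is rotationally invariant: $\int\mathring F_E\,d\mathring\mu=\int\mathring F\,d\mathring\mu$ for all $E\in O(D)$ and all cylindrical $F$, where $F_E[T]=\tilde F(T(Ef_1),\dots,T(Ef_m))$ and $Ef(x)=f(E^{-1}x)$. 3. If $\mathfrak M_nR_n^D/\Lambda_n\to0$, then $\mathring\mu$ is reflection positive: $\int\mathring F\,\mathring F_\Theta\,d\mathring\mu\ge0$ for every cylindrical $F$ for which the supports of $f_1,\dots,f_m$ lie in $\{x_D>0\}$, where $\Theta$ is the reflection in the coordinate $x_D$. For any given $\mathcal L_n$, sequences $R_n,\Lambda_n\to\infty$ with $\mathfrak M_nR_n^D/\Lambda_n\to0$ exist. 4. If $I(\|\phi\|_{H^{-k}})<\infty$ (whether or not $\mathfrak M_nR_n^D/\Lambda_n\to0$), then $\mathring\mu$ is invariant under translations, and hence under all Euclidean motions $E$ of $\mathbb R^D$, in the sense of 2. -/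

import Mathlib

open MeasureTheory ProbabilityTheory Filter Topology TopologicalSpace
open scoped Distributions ENNReal NNReal BoundedContinuousFunction ContDiff

noncomputable section

namespace SphereQFT

/-! ### Distributions, cylindrical functions, compactification -/

/-- The space `ℝ^D`. -/
abbrev Space (D : ℕ) := EuclideanSpace ℝ (Fin D)

/-- The space `𝒟` of (real) smooth compactly supported functions on `ℝ^D`, with its LF topology. -/
abbrev Test (D : ℕ) := 𝓓((⊤ : Opens (Space D)), ℝ)

/-- The space `𝒟'` of distributions on `ℝ^D`, with the weak-* topology. -/
abbrev Distr (D : ℕ) := WeakDual ℝ (Test D)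

variable {D : ℕ}

/-- The function `T ↦ F (T f₁, …, T f_m)` on `𝒟'`. -/
def cyl {m : ℕ} (f : Fin m → Test D) (F : (Fin m → ℝ) →ᵇ ℝ) (T : Distr D) : ℝ :=
  F fun i => T (f i)

/-- Cylindrical functions on `𝒟'`. -/
def IsCylindrical (G : Distr D → ℝ) : Prop :=
  ∃ (m : ℕ) (f : Fin m → Test D) (F : (Fin m → ℝ) →ᵇ ℝ), G = cyl f F

/-- `ι : 𝒟' → K` is a (Hausdorff) compactification to which every cylindrical function extends
continuously, and whose points are separated by these extensions. -/
structure IsCylCompactification {K : Type*} [TopologicalSpace K] (ι : Distr D → K) : Prop where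
  compactSpace : CompactSpace K
  t2Space : T2Space K
  isEmbedding : IsEmbedding ι
  denseRange : DenseRange ι
  exists_extension : ∀ G : Distr D → ℝ, IsCylindrical G → ∃ Φ : C(K, ℝ), ∀ T, Φ (ι T) = G T
  separates : ∀ x y : K, x ≠ y → ∃ Φ : C(K, ℝ), IsCylindrical (fun T => Φ (ι T)) ∧ Φ x ≠ Φ y

/-! ### Euclidean motions, reflection positivity -/

/-- The transformed test function `(E f)(x) = f (E⁻¹ x)`, for a Euclidean motion `E`. -/
def move (E : Space D ≃ᵃⁱ[ℝ] Space D) (f : Test D) : Test D where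
  toFun x := f (E.symm x)
  contDiff' := f.contDiff.comp E.symm.toAffineIsometry.toContinuousAffineMap.contDiff
  hasCompactSupport' := f.hasCompactSupport.comp_homeomorph E.symm.toHomeomorph
  tsupport_subset' := fun _ _ => trivial

/-- Index of the last coordinate `x_D` of `ℝ^D`. -/
def lastIdx (D : ℕ) [NeZero D] : Fin D := ⟨D - 1, Nat.sub_one_lt (NeZero.ne D)⟩

/-- The reflection `Θ` of `ℝ^D` in the coordinate `x_D`. -/
def theta (D : ℕ) [NeZero D] : Space D ≃ᵃⁱ[ℝ] Space D :=
  (Submodule.reflection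
    (Submodule.span ℝ {EuclideanSpace.single (lastIdx D) (1 : ℝ)})ᗮ).toAffineIsometryEquiv

section

variable {K : Type*} [TopologicalSpace K] [MeasurableSpace K]

/-- `∫ F̊_E dμ = ∫ F̊ dμ` for every cylindrical `F`, where `Φ = F̊` and `Φ' = F̊_E`. -/
def InvariantUnder (ι : Distr D → K) (μ : Measure K) (E : Space D ≃ᵃⁱ[ℝ] Space D) : Prop :=
  ∀ (m : ℕ) (f : Fin m → Test D) (F : (Fin m → ℝ) →ᵇ ℝ) (Φ Φ' : C(K, ℝ)),
    (∀ T, Φ (ι T) = cyl f F T) → (∀ T, Φ' (ι T) = cyl (fun i => move E (f i)) F T) →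
      ∫ x, Φ' x ∂μ = ∫ x, Φ x ∂μ

/-- `∫ F̊ F̊_Θ dμ ≥ 0` for every cylindrical `F` built from test functions supported in
`{x_D > 0}`, where `Φ = F̊` and `Φ' = F̊_Θ`. -/
def ReflectionPositive [NeZero D] (ι : Distr D → K) (μ : Measure K) : Prop :=
  ∀ (m : ℕ) (f : Fin m → Test D) (F : (Fin m → ℝ) →ᵇ ℝ) (Φ Φ' : C(K, ℝ)),
    (∀ i, tsupport (f i) ⊆ {x | 0 < x (lastIdx D)}) →
    (∀ T, Φ (ι T) = cyl f F T) →
    (∀ T, Φ' (ι T) = cyl (fun i => move (theta D) (f i)) F T) →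
      0 ≤ ∫ x, Φ x * Φ' x ∂μ

end

/-! ### The sphere `S_R` and its spherical harmonics -/

/-- The space `ℝ^D × ℝ`; the coordinates of a point `(x, y)` are `x i = v i.castSucc` and
`y = v (Fin.last D)`. -/
abbrev Ambient (D : ℕ) := EuclideanSpace ℝ (Fin (D + 1))

/-- The centre `(0, R)` of the sphere `S_R : x² + (y - R)² = R²`. -/
def center (D : ℕ) (R : ℝ) : Ambient D := EuclideanSpace.single (Fin.last D) R

/-- The surface measure `Ω_R` of `S_R`, as a measure on `ℝ^D × ℝ` (carried by `S_R`): the image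
under `w ↦ (0, R) + R w` of `R^D` times the surface measure of the unit sphere. -/
def surface (D : ℕ) (R : ℝ) : Measure (Ambient D) :=
  ENNReal.ofReal (R ^ D) •
    Measure.map
      (fun w : Metric.sphere (0 : Ambient D) 1 => center D R + R • (w : Ambient D))
      (volume : Measure (Ambient D)).toSphere

/-- Stereographic projection `𝔰 (x, y) = 2R / (2R - y) x`. -/
def stereo (R : ℝ) (v : Ambient D) : Space D :=
  WithLp.toLp 2 fun i => 2 * R / (2 * R - v (Fin.last D)) * v i.castSucc

/-- The function `f ∘ 𝔰` on the sphere, extended by `0` to the pole `(0, 2R)`. -/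
def pull (R : ℝ) (f : Space D → ℝ) (v : Ambient D) : ℝ :=
  if v (Fin.last D) = 2 * R then 0 else f (stereo R v)

/-- Spherical harmonics of degree `l` on `S_R`, as elements of `L²(S_R)`: the restrictions to the
sphere of the harmonic homogeneous polynomials of degree `l` in the `D + 1` coordinates relative
to the centre of the sphere. -/
def sphericalHarmonics (D : ℕ) (R : ℝ) (l : ℕ) : Submodule ℝ (Lp ℝ 2 (surface D R)) where
  carrier := {u | ∃ p : MvPolynomial (Fin (D + 1)) ℝ, p.IsHomogeneous l ∧
    ∑ i, MvPolynomial.pderiv i (MvPolynomial.pderiv i p) = 0 ∧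
    u =ᵐ[surface D R] fun v => MvPolynomial.eval (fun i => (v - center D R) i) p}
  add_mem' := by
    rintro u w ⟨p, hp, hp', hu⟩ ⟨q, hq, hq', hw⟩
    refine ⟨p + q, hp.add hq, by simp [Finset.sum_add_distrib, hp', hq'], ?_⟩
    filter_upwards [Lp.coeFn_add u w, hu, hw] with v h1 h2 h3
    rw [h1, Pi.add_apply, h2, h3, map_add]
  zero_mem' := by
    refine ⟨0, MvPolynomial.isHomogeneous_zero _ _ _, by simp, ?_⟩
    filter_upwards [Lp.coeFn_zero ℝ 2 (surface D R)] with v h1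
    rw [h1, map_zero, Pi.zero_apply]
  smul_mem' := by
    rintro c u ⟨p, hp, hp', hu⟩
    refine ⟨MvPolynomial.C c * p, by simpa using (MvPolynomial.isHomogeneous_C _ c).mul hp, ?_, ?_⟩
    · simp [← Finset.mul_sum, hp']
    · filter_upwards [Lp.coeFn_smul c u, hu] with v h1 h2
      rw [h1, Pi.smul_apply, h2, map_mul, MvPolynomial.eval_C, smul_eq_mul]

/-- The indices `(l, m)`. -/
abbrev Modes (D : ℕ) (R : ℝ) := Σ l : ℕ, Fin (Module.finrank ℝ (sphericalHarmonics D R l))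

/-- A choice `{Y_{l,m}}` of orthonormal bases of the spaces of spherical harmonics on `S_R`. -/
abbrev HarmonicBasis (D : ℕ) (R : ℝ) :=
  ∀ l : ℕ, OrthonormalBasis (Fin (Module.finrank ℝ (sphericalHarmonics D R l))) ℝ
    (sphericalHarmonics D R l)

/-- The eigenvalue of `-∇²` (`∇²` the Laplace-Beltrami operator of `S_R`) on spherical harmonics
of degree `l`. -/
def eig (D : ℕ) (R : ℝ) (l : ℕ) : ℝ := l * (l + D - 1) / R ^ 2

/-- A field on `S_R` is given by its coefficients `φ_{l,m}`. -/
abbrev Field (D : ℕ) (R : ℝ) := Modes D R → ℝ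

/-- The norm of `H^{-k}(S_R)`; the value `∞` is taken off `H^{-k}`. -/
def sobolevNorm {R : ℝ} (k : ℝ) (φ : Field D R) : ℝ≥0∞ :=
  (∑' i, ENNReal.ofReal ((eig D R i.1 + 1) ^ (-k) * φ i ^ 2)) ^ (1 / 2 : ℝ)

/-- The centred Gaussian measure with covariance `(-∇² + 1)⁻¹`: the coefficients `φ_{l,m}` are
independent with variances `(eig l + 1)⁻¹`. -/
def freeMeasure (D : ℕ) (R : ℝ) : Measure (Field D R) :=
  Measure.infinitePi fun i : Modes D R => gaussianReal 0 (Real.toNNReal (eig D R i.1 + 1)⁻¹)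

/-- The coefficient `u_{l,m}` of a function `u` on `S_R`. -/
def coeff {R : ℝ} (Y : HarmonicBasis D R) (u : Ambient D → ℝ) (i : Modes D R) : ℝ :=
  ∫ v, u v * ((Y i.1 i.2 : sphericalHarmonics D R i.1) : Lp ℝ 2 (surface D R)) v ∂(surface D R)

/-- The pairing `φ(u) = ∑ φ_{l,m} u_{l,m}` of a field with a function on `S_R`. -/
def pair {R : ℝ} (Y : HarmonicBasis D R) (φ : Field D R) (u : Ambient D → ℝ) : ℝ :=
  ∑' i, φ i * coeff Y u i

/-- `F̆[φ] = F (φ(f₁ ∘ 𝔰), …, φ(f_m ∘ 𝔰))`. -/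
def breve {R : ℝ} (Y : HarmonicBasis D R) {m : ℕ} (f : Fin m → Test D) (F : (Fin m → ℝ) →ᵇ ℝ)
    (φ : Field D R) : ℝ :=
  F fun i => pair Y φ (pull R (f i))

/-! ### The regularized theory -/

/-- The mollifier `h_Λ` on `S_R`, concentrated at the origin. -/
def mollifier (R Λ : ℝ) (h : Space D → ℝ) (v : Ambient D) : ℝ :=
  pull R (fun x => h (Λ • x)) v / ∫ w, pull R (fun x => h (Λ • x)) w ∂(surface D R)

/-- `h_Λ` recentred at the point `θ` of `S_R`, that is, composed with an isometry of `S_R` taking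
`θ` to the origin (here the reflection in the hyperplane that bisects the segment from the origin
to `θ`; as `h_Λ` is zonal, the choice of the isometry is immaterial). -/
def mollifierAt (R Λ : ℝ) (h : Space D → ℝ) (θ v : Ambient D) : ℝ :=
  mollifier R Λ h
    (center D R + Submodule.reflection (Submodule.span ℝ {θ})ᗮ (v - center D R))

/-- The distribution `(∇²)^j φ` on `S_R`. -/
def laplacianPow {R : ℝ} (j : ℕ) (φ : Field D R) : Field D R := fun i => (-eig D R i.1) ^ j * φ i

/-- The convolution `φ_Λ = h_Λ * φ` on `S_R`. -/
def smoothed {R : ℝ} (Y : HarmonicBasis D R) (Λ : ℝ) (h : Space D → ℝ) (φ : Field D R)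
    (θ : Ambient D) : ℝ :=
  pair Y φ (mollifierAt R Λ h θ)

/-- `∫_{S_R} 𝓛 (φ_Λ, ∇² φ_Λ, …, (∇²)^N φ_Λ) dΩ_R`; here `(∇²)^j φ_Λ = h_Λ * (∇²)^j φ`. -/
def action {R : ℝ} (Y : HarmonicBasis D R) (Λ : ℝ) (h : Space D → ℝ) {N : ℕ}
    (𝓛 : (Fin (N + 1) → ℝ) → ℝ) (φ : Field D R) : ℝ :=
  ∫ θ, 𝓛 (fun j => smoothed Y Λ h (laplacianPow (j : ℕ) φ) θ) ∂(surface D R)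

/-- The normalized regularized expectation `∫ G e^{-action} dμ / ∫ e^{-action} dμ`. -/
def expect {R : ℝ} (Y : HarmonicBasis D R) (Λ : ℝ) (h : Space D → ℝ) {N : ℕ}
    (𝓛 : (Fin (N + 1) → ℝ) → ℝ) (G : Field D R → ℝ) : ℝ :=
  (∫ φ, G φ * Real.exp (-action Y Λ h 𝓛 φ) ∂(freeMeasure D R)) /
    ∫ φ, Real.exp (-action Y Λ h 𝓛 φ) ∂(freeMeasure D R)

theorem abs_expect_le {R : ℝ} (Y : HarmonicBasis D R) (Λ : ℝ) (h : Space D → ℝ) {N : ℕ}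
    (𝓛 : (Fin (N + 1) → ℝ) → ℝ) (G : Field D R → ℝ) {C : ℝ} (hC : ∀ φ, |G φ| ≤ C) :
    |expect Y Λ h 𝓛 G| ≤ C := by
  have hC0 : 0 ≤ C := (abs_nonneg _).trans (hC fun _ => 0)
  unfold expect
  by_cases hi : Integrable (fun φ => Real.exp (-action Y Λ h 𝓛 φ)) (freeMeasure D R)
  · have h0 : 0 ≤ ∫ φ, Real.exp (-action Y Λ h 𝓛 φ) ∂(freeMeasure D R) :=
      integral_nonneg fun φ => (Real.exp_pos _).le
    rw [abs_div, abs_of_nonneg h0]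
    refine div_le_of_le_mul₀ h0 hC0 ?_
    rw [← integral_const_mul, ← Real.norm_eq_abs]
    refine norm_integral_le_of_norm_le (hi.const_mul C) (Eventually.of_forall fun φ => ?_)
    rw [norm_mul, Real.norm_eq_abs, Real.norm_eq_abs, Real.abs_exp]
    exact mul_le_mul_of_nonneg_right (hC φ) (Real.exp_pos _).le
  · rw [integral_undef hi]
    simpa using hC0

/-- `L` is a positive norm one functional on `ℓ^∞` that extends the limit functional. (A Banach
limit is such an `L` which is moreover shift invariant; this is not required.) -/
structure IsGeneralizedLimit (L : StrongDual ℝ (lp (fun _ : ℕ => ℝ) ∞)) : Prop where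
  norm_eq : ‖L‖ = 1
  nonneg : ∀ a : lp (fun _ : ℕ => ℝ) ∞, (∀ n, 0 ≤ a n) → 0 ≤ L a
  eq_lim : ∀ (a : lp (fun _ : ℕ => ℝ) ∞) (x : ℝ), Tendsto (fun n => a n) atTop (𝓝 x) → L a = x

open Classical in
/-- The functional `I` on (uniformly) bounded families `G n : Field D (R n) → ℝ`: the generalized
limit of the regularized expectations. For such families the sequence of expectations is bounded,
so the value `0` of the other case is not taken. -/
def limExpect (L : StrongDual ℝ (lp (fun _ : ℕ => ℝ) ∞)) {R : ℕ → ℝ}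
    (Y : ∀ n, HarmonicBasis D (R n)) (Λ : ℕ → ℝ) (h : Space D → ℝ) {N : ℕ → ℕ}
    (𝓛 : ∀ n, (Fin (N n + 1) → ℝ) → ℝ) (G : ∀ n, Field D (R n) → ℝ) : ℝ :=
  if hG : Memℓp (fun n => expect (Y n) (Λ n) h (𝓛 n) (G n)) ∞ then L ⟨_, hG⟩ else 0

theorem memℓp_expect {R : ℕ → ℝ}
    (Y : ∀ n, HarmonicBasis D (R n)) (Λ : ℕ → ℝ) (h : Space D → ℝ) {N : ℕ → ℕ}
    (𝓛 : ∀ n, (Fin (N n + 1) → ℝ) → ℝ) (G : ∀ n, Field D (R n) → ℝ) {C : ℝ}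
    (hC : ∀ n φ, |G n φ| ≤ C) :
    Memℓp (fun n => expect (Y n) (Λ n) h (𝓛 n) (G n)) ∞ :=
  memℓp_infty ⟨C, by
    rintro _ ⟨n, rfl⟩
    exact abs_expect_le (Y n) (Λ n) h (𝓛 n) (G n) (hC n)⟩

/-- The functional `I` on families `G n : Field D (R n) → [0, ∞]`, by monotone extension from the
bounded ones: `I(G) = sup_M I(min(G, M))`. -/
def limExpectENN (L : StrongDual ℝ (lp (fun _ : ℕ => ℝ) ∞)) {R : ℕ → ℝ}
    (Y : ∀ n, HarmonicBasis D (R n)) (Λ : ℕ → ℝ) (h : Space D → ℝ) {N : ℕ → ℕ}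
    (𝓛 : ∀ n, (Fin (N n + 1) → ℝ) → ℝ) (G : ∀ n, Field D (R n) → ℝ≥0∞) : ℝ≥0∞ :=
  ⨆ M : ℕ, ENNReal.ofReal
    (limExpect L Y Λ h 𝓛 fun n φ => (min (G n φ) (M : ℝ≥0∞)).toReal)

/-- `𝔐 = sup 𝓛 - inf 𝓛`, the supremum of the bounded function `𝓛` after it has been normalized, by
adding a constant, to have infimum `0`. -/
def lagrangianSup {N : ℕ} (𝓛 : (Fin (N + 1) → ℝ) → ℝ) : ℝ := (⨆ x, 𝓛 x) - ⨅ x, 𝓛 x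

/-- `μ` is a (regular Borel) probability measure on `K` with `∫ F̊ dμ = I(F̆)` for every cylindrical
function `F`, where `Φ = F̊`. -/
structure Represents {K : Type*} [TopologicalSpace K] [MeasurableSpace K] (ι : Distr D → K)
    (μ : Measure K) (L : StrongDual ℝ (lp (fun _ : ℕ => ℝ) ∞)) {R : ℕ → ℝ}
    (Y : ∀ n, HarmonicBasis D (R n)) (Λ : ℕ → ℝ) (h : Space D → ℝ) {N : ℕ → ℕ}
    (𝓛 : ∀ n, (Fin (N n + 1) → ℝ) → ℝ) : Prop where
  isProbabilityMeasure : IsProbabilityMeasure μ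
  regular : μ.Regular
  integral_eq : ∀ (m : ℕ) (f : Fin m → Test D) (F : (Fin m → ℝ) →ᵇ ℝ) (Φ : C(K, ℝ)),
    (∀ T, Φ (ι T) = cyl f F T) →
      ∫ x, Φ x ∂μ = limExpect L Y Λ h 𝓛 fun n => breve (Y n) f F

end SphereQFT

end

open SphereQFT

noncomputable section

namespace SphereQFT

variable {D : ℕ}

section

/-! ### The compactification -/

/-! Compactification. Cylindrical functions are bounded, so evaluating all of them at once maps
`Distr D` into a compact product of balls. This map is an embedding because `arctan (T f)` is
cylindrical. The closure of the image is the compactification, and every other one is canonically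
homeomorphic to it.

Measure. The free measure is carried by tempered fields. Such a field defines a linear functional on
test functions. By finite-dimensional duality the functional agrees with a distribution on any
finite set of test functions, so compactness provides a point of `K` that represents it
(`IsCylCompactification.exists_point`). Composition with this map turns the limit functional into a
positive functional on `C(K, ℝ)`. Riesz-Markov-Kakutani then gives the measure, and
Stone-Weierstrass gives its uniqueness.

Rotations. A linear isometry acts on spherical harmonics by finite orthogonal blocks, one for each
degree. It therefore preserves the free Gaussian law (`map_rotField`). It also preserves the action,
because the mollifier is zonal. Isometries `O ⊕ 1` commute with stereographic projection, so the
invariance passes to the limit.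

Reflection positivity. Four ingredients are combined. (a) The covariance `C` of the free field
satisfies `⟨u, C Θu⟩ ≥ 0` for `u` living on the positive side. Equivalently, the odd part `u - Θu`
has a smaller `C`-norm than the even part `u + Θu`. This is the comparison of Dirichlet and Neumann
covariances. It follows from `⟨u, C u⟩ = sup (2 ∫ u w - ‖w‖²)` with the `H¹` norm, since
multiplication of an odd `w` by the sign of the coordinate does not change that norm
(`freeCov_reflection_nonneg`). (b) Positivity of the covariance blocks lets the Gaussian vector and
its reflection be written as a common summand plus two independent identically distributed ones.
Conditionally on the common summand, the expectation of `g` times its reflection is a square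
(`integral_mul_reflection_nonneg`). (c) The action of the region `x_D > 2B/Λ` is an `L²` limit of
functions of fields smeared on the positive side (`exists_isPosCyl_approx`). (d) The remaining strip
around the equator has area at most a constant times `R^D / Λ` once `R ≥ 1`. It spoils positivity by
at most `‖F‖² (exp (𝔐 · area) - 1)`, which tends to zero (`neg_le_expect_reflection`).

Translations. A reflection of `ℝ^D` in a hyperplane that misses the origin is the limit, as `ε =
1/(2R)` tends to zero, of reflections of the spheres in hyperplanes through their centres. Both the
rotation vector fields, which generate the Laplacian, and the pulled-back test functions extend
smoothly to `ε = 0`. The discrepancy between the exact sphere reflection and the Euclidean one is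
thus a jointly smooth function that vanishes at `ε = 0` and has uniformly bounded support. Its
pairing with a field is at most the `H^{-k}` norm of the field times a quantity that tends to zero.
Finiteness of the expected norm, a Markov-type bound and uniform continuity on bounded sets finish
the argument (`Represents.invariantUnder_of_isDeformation`). Translations are products of two
reflections, and all motions follow. -/

theorem continuous_cyl {m : ℕ} (f : Fin m → Test D) (F : (Fin m → ℝ) →ᵇ ℝ) :
    Continuous (cyl f F) :=
  F.continuous.comp (continuous_pi fun i => WeakDual.eval_continuous (f i))

theorem IsCylindrical.continuous {G : Distr D → ℝ} (hG : IsCylindrical G) : Continuous G := by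
  obtain ⟨m, f, F, rfl⟩ := hG
  exact continuous_cyl f F

theorem IsCylindrical.exists_bound {G : Distr D → ℝ} (hG : IsCylindrical G) :
    ∃ C, ∀ T, G T ∈ Metric.closedBall (0 : ℝ) C := by
  obtain ⟨m, f, F, rfl⟩ := hG
  exact ⟨‖F‖, fun T => mem_closedBall_zero_iff.2 (F.norm_coe_le_norm _)⟩

/-- The function `T ↦ arctan (T f)`. -/
theorem isCylindrical_arctan (f : Test D) :
    IsCylindrical fun T : Distr D => Real.arctan (T f) := by
  refine ⟨1, fun _ => f, BoundedContinuousFunction.ofNormedAddCommGroup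
    (fun x : Fin 1 → ℝ => Real.arctan (x 0)) (by fun_prop) (Real.pi / 2) fun x => ?_, rfl⟩
  exact abs_le.2 ⟨(Real.neg_pi_div_two_lt_arctan _).le, (Real.arctan_lt_pi_div_two _).le⟩

/-- All cylindrical functions at once. -/
def cylMap (D : ℕ) (T : Distr D) (G : {G : Distr D → ℝ // IsCylindrical G}) : ℝ := G.1 T

theorem isEmbedding_arctan : IsEmbedding Real.arctan := by
  refine Real.arctan_strictMono.isEmbedding_of_ordConnected ?_
  rw [Real.range_arctan]
  exact Set.ordConnected_Ioo

theorem continuous_cylMap : Continuous (cylMap D) :=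
  continuous_pi fun G => G.2.continuous

/-- The coordinates `arctan (T f)` alone recover the weak-* topology, since `arctan` is an embedding
of `ℝ`. The remaining coordinates are continuous and change nothing. -/
theorem isEmbedding_cylMap : IsEmbedding (cylMap D) := by
  have h1 : IsEmbedding fun (T : Distr D) (f : Test D) => T f :=
    WeakBilin.isEmbedding (B := topDualPairing ℝ (Test D)) ContinuousLinearMap.coe_injective
  have h2 : IsEmbedding (Pi.map fun (_ : Test D) => Real.arctan) :=
    IsEmbedding.piMap fun _ => isEmbedding_arctan
  exact IsEmbedding.of_comp continuous_cylMap (g := fun x (f : Test D) =>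
    x ⟨fun T : Distr D => Real.arctan (T f), isCylindrical_arctan f⟩)
    (continuous_pi fun f => continuous_apply _) (h2.comp h1)

theorem exists_isCylCompactification (D : ℕ) :
    ∃ (K : Type) (_ : TopologicalSpace K) (ι : Distr D → K), IsCylCompactification ι := by
  have hcl : IsClosedEmbedding (Subtype.val : closure (Set.range (cylMap D)) → _) :=
    isClosed_closure.isClosedEmbedding_subtypeVal
  refine ⟨closure (Set.range (cylMap D)), inferInstance,
    fun T => ⟨cylMap D T, subset_closure ⟨T, rfl⟩⟩, ?_, inferInstance, ?_, ?_, ?_, ?_⟩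
  · choose C hC using fun G : {G : Distr D → ℝ // IsCylindrical G} => G.2.exists_bound
    have hK : IsCompact (Set.univ.pi fun G => Metric.closedBall (0 : ℝ) (C G)) :=
      isCompact_univ_pi fun G => isCompact_closedBall _ _
    refine isCompact_iff_compactSpace.1 (hK.of_isClosed_subset isClosed_closure
      (closure_minimal ?_ hK.isClosed))
    rintro _ ⟨T, rfl⟩ G -
    exact hC G T
  · exact isEmbedding_cylMap.codRestrict _ _
  · intro x
    rw [closure_subtype]
    have : Subtype.val '' Set.range (fun T : Distr D => (⟨cylMap D T, subset_closure ⟨T, rfl⟩⟩ :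
        closure (Set.range (cylMap D)))) = Set.range (cylMap D) := by
      rw [← Set.range_comp]; rfl
    rw [this]
    exact x.2
  · intro G hG
    exact ⟨⟨fun x => x.1 ⟨G, hG⟩, (continuous_apply _).comp continuous_subtype_val⟩, fun T => rfl⟩
  · intro x y hxy
    obtain ⟨G, hG⟩ : ∃ G, x.1 G ≠ y.1 G := by
      by_contra! hc
      exact hxy (Subtype.ext (funext hc))
    exact ⟨⟨fun x => x.1 G, (continuous_apply G).comp continuous_subtype_val⟩, G.2, hG⟩

namespace IsCylCompactification

variable {K : Type*} [TopologicalSpace K] {ι : Distr D → K}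

theorem extension_unique (hι : IsCylCompactification ι) {Φ Ψ : C(K, ℝ)}
    (h : ∀ T, Φ (ι T) = Ψ (ι T)) : Φ = Ψ :=
  DFunLike.coe_injective (hι.denseRange.equalizer Φ.continuous Ψ.continuous (funext h))

theorem existsUnique_extension (hι : IsCylCompactification ι) {G : Distr D → ℝ}
    (hG : IsCylindrical G) : ∃! Φ : C(K, ℝ), ∀ T, Φ (ι T) = G T := by
  obtain ⟨Φ, hΦ⟩ := hι.exists_extension G hG
  exact ⟨Φ, hΦ, fun Ψ hΨ => hι.extension_unique fun T => (hΨ T).trans (hΦ T).symm⟩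

/-- A model that does not depend on `K`: the tuple of all extensions is injective, because each
separating function is the unique extension of its own restriction. By density its image is the
closure of the range of `cylMap`. Uniqueness of the compactification follows by comparing two such
models. -/
theorem exists_isClosedEmbedding (hι : IsCylCompactification ι) :
    ∃ E : K → {G : Distr D → ℝ // IsCylindrical G} → ℝ, IsClosedEmbedding E ∧
      (∀ T, E (ι T) = cylMap D T) ∧ Set.range E = closure (Set.range (cylMap D)) := by
  have := hι.compactSpace
  choose Φ hΦ using fun G : {G : Distr D → ℝ // IsCylindrical G} => hι.exists_extension G.1 G.2
  have hE : IsClosedEmbedding fun x G => Φ G x := by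
    refine Continuous.isClosedEmbedding (continuous_pi fun G => (Φ G).continuous) fun x y hxy => ?_
    by_contra hne
    obtain ⟨Ψ, hΨ, hne⟩ := hι.separates x y hne
    refine hne ?_
    rw [hι.extension_unique (Φ := Ψ) (Ψ := Φ ⟨_, hΨ⟩) fun T => (hΦ ⟨_, hΨ⟩ T).symm]
    exact congrFun hxy _
  have hc : ∀ T, (fun G => Φ G (ι T)) = cylMap D T := fun T => funext fun G => hΦ G T
  refine ⟨_, hE, hc, ?_⟩
  have h2 : Set.range (cylMap D) = (fun x G => Φ G x) '' Set.range ι := by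
    rw [← Set.range_comp]
    exact congrArg Set.range (funext fun T => (hc T).symm)
  rw [h2, hE.closure_image_eq, hι.denseRange.closure_range, Set.image_univ]

end IsCylCompactification

theorem existsUnique_homeomorph {K₁ K₂ : Type*} [TopologicalSpace K₁] [TopologicalSpace K₂]
    {ι₁ : Distr D → K₁} {ι₂ : Distr D → K₂} (h₁ : IsCylCompactification ι₁)
    (h₂ : IsCylCompactification ι₂) : ∃! e : K₁ ≃ₜ K₂, ∀ T, e (ι₁ T) = ι₂ T := by
  have := h₂.t2Space
  obtain ⟨E₁, hE₁, hc₁, hr₁⟩ := h₁.exists_isClosedEmbedding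
  obtain ⟨E₂, hE₂, hc₂, hr₂⟩ := h₂.exists_isClosedEmbedding
  let e : K₁ ≃ₜ K₂ := (hE₁.isEmbedding.toHomeomorph.trans
    (Homeomorph.setCongr (hr₁.trans hr₂.symm))).trans hE₂.isEmbedding.toHomeomorph.symm
  have he : ∀ T, e (ι₁ T) = ι₂ T := fun T => by
    refine hE₂.injective ?_
    have h3 : ∀ x, E₂ (e x) = E₁ x := fun x => congrArg Subtype.val
      (hE₂.isEmbedding.toHomeomorph.apply_symm_apply
        (Homeomorph.setCongr (hr₁.trans hr₂.symm) (hE₁.isEmbedding.toHomeomorph x)))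
    rw [h3, hc₁, hc₂]
  refine ⟨e, he, fun e' he' => ?_⟩
  refine Homeomorph.ext fun x => congrFun (h₁.denseRange.equalizer e'.continuous e.continuous
    (funext fun T => ?_)) x
  exact (he' T).trans (he T).symm

end

/-! ### The surface measure -/

/-- The isometry `v ↦ c + A (v - c)` of `S_R`, `c` the centre, for a linear isometry `A`. -/
def sphereIso (R : ℝ) (A : Ambient D ≃ₗᵢ[ℝ] Ambient D) (v : Ambient D) : Ambient D :=
  center D R + A (v - center D R)

theorem contDiff_sphereIso (R : ℝ) (A : Ambient D ≃ₗᵢ[ℝ] Ambient D) :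
    ContDiff ℝ ∞ (sphereIso R A) :=
  contDiff_const.add (A.toContinuousLinearEquiv.contDiff.comp (contDiff_id.sub contDiff_const))

theorem continuous_sphereIso (R : ℝ) (A : Ambient D ≃ₗᵢ[ℝ] Ambient D) :
    Continuous (sphereIso R A) := (contDiff_sphereIso R A).continuous

theorem sphereIso_symm_apply (R : ℝ) (A : Ambient D ≃ₗᵢ[ℝ] Ambient D) (v : Ambient D) :
    sphereIso R A.symm (sphereIso R A v) = v := by
  simp [sphereIso]

theorem sphereIso_apply_symm (R : ℝ) (A : Ambient D ≃ₗᵢ[ℝ] Ambient D) (v : Ambient D) :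
    sphereIso R A (sphereIso R A.symm v) = v := by
  simp [sphereIso]

theorem sphereIso_mem {R : ℝ} (A : Ambient D ≃ₗᵢ[ℝ] Ambient D) {v : Ambient D}
    (hv : v ∈ Metric.sphere (center D R) R) :
    sphereIso R A v ∈ Metric.sphere (center D R) R := by
  rw [mem_sphere_iff_norm] at hv ⊢
  rw [sphereIso, add_sub_cancel_left, A.norm_map, hv]

instance (R : ℝ) : IsFiniteMeasure (surface D R) := by
  unfold surface
  exact Measure.smul_finite _ ENNReal.ofReal_ne_top

theorem measurable_param (D : ℕ) (R : ℝ) : Measurable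
    fun w : Metric.sphere (0 : Ambient D) 1 => center D R + R • (w : Ambient D) := by fun_prop

theorem ae_mem_sphere {R : ℝ} (hR : 0 < R) :
    ∀ᵐ v ∂surface D R, v ∈ Metric.sphere (center D R) R := by
  refine Measure.ae_smul_measure ?_ _
  refine (ae_map_iff (measurable_param D R).aemeasurable
    ((Metric.isClosed_sphere (x := center D R) (ε := R)).measurableSet)).2 ?_
  refine Eventually.of_forall fun w => ?_
  have := mem_sphere_iff_norm.1 w.2
  rw [sub_zero] at this
  simp [norm_smul, this, hR.le]

/-- The action of a linear isometry on the unit sphere. -/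
def unitSphereMap (A : Ambient D ≃ₗᵢ[ℝ] Ambient D) (w : Metric.sphere (0 : Ambient D) 1) :
    Metric.sphere (0 : Ambient D) 1 := ⟨A w, by simp⟩

theorem measurable_unitSphereMap (A : Ambient D ≃ₗᵢ[ℝ] Ambient D) :
    Measurable (unitSphereMap A) :=
  Measurable.subtype_mk (A.continuous.measurable.comp measurable_subtype_coe)

/-- `toSphere` measures a set by the volume of the cone over it, and a linear isometry maps cones to
cones and preserves volume. -/
theorem map_toSphere (A : Ambient D ≃ₗᵢ[ℝ] Ambient D) :
    (volume : Measure (Ambient D)).toSphere.map (unitSphereMap A) =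
    (volume : Measure (Ambient D)).toSphere := by
  have hm := measurable_unitSphereMap A
  ext s hs
  rw [Measure.map_apply hm hs, Measure.toSphere_apply' _ (hm hs), Measure.toSphere_apply' _ hs]
  congr 1
  conv_rhs => rw [← (A.measurePreserving).measure_preimage_equiv (f := A.toMeasurableEquiv)]
  congr 1
  ext x
  constructor
  · rintro ⟨r, hr, _, ⟨w, hw, rfl⟩, rfl⟩
    exact ⟨r, hr, _, ⟨_, hw, rfl⟩, (A.map_smul r w.1).symm⟩
  · rintro ⟨r, hr, _, ⟨w, hw, rfl⟩, hx⟩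
    refine ⟨r, hr, A.symm w, ⟨⟨A.symm w, by simp⟩, ?_, rfl⟩, ?_⟩
    · have : unitSphereMap A ⟨A.symm w, by simp⟩ = w := Subtype.ext (A.apply_symm_apply w.1)
      rwa [Set.mem_preimage, this]
    · refine A.injective ?_
      simpa using hx

theorem measurePreserving_sphereIso (R : ℝ) (A : Ambient D ≃ₗᵢ[ℝ] Ambient D) :
    MeasurePreserving (sphereIso R A) (surface D R) (surface D R) := by
  refine ⟨(continuous_sphereIso R A).measurable, ?_⟩
  unfold surface
  rw [Measure.map_smul]
  congr 1
  rw [Measure.map_map (continuous_sphereIso R A).measurable (measurable_param D R)]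
  conv_rhs => rw [← map_toSphere A]
  rw [Measure.map_map (measurable_param D R) (measurable_unitSphereMap A)]
  congr 1
  ext w : 1
  simp [sphereIso, unitSphereMap]

/-- `v ↦ c + A (v - c)` as a homeomorphism. -/
def sphereIsoHomeo (R : ℝ) (A : Ambient D ≃ₗᵢ[ℝ] Ambient D) : Ambient D ≃ₜ Ambient D where
  toFun := sphereIso R A
  invFun := sphereIso R A.symm
  left_inv := sphereIso_symm_apply R A
  right_inv := sphereIso_apply_symm R A
  continuous_toFun := continuous_sphereIso R A
  continuous_invFun := continuous_sphereIso R A.symm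

theorem integral_comp_sphereIso (R : ℝ) (A : Ambient D ≃ₗᵢ[ℝ] Ambient D) (u : Ambient D → ℝ) :
    ∫ v, u (sphereIso R A v) ∂surface D R = ∫ v, u v ∂surface D R :=
  (measurePreserving_sphereIso R A).integral_comp (sphereIsoHomeo R A).measurableEmbedding u

/-- After rescaling to the unit sphere, the cone over the set lies in the box with half-sides `b i`.
The factor `D + 1` is the dimension factor in the definition of `toSphere`. -/
theorem surface_box_le {R : ℝ} (hR : 0 < R) (b : Fin (D + 1) → ℝ) :
    surface D R {v | ∀ i, |(v - center D R) i| ≤ R * b i} ≤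
      ENNReal.ofReal (R ^ D * (D + 1) * ∏ i, (2 * b i)) := by
  by_cases hb : ∀ i, 0 ≤ b i
  swap
  · have : {v : Ambient D | ∀ i, |(v - center D R) i| ≤ R * b i} = ∅ := by
      push Not at hb
      obtain ⟨i, hi⟩ := hb
      refine Set.eq_empty_of_forall_notMem fun v hv => ?_
      exact absurd ((abs_nonneg _).trans (hv i)) (not_le.2 (mul_neg_of_pos_of_neg hR hi))
    rw [this, measure_empty]
    exact bot_le
  have hms : MeasurableSet {v : Ambient D | ∀ i, |(v - center D R) i| ≤ R * b i} := by
    simp only [Set.ofPred_forall]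
    exact MeasurableSet.iInter fun i => measurableSet_le (by fun_prop) measurable_const
  unfold surface
  rw [Measure.smul_apply, Measure.map_apply (measurable_param D R) hms,
    Measure.toSphere_apply' _ (measurable_param D R hms), smul_eq_mul, mul_assoc (R ^ D),
    ENNReal.ofReal_mul (by positivity), ENNReal.ofReal_mul (by positivity)]
  gcongr
  · rw [finrank_euclideanSpace_fin]
    exact_mod_cast (ENNReal.ofReal_natCast (D + 1)).ge
  · refine (measure_mono (t := (@WithLp.ofLp 2 (Fin (D + 1) → ℝ)) ⁻¹'
      Set.Icc (-b) b) ?_).trans ?_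
    · rintro _ ⟨r, ⟨hr0, hr1⟩, _, ⟨w, hw, rfl⟩, rfl⟩
      have h3 : ∀ i, |r * (w : Ambient D) i| ≤ b i := fun i => by
        have h1 := hw i
        simp only [add_sub_cancel_left, PiLp.smul_apply, smul_eq_mul, abs_mul, abs_of_pos hR] at h1
        have h2 := le_of_mul_le_mul_left h1 hR
        rw [abs_mul, abs_of_pos hr0]
        exact (mul_le_of_le_one_left (abs_nonneg _) hr1.le).trans h2
      exact ⟨fun i => (abs_le.1 (h3 i)).1, fun i => (abs_le.1 (h3 i)).2⟩
    · rw [(PiLp.volume_preserving_ofLp (Fin (D + 1))).measure_preimage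
        measurableSet_Icc.nullMeasurableSet, Real.volume_Icc_pi,
        ENNReal.ofReal_prod_of_nonneg fun i _ => by have := hb i; positivity]
      refine le_of_eq (Finset.prod_congr rfl fun i _ => ?_)
      congr 1
      simp only [Pi.neg_apply]
      ring

/-- The part of the sphere near the vertical axis. -/
theorem surface_axis_le {R : ℝ} (hR : 0 < R) (a : ℝ) :
    surface D R {v | v ∈ Metric.sphere (center D R) R ∧ ∀ i : Fin D, |v i.castSucc| ≤ a} ≤
      ENNReal.ofReal (2 * (D + 1) * (2 * a) ^ D) := by
  -- The vertical coordinate gets the trivial bound 1, so the powers of `R` cancel and the estimate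
  -- is uniform in `R`.
  refine (measure_mono ?_).trans ((surface_box_le hR
    (Fin.snoc (fun _ : Fin D => a / R) 1 : Fin (D + 1) → ℝ)).trans (le_of_eq ?_))
  · rintro v ⟨hv, h⟩ i
    refine Fin.lastCases ?_ (fun i => ?_) i
    · rw [mem_sphere_iff_norm] at hv
      simpa [hv] using PiLp.norm_apply_le (v - center D R) (Fin.last D)
    · have : (center D R) i.castSucc = 0 := by
        simp [center, (Fin.castSucc_lt_last i).ne]
      rw [PiLp.sub_apply, this, sub_zero, Fin.snoc_castSucc, mul_div_cancel₀ _ hR.ne']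
      exact h i
  · congr 1
    rw [Fin.prod_univ_castSucc]
    simp only [Fin.snoc_castSucc, Fin.snoc_last, Finset.prod_const, Finset.card_univ,
      Fintype.card_fin]
    rw [show 2 * (a / R) = 2 * a / R by ring, div_pow]
    field_simp

theorem surface_strip_le {R : ℝ} (hR : 0 < R) (a : ℝ) (j : Fin D) :
    surface D R {v | v ∈ Metric.sphere (center D R) R ∧ |v j.castSucc| ≤ a} ≤
      ENNReal.ofReal ((D + 1) * 2 ^ (D + 1) * (R ^ D * a / R)) := by
  refine (measure_mono ?_).trans ((surface_box_le hR
    (Function.update 1 j.castSucc (a / R) : Fin (D + 1) → ℝ)).trans (le_of_eq ?_))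
  · rintro v ⟨hv, h⟩ i
    by_cases hi : i = j.castSucc
    · subst hi
      have : (center D R) j.castSucc = 0 := by
        simp [center, (Fin.castSucc_lt_last j).ne]
      rw [PiLp.sub_apply, this, sub_zero, Function.update_self, mul_div_cancel₀ _ hR.ne']
      exact h
    · rw [mem_sphere_iff_norm] at hv
      rw [Function.update_of_ne hi]
      simpa [hv] using PiLp.norm_apply_le (v - center D R) i
  · congr 1
    rw [Finset.prod_mul_distrib, Finset.prod_update_of_mem (Finset.mem_univ _)]
    simp only [Finset.prod_const, Finset.card_univ, Fintype.card_fin, Pi.one_apply, one_pow]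
    ring

/-- The surface measure charges every nonempty open subset of the sphere. -/
theorem eqOn_zero_of_integral_eq_zero {R : ℝ} (hR : 0 < R) {g : Ambient D → ℝ}
    (hg : Continuous g) (h0 : g =ᵐ[surface D R] 0) :
    ∀ v ∈ Metric.sphere (center D R) R, g v = 0 := by
  have h1 : (fun v => g v) =ᵐ[Measure.map
      (fun w : Metric.sphere (0 : Ambient D) 1 => center D R + R • (w : Ambient D))
      (volume : Measure (Ambient D)).toSphere] 0 := by
    unfold surface at h0
    exact (Measure.ae_ennreal_smul_measure_iff (ENNReal.ofReal_pos.2 (by positivity)).ne').1 h0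
  have h2 := ae_of_ae_map (measurable_param D R).aemeasurable h1
  have h3 := Continuous.ae_eq_iff_eq (volume : Measure (Ambient D)).toSphere
    (f := fun w : Metric.sphere (0 : Ambient D) 1 => g (center D R + R • (w : Ambient D)))
    (g := fun _ => 0) (by fun_prop) (by fun_prop) |>.1 h2
  intro v hv
  rw [mem_sphere_iff_norm] at hv
  have h4 := congrFun h3 ⟨R⁻¹ • (v - center D R), by
    simp [norm_smul, hv, abs_of_pos hR, hR.ne']⟩
  simpa [smul_smul, hR.ne'] using h4

/-! ### Rotation fields and the Laplace-Beltrami operator -/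

theorem exists_bound_on_sphere {U : Ambient D → ℝ} (hU : Continuous U) (R : ℝ) :
    ∃ C, ∀ v ∈ Metric.sphere (center D R) R, ‖U v‖ ≤ C :=
  (isCompact_sphere _ _).exists_bound_of_continuousOn hU.continuousOn

theorem memLp_of_continuous {R : ℝ} (hR : 0 < R) {U : Ambient D → ℝ} (hU : Continuous U)
    (p : ℝ≥0∞) : MemLp U p (surface D R) := by
  obtain ⟨C, hC⟩ := exists_bound_on_sphere hU R
  exact MemLp.of_bound hU.aestronglyMeasurable C ((ae_mem_sphere hR).mono hC)

theorem integrable_of_continuous {R : ℝ} (hR : 0 < R) {U : Ambient D → ℝ} (hU : Continuous U) :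
    Integrable U (surface D R) :=
  memLp_one_iff_integrable.1 (memLp_of_continuous hR hU 1)

/-- The vector field `m_a e_b - m_b e_a`, `m = 2 ε v - e_last`. For `ε = 1 / (2 R)` it generates
a rotation of `S_R` with speed one at the origin. -/
def rotVec (ε : ℝ) (a b : Fin (D + 1)) (v : Ambient D) : Ambient D :=
  ((2 * ε) • v - EuclideanSpace.single (Fin.last D) (1 : ℝ)) a • EuclideanSpace.single b 1 -
    ((2 * ε) • v - EuclideanSpace.single (Fin.last D) (1 : ℝ)) b • EuclideanSpace.single a 1

/-- The derivative along `rotVec`. -/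
def rotD (ε : ℝ) (a b : Fin (D + 1)) (U : Ambient D → ℝ) (v : Ambient D) : ℝ :=
  fderiv ℝ U v (rotVec ε a b v)

/-- The Laplace-Beltrami operator of `S_R`, `ε = 1 / (2 R)`, on functions on the ambient space. -/
def lap (ε : ℝ) (U : Ambient D → ℝ) (v : Ambient D) : ℝ :=
  (∑ a, ∑ b, rotD ε a b (rotD ε a b U) v) / 2

/-- The operator `1 - ∇²`. -/
def oneSubLap (ε : ℝ) (U : Ambient D → ℝ) (v : Ambient D) : ℝ := U v - lap ε U v

/-- A family of functions which is jointly smooth in the parameter and the point. -/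
abbrev JointSmooth (G : ℝ → Ambient D → ℝ) : Prop :=
  ContDiff ℝ ∞ fun p : ℝ × Ambient D => G p.1 p.2

theorem JointSmooth.slice {G : ℝ → Ambient D → ℝ} (hG : JointSmooth G) (ε : ℝ) :
    ContDiff ℝ ∞ (G ε) :=
  hG.comp (contDiff_const.prodMk contDiff_id)

theorem jointSmooth_const {U : Ambient D → ℝ} (hU : ContDiff ℝ ∞ U) : JointSmooth fun _ => U :=
  hU.comp contDiff_snd

theorem JointSmooth.sub {G H : ℝ → Ambient D → ℝ} (hG : JointSmooth G) (hH : JointSmooth H) :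
    JointSmooth fun ε v => G ε v - H ε v :=
  ContDiff.sub hG hH

/-- The coefficients are affine in `ε`, so the operators built from them persist at `ε = 0`. There
`lap` becomes the flat Laplacian in the horizontal directions. All estimates that are uniform as `R
→ ∞` rest on this. -/
theorem contDiff_rotVec (a b : Fin (D + 1)) :
    ContDiff ℝ ∞ fun p : ℝ × Ambient D => rotVec p.1 a b p.2 := by
  unfold rotVec
  simp only [PiLp.sub_apply, PiLp.smul_apply, smul_eq_mul]
  fun_prop

theorem JointSmooth.rotD {G : ℝ → Ambient D → ℝ} (hG : JointSmooth G) (a b : Fin (D + 1)) :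
    JointSmooth fun ε => rotD ε a b (G ε) :=
  ContDiff.fderiv_apply (f := fun p : ℝ × Ambient D => G p.1) (m := ∞) (n := ∞)
    (hG.comp ((contDiff_fst.comp contDiff_fst).prodMk contDiff_snd)) contDiff_snd
    (contDiff_rotVec a b) (by simp)

theorem JointSmooth.lap {G : ℝ → Ambient D → ℝ} (hG : JointSmooth G) :
    JointSmooth fun ε => lap ε (G ε) :=
  ContDiff.div_const (ContDiff.sum fun a _ => ContDiff.sum fun b _ => (hG.rotD a b).rotD a b) 2

theorem JointSmooth.oneSubLap {G : ℝ → Ambient D → ℝ} (hG : JointSmooth G) :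
    JointSmooth fun ε => oneSubLap ε (G ε) :=
  hG.sub hG.lap

theorem JointSmooth.oneSubLap_iterate {G : ℝ → Ambient D → ℝ} (hG : JointSmooth G) (j : ℕ) :
    JointSmooth fun ε => (SphereQFT.oneSubLap ε)^[j] (G ε) := by
  induction j with
  | zero => exact hG
  | succ j ih =>
    simp only [Function.iterate_succ_apply']
    exact ih.oneSubLap

theorem contDiff_rotD {U : Ambient D → ℝ} (hU : ContDiff ℝ ∞ U) (ε : ℝ) (a b : Fin (D + 1)) :
    ContDiff ℝ ∞ (rotD ε a b U) := ((jointSmooth_const hU).rotD a b).slice ε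

theorem contDiff_lap {U : Ambient D → ℝ} (hU : ContDiff ℝ ∞ U) (ε : ℝ) :
    ContDiff ℝ ∞ (lap ε U) := (jointSmooth_const hU).lap.slice ε

theorem contDiff_oneSubLap {U : Ambient D → ℝ} (hU : ContDiff ℝ ∞ U) (ε : ℝ) :
    ContDiff ℝ ∞ (oneSubLap ε U) := (jointSmooth_const hU).oneSubLap.slice ε

theorem contDiff_oneSubLap_iterate {U : Ambient D → ℝ} (hU : ContDiff ℝ ∞ U) (ε : ℝ) (j : ℕ) :
    ContDiff ℝ ∞ ((oneSubLap ε)^[j] U) :=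
  ((jointSmooth_const hU).oneSubLap_iterate j).slice ε

theorem contDiff_lap_iterate {U : Ambient D → ℝ} (hU : ContDiff ℝ ∞ U) (ε : ℝ) (j : ℕ) :
    ContDiff ℝ ∞ ((lap ε)^[j] U) := by
  induction j with
  | zero => exact hU
  | succ j ih =>
    rw [Function.iterate_succ_apply']
    exact contDiff_lap ih ε

theorem tsupport_rotD_subset (U : Ambient D → ℝ) (ε : ℝ) (a b : Fin (D + 1)) :
    tsupport (rotD ε a b U) ⊆ tsupport U := by
  refine closure_minimal (fun v hv => ?_) (isClosed_tsupport U)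
  by_contra hc
  refine hv ?_
  simp only [rotD, fderiv_of_notMem_tsupport ℝ hc, _root_.zero_apply]

theorem tsupport_lap_subset (U : Ambient D → ℝ) (ε : ℝ) :
    tsupport (lap ε U) ⊆ tsupport U := by
  refine closure_minimal (fun v hv => ?_) (isClosed_tsupport U)
  by_contra hc
  refine hv ?_
  have : ∀ a b, rotD ε a b (rotD ε a b U) v = 0 := fun a b =>
    image_eq_zero_of_notMem_tsupport fun h =>
      hc (tsupport_rotD_subset _ _ _ _ (tsupport_rotD_subset _ _ _ _ h))
  simp [lap, this]

theorem tsupport_lap_iterate_subset (U : Ambient D → ℝ) (ε : ℝ) (j : ℕ) :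
    tsupport ((lap ε)^[j] U) ⊆ tsupport U := by
  induction j with
  | zero => exact subset_rfl
  | succ j ih =>
    rw [Function.iterate_succ_apply']
    exact (tsupport_lap_subset _ _).trans ih

theorem tsupport_oneSubLap_subset (U : Ambient D → ℝ) (ε : ℝ) :
    tsupport (oneSubLap ε U) ⊆ tsupport U := by
  refine closure_minimal (fun v hv => ?_) (isClosed_tsupport U)
  by_contra hc
  refine hv ?_
  simp [oneSubLap, image_eq_zero_of_notMem_tsupport hc,
    image_eq_zero_of_notMem_tsupport fun h => hc (tsupport_lap_subset U ε h)]

theorem tsupport_oneSubLap_iterate_subset (U : Ambient D → ℝ) (ε : ℝ) (j : ℕ) :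
    tsupport ((oneSubLap ε)^[j] U) ⊆ tsupport U := by
  induction j with
  | zero => exact subset_rfl
  | succ j ih =>
    rw [Function.iterate_succ_apply']
    exact (tsupport_oneSubLap_subset _ _).trans ih

theorem rotD_mul {U V : Ambient D → ℝ} (hU : ContDiff ℝ ∞ U) (hV : ContDiff ℝ ∞ V) (ε : ℝ)
    (a b : Fin (D + 1)) (v : Ambient D) :
    rotD ε a b (fun v => U v * V v) v = U v * rotD ε a b V v + rotD ε a b U v * V v := by
  simp only [rotD]
  rw [fderiv_fun_mul (hU.differentiable (by simp) v) (hV.differentiable (by simp) v)]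
  simp [mul_comm]

/-- The action of a reflection on `S_R`. -/
theorem sphereIso_reflection (R : ℝ) (n v : Ambient D) :
    sphereIso R (Submodule.reflection (ℝ ∙ n)ᗮ) v =
      v - (2 * (inner ℝ n (v - center D R) / ‖n‖ ^ 2)) • n := by
  rw [sphereIso, Submodule.reflection_orthogonal_apply, Submodule.reflection_singleton_apply]
  simp only [RCLike.ofReal_real_eq_id, id_eq, two_smul, two_mul, add_smul]
  abel

/-- The reflections with normals `e_a + s e_b` preserve the surface measure, so the integral of `U`
composed with them does not depend on `s`. Its derivative at `s = 0` is the integral of a multiple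
of `rotD`, evaluated at the reflected point. Hence no one-parameter group of rotations is required.
-/
theorem integral_rotD {R : ℝ} (hR : 0 < R) {U : Ambient D → ℝ} (hU : ContDiff ℝ ∞ U)
    (a b : Fin (D + 1)) : ∫ v, rotD (1 / (2 * R)) a b U v ∂surface D R = 0 := by
  by_cases hab : a = b
  · subst hab
    simp [rotD, rotVec]
  let c := center D R
  let n : ℝ → Ambient D := fun s => EuclideanSpace.single a (1 : ℝ) + s • EuclideanSpace.single b (1 : ℝ)
  have hn : ∀ s, ‖n s‖ ^ 2 = 1 + s ^ 2 := by
    intro s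
    rw [← real_inner_self_eq_norm_sq]
    simp only [n, inner_add_left, inner_add_right, inner_smul_left, inner_smul_right,
      EuclideanSpace.inner_single_left]
    simp [hab, Ne.symm hab]
    ring
  let γ : ℝ → Ambient D → Ambient D := fun s v =>
    v - (2 * (((v - c) a + s * (v - c) b) / (1 + s ^ 2))) • n s
  have hγ : ∀ s v, sphereIso R (Submodule.reflection (ℝ ∙ n s)ᗮ) v = γ s v := by
    intro s v
    rw [sphereIso_reflection, hn]
    simp [γ, n, inner_add_left, inner_smul_left, EuclideanSpace.inner_single_left, c]
  have hγs : ContDiff ℝ ∞ fun p : ℝ × Ambient D => γ p.1 p.2 := by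
    have hne : ∀ p : ℝ × Ambient D, 1 + p.1 ^ 2 ≠ 0 := fun p => by positivity
    simp only [γ, n, PiLp.sub_apply]
    refine contDiff_snd.sub (ContDiff.smul (contDiff_const.mul (ContDiff.div ?_ ?_ hne)) ?_) <;>
      fun_prop
  have hF : ContDiff ℝ ∞ fun p : ℝ × Ambient D => U (γ p.1 p.2) := hU.comp hγs
  let F' : ℝ → Ambient D → ℝ := fun s v => fderiv ℝ (fun s => U (γ s v)) s 1
  have hF' : Continuous fun p : ℝ × Ambient D => F' p.1 p.2 :=
    (ContDiff.fderiv_apply (f := fun (p : ℝ × Ambient D) s => U (γ s p.2)) (m := ∞) (n := ∞)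
      (hF.comp (contDiff_snd.prodMk (contDiff_snd.comp contDiff_fst))) contDiff_fst
      contDiff_const (by simp)).continuous
  obtain ⟨C, hC⟩ := ((isCompact_Icc (a := (-1 : ℝ)) (b := 1)).prod
    (isCompact_sphere c R)).exists_bound_of_continuousOn hF'.continuousOn
  have key := (hasDerivAt_integral_of_dominated_loc_of_deriv_le (μ := surface D R)
    (F := fun s v => U (γ s v)) (F' := F') (x₀ := 0) (s := Set.Icc (-1) 1) (bound := fun _ => C)
    (Icc_mem_nhds (by norm_num) (by norm_num))
    (Eventually.of_forall fun s => (hF.comp (contDiff_const.prodMk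
      contDiff_id)).continuous.aestronglyMeasurable)
    (integrable_of_continuous hR (hF.comp (contDiff_const.prodMk contDiff_id)).continuous)
    (hF'.comp (Continuous.prodMk_right 0)).aestronglyMeasurable
    ((ae_mem_sphere hR).mono fun v hv s hs => hC (s, v) ⟨hs, hv⟩)
    (integrable_const C)
    (Eventually.of_forall fun v s _ => by
      have : DifferentiableAt ℝ (fun s => U (γ s v)) s :=
        (hF.comp (contDiff_id.prodMk contDiff_const)).differentiable (by simp) s
      exact this.hasFDerivAt.hasDerivAt)).2
  have hconst : (fun s => ∫ v, U (γ s v) ∂surface D R) = fun _ => ∫ v, U v ∂surface D R := by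
    ext s
    simp only [← hγ]
    exact integral_comp_sphereIso R _ U
  rw [hconst] at key
  have h0 := (hasDerivAt_const (0 : ℝ) (∫ v, U v ∂surface D R)).unique key
  -- `γ s` is `γ 0` followed by the rotation by the angle `2 arctan s` in the `(a, b)`-plane, which
  -- has angular speed 2 at `s = 0`. The field `rotVec` has angular speed `1 / R`, hence the factor
  -- `2 R`.
  have hF0 : ∀ v, F' 0 v = 2 * R * rotD (1 / (2 * R)) a b U (γ 0 v) := by
    intro v
    have h1 : HasDerivAt (fun s => γ s v)
        (-(2 * (v - c) b) • EuclideanSpace.single a 1 -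
          (2 * (v - c) a) • EuclideanSpace.single b 1 : Ambient D) 0 := by
      have h2 : HasDerivAt (fun s : ℝ => 2 * (((v - c) a + s * (v - c) b) / (1 + s ^ 2)))
          (2 * (v - c) b) 0 := by
        have h3 : HasDerivAt (fun s : ℝ => (v - c) a + s * (v - c) b) ((v - c) b) 0 := by
          simpa using ((hasDerivAt_id (0 : ℝ)).mul_const ((v - c) b)).const_add ((v - c) a)
        have h4 : HasDerivAt (fun s : ℝ => 1 + s ^ 2) 0 0 := by
          simpa using ((hasDerivAt_id (0 : ℝ)).pow 2).const_add 1
        simpa using (h3.div h4 (by norm_num)).const_mul 2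
      have h5 : HasDerivAt n (EuclideanSpace.single b 1) 0 := by
        have := ((hasDerivAt_id (0 : ℝ)).smul_const (EuclideanSpace.single b (1 : ℝ) :
          Ambient D)).const_add (EuclideanSpace.single a (1 : ℝ) : Ambient D)
        rw [one_smul] at this
        exact this
      have h6 := (h2.smul h5).const_sub v
      refine h6.congr_deriv ?_
      simp [n]
      module
    have h7 : F' 0 v = fderiv ℝ U (γ 0 v) (-(2 * (v - c) b) • EuclideanSpace.single a 1 -
          (2 * (v - c) a) • EuclideanSpace.single b 1) := by
      have h8 := ((hU.differentiable (by simp) (γ 0 v)).hasFDerivAt.comp_hasDerivAt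
        (0 : ℝ) h1).deriv
      rw [← h8]
      exact fderiv_apply_one_eq_deriv
    rw [h7, rotD, ← smul_eq_mul (2 * R), ← map_smul]
    congr 1
    have e1 : ∀ i, ((2 * (1 / (2 * R))) • γ 0 v - EuclideanSpace.single (Fin.last D) 1 :
        Ambient D) i = (γ 0 v - c) i / R := by
      intro i
      have : c i = R * (EuclideanSpace.single (Fin.last D) 1 : Ambient D) i := by
        simp [c, center]
      simp only [PiLp.sub_apply, PiLp.smul_apply, smul_eq_mul, this]
      field_simp
    have e2 : (γ 0 v - c) a = -(v - c) a := by
      simp [γ, n]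
      ring
    have e3 : (γ 0 v - c) b = (v - c) b := by
      simp [γ, n, Ne.symm hab]
    rw [rotVec, e1, e1, e2, e3, smul_sub, smul_smul, smul_smul]
    rw [show 2 * R * (-(v - c) a / R) = -(2 * (v - c) a) by field_simp,
      show 2 * R * ((v - c) b / R) = 2 * (v - c) b by field_simp]
    module
  simp only [hF0, ← hγ, integral_const_mul] at h0
  rw [integral_comp_sphereIso R _ (rotD (1 / (2 * R)) a b U)] at h0
  exact (mul_eq_zero.1 h0.symm).resolve_left (by positivity)

theorem integral_rotD_mul {R : ℝ} (hR : 0 < R) {U V : Ambient D → ℝ} (hU : ContDiff ℝ ∞ U)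
    (hV : ContDiff ℝ ∞ V) (a b : Fin (D + 1)) :
    ∫ v, U v * rotD (1 / (2 * R)) a b V v ∂surface D R =
      -∫ v, rotD (1 / (2 * R)) a b U v * V v ∂surface D R := by
  have h := integral_rotD hR (hU.mul hV) a b
  simp only [rotD_mul hU hV] at h
  rw [integral_add] at h
  · linarith
  · exact integrable_of_continuous hR (hU.continuous.mul (contDiff_rotD hV _ a b).continuous)
  · exact integrable_of_continuous hR ((contDiff_rotD hU _ a b).continuous.mul hV.continuous)

/-- Green's formula. -/
theorem integral_mul_lap {R : ℝ} (hR : 0 < R) {U V : Ambient D → ℝ} (hU : ContDiff ℝ ∞ U)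
    (hV : ContDiff ℝ ∞ V) :
    ∫ v, U v * lap (1 / (2 * R)) V v ∂surface D R =
      -((∑ a, ∑ b, ∫ v, rotD (1 / (2 * R)) a b U v * rotD (1 / (2 * R)) a b V v
        ∂surface D R) / 2) := by
  have hi : ∀ a b, Integrable (fun v => U v * rotD (1 / (2 * R)) a b
      (rotD (1 / (2 * R)) a b V) v) (surface D R) := fun a b =>
    integrable_of_continuous hR (hU.continuous.mul
      (contDiff_rotD (contDiff_rotD hV _ a b) _ a b).continuous)
  simp only [lap, mul_div_assoc', Finset.mul_sum]
  rw [integral_div, integral_finsetSum _ fun a _ => integrable_finsetSum _ fun b _ => hi a b]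
  simp only [integral_finsetSum _ fun b _ => hi _ b]
  simp only [integral_rotD_mul hR hU (contDiff_rotD hV _ _ _), Finset.sum_neg_distrib, neg_div]

theorem integral_lap_mul {R : ℝ} (hR : 0 < R) {U V : Ambient D → ℝ} (hU : ContDiff ℝ ∞ U)
    (hV : ContDiff ℝ ∞ V) :
    ∫ v, lap (1 / (2 * R)) U v * V v ∂surface D R =
      ∫ v, U v * lap (1 / (2 * R)) V v ∂surface D R := by
  rw [integral_mul_lap hR hU hV]
  simp only [mul_comm (lap _ _ _)]
  rw [integral_mul_lap hR hV hU]
  simp only [mul_comm]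

/-! ### Polynomials on the sphere -/

open MvPolynomial in
/-- The function given by a polynomial in the coordinates relative to the centre. -/
def polyFun (R : ℝ) (p : MvPolynomial (Fin (D + 1)) ℝ) (v : Ambient D) : ℝ :=
  eval (fun i => (v - center D R) i) p

open MvPolynomial

theorem contDiff_polyFun (R : ℝ) (p : MvPolynomial (Fin (D + 1)) ℝ) :
    ContDiff ℝ ∞ (polyFun R p) := by
  induction p using MvPolynomial.induction_on with
  | C a =>
    have : polyFun (D := D) R (C a) = fun _ => a := by ext; simp [polyFun]
    rw [this]
    exact contDiff_const
  | add p q hp hq =>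
    have : polyFun R (p + q) = fun v => polyFun R p v + polyFun R q v := by
      ext; simp [polyFun]
    rw [this]
    exact hp.add hq
  | mul_X p i hp =>
    have : polyFun R (p * X i) = fun v => polyFun R p v * (v i - center D R i) := by
      ext; simp [polyFun]
    rw [this]
    exact hp.mul (by fun_prop)

theorem continuous_polyFun (R : ℝ) (p : MvPolynomial (Fin (D + 1)) ℝ) :
    Continuous (polyFun R p) := (contDiff_polyFun R p).continuous

theorem fderiv_polyFun (R : ℝ) (p : MvPolynomial (Fin (D + 1)) ℝ) (v x : Ambient D) :
    fderiv ℝ (polyFun R p) v x = ∑ i, x i * polyFun R (pderiv i p) v := by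
  induction p using MvPolynomial.induction_on with
  | C a =>
    have : polyFun (D := D) R (C a) = fun _ => a := by ext; simp [polyFun]
    rw [this]
    simp [polyFun]
  | add p q hp hq =>
    have : polyFun R (p + q) = fun v => polyFun R p v + polyFun R q v := by
      ext; simp [polyFun]
    rw [this, fderiv_fun_add ((contDiff_polyFun R p).differentiable (by simp) v)
      ((contDiff_polyFun R q).differentiable (by simp) v), _root_.add_apply, hp, hq,
      ← Finset.sum_add_distrib]
    simp [polyFun, mul_add]
  | mul_X p i hp =>
    have h1 : polyFun R (p * X i) = fun v => polyFun R p v * (v - center D R) i := by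
      ext; simp [polyFun]
    have h2 : HasFDerivAt (fun v : Ambient D => (v - center D R) i)
        (EuclideanSpace.proj i : Ambient D →L[ℝ] ℝ) v :=
      (EuclideanSpace.proj i : Ambient D →L[ℝ] ℝ).hasFDerivAt.comp v
        ((hasFDerivAt_id v).sub_const _)
    rw [h1, fderiv_fun_mul ((contDiff_polyFun R p).differentiable (by simp) v)
      h2.differentiableAt, h2.fderiv]
    simp only [_root_.add_apply, _root_.smul_apply, smul_eq_mul, hp]
    have h3 : ∀ j, x j * polyFun R (pderiv j (p * X i)) v =
        (v - center D R) i * (x j * polyFun R (pderiv j p) v) +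
          (if j = i then x j * polyFun R p v else 0) := by
      intro j
      by_cases hj : j = i
      · subst hj
        simp [polyFun, Derivation.leibniz]
        ring
      · simp [polyFun, Derivation.leibniz, hj, pderiv_X_of_ne (Ne.symm hj)]
        ring
    simp only [h3, Finset.sum_add_distrib, ← Finset.mul_sum, Finset.sum_ite_eq', Finset.mem_univ,
      if_true, PiLp.proj_apply]
    ring

/-- The polynomial version of `rotD`. -/
def rotP (a b : Fin (D + 1)) (p : MvPolynomial (Fin (D + 1)) ℝ) : MvPolynomial (Fin (D + 1)) ℝ :=
  X a * pderiv b p - X b * pderiv a p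

theorem rotD_polyFun {R : ℝ} (hR : 0 < R) (a b : Fin (D + 1))
    (p : MvPolynomial (Fin (D + 1)) ℝ) :
    rotD (1 / (2 * R)) a b (polyFun R p) = polyFun R (C R⁻¹ * rotP a b p) := by
  ext v
  have e1 : ∀ i, ((2 * (1 / (2 * R))) • v - EuclideanSpace.single (Fin.last D) 1 :
      Ambient D) i = R⁻¹ * (v - center D R) i := by
    intro i
    have : (center D R) i = R * (EuclideanSpace.single (Fin.last D) 1 : Ambient D) i := by
      simp [center]
    simp only [PiLp.sub_apply, PiLp.smul_apply, smul_eq_mul, this]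
    field_simp
  rw [rotD, rotVec, e1, e1, map_sub, map_smul, map_smul, fderiv_polyFun, fderiv_polyFun]
  simp [polyFun, rotP]
  ring

/-- This is the Casimir identity of the rotation algebra. Expanding the squares leaves `|X|²` times
the Laplacian and terms that Euler's relation evaluates on homogeneous polynomials. Each unordered
pair of indices occurs twice, whence the factor 2. -/
theorem sum_rotP_rotP {l : ℕ} {p : MvPolynomial (Fin (D + 1)) ℝ} (hp : p.IsHomogeneous l) :
    ∑ a, ∑ b, rotP a b (rotP a b p) = C 2 * ((∑ a, X a ^ 2) * (∑ i, pderiv i (pderiv i p)) -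
      C ((l : ℝ) * (l + D - 1)) * p) := by
  classical
  have hE : ∑ i, X i * pderiv i p = l • p := hp.sum_X_mul_pderiv
  -- Euler's relation applied twice: the square of the Euler operator is its second order part plus
  -- the Euler operator itself.
  have hQ : ∑ a, ∑ b, X a * X b * pderiv a (pderiv b p) = C ((l : ℝ) * (l - 1)) * p := by
    have h1 : ∀ a, pderiv a (∑ b, X b * pderiv b p) = pderiv a p +
        ∑ b, X b * pderiv a (pderiv b p) := by
      intro a
      simp only [map_sum, Derivation.leibniz, smul_eq_mul, pderiv_X, Finset.sum_add_distrib]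
      refine (add_comm _ _).trans (congrArg₂ _ ?_ rfl)
      rw [Finset.sum_eq_single a]
      · simp
      · intro b _ hb
        simp [hb]
      · simp
    have h2 : ∑ a, X a * pderiv a (∑ b, X b * pderiv b p) = l • l • p := by
      rw [hE]
      simp only [map_nsmul, mul_smul_comm, ← Finset.smul_sum, hE]
    have h4 : ∑ a, X a * pderiv a (∑ b, X b * pderiv b p) =
        l • p + ∑ a, ∑ b, X a * X b * pderiv a (pderiv b p) := by
      simp only [h1, mul_add, Finset.sum_add_distrib]
      rw [hE]
      simp only [Finset.mul_sum, ← mul_assoc]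
    have h3 := eq_sub_of_add_eq' (h4.symm.trans h2)
    rw [h3]
    simp only [nsmul_eq_mul, map_mul, map_sub, map_natCast, map_one]
    ring
  have hab : ∀ a b, rotP a b (rotP a b p) = X a ^ 2 * pderiv b (pderiv b p) +
      X b ^ 2 * pderiv a (pderiv a p) - X a * X b * pderiv a (pderiv b p) -
      X b * X a * pderiv b (pderiv a p) +
      ((if a = b then X a * pderiv a p else 0) - X a * pderiv a p) +
      ((if a = b then X b * pderiv b p else 0) - X b * pderiv b p) := by
    intro a b
    by_cases h : a = b
    · subst h
      simp [rotP]
      ring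
    · simp [rotP, Derivation.leibniz, pderiv_X_of_ne h, pderiv_X_of_ne (Ne.symm h), h]
      ring
  have s1 : ∑ a, ∑ b, (X a ^ 2 * pderiv b (pderiv b p) : MvPolynomial (Fin (D + 1)) ℝ) =
      (∑ a, X a ^ 2) * ∑ i, pderiv i (pderiv i p) := by
    rw [Finset.sum_mul]
    exact Finset.sum_congr rfl fun a _ => (Finset.mul_sum _ _ _).symm
  have s2 : ∑ a, ∑ b, (X b ^ 2 * pderiv a (pderiv a p) : MvPolynomial (Fin (D + 1)) ℝ) =
      (∑ a, X a ^ 2) * ∑ i, pderiv i (pderiv i p) := by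
    rw [Finset.sum_comm, s1]
  have s3 : ∑ a, ∑ b, (X b * X a * pderiv b (pderiv a p) : MvPolynomial (Fin (D + 1)) ℝ) =
      C ((l : ℝ) * (l - 1)) * p := by
    rw [Finset.sum_comm, hQ]
  have s4 : ∑ a : Fin (D + 1), ∑ b : Fin (D + 1), (if a = b then X a * pderiv a p else 0 :
      MvPolynomial (Fin (D + 1)) ℝ) = l • p := by
    simp [hE]
  have s5 : ∑ a : Fin (D + 1), ∑ b : Fin (D + 1), (if a = b then X b * pderiv b p else 0 :
      MvPolynomial (Fin (D + 1)) ℝ) = l • p := by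
    simp [hE]
  have s6 : ∑ a : Fin (D + 1), ∑ _b : Fin (D + 1), (X a * pderiv a p :
      MvPolynomial (Fin (D + 1)) ℝ) = (D + 1) • l • p := by
    simp only [Finset.sum_const, Finset.card_univ, Fintype.card_fin, ← Finset.smul_sum, hE]
  have s7 : ∑ _a : Fin (D + 1), ∑ b : Fin (D + 1), (X b * pderiv b p :
      MvPolynomial (Fin (D + 1)) ℝ) = (D + 1) • l • p := by
    simp only [Finset.sum_const, Finset.card_univ, Fintype.card_fin, hE]
  simp only [hab, Finset.sum_add_distrib, Finset.sum_sub_distrib, s1, s2, s3, s4, s5, s6, s7, hQ]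
  simp only [nsmul_eq_mul, map_mul, map_sub, map_add, map_natCast, map_one, map_ofNat]
  push_cast
  ring

theorem lap_polyFun {R : ℝ} (hR : 0 < R) {l : ℕ} {p : MvPolynomial (Fin (D + 1)) ℝ}
    (hp : p.IsHomogeneous l) (hh : ∑ i, pderiv i (pderiv i p) = 0) (v : Ambient D) :
    lap (1 / (2 * R)) (polyFun R p) v = -eig D R l * polyFun R p v := by
  have h1 : ∀ a b, rotP a b (C R⁻¹ * rotP a b p) = C R⁻¹ * rotP a b (rotP a b p) := by
    intro a b
    conv_lhs => rw [rotP]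
    conv_rhs => rw [rotP]
    simp only [pderiv_C_mul]
    ring
  have h2 := congrArg (polyFun R · v) (sum_rotP_rotP hp)
  simp only [hh, mul_zero, zero_sub] at h2
  simp only [lap, rotD_polyFun hR, h1]
  simp only [polyFun, map_sum, map_mul, map_neg, eval_C, ← Finset.mul_sum] at h2 ⊢
  rw [h2, eig]
  field_simp

section

open MvPolynomial

/-! ### Completeness of the spherical harmonics -/

/-- The class in `L²(S_R)` of a continuous function. -/
def toL2 {R : ℝ} (hR : 0 < R) {U : Ambient D → ℝ} (hU : Continuous U) : Lp ℝ 2 (surface D R) :=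
  (memLp_of_continuous hR hU 2).toLp U

theorem coeFn_toL2 {R : ℝ} (hR : 0 < R) {U : Ambient D → ℝ} (hU : Continuous U) :
    toL2 hR hU =ᵐ[surface D R] U := MemLp.coeFn_toLp _

theorem inner_toL2 {R : ℝ} (hR : 0 < R) {U V : Ambient D → ℝ} (hU : Continuous U)
    (hV : Continuous V) : inner ℝ (toL2 hR hU) (toL2 hR hV) = ∫ v, U v * V v ∂surface D R := by
  rw [L2.inner_def]
  refine integral_congr_ae ?_
  filter_upwards [coeFn_toL2 hR hU, coeFn_toL2 hR hV] with v h1 h2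
  rw [h1, h2]
  simp [mul_comm]

theorem inner_toL2_right {R : ℝ} (hR : 0 < R) {U : Ambient D → ℝ} (hU : Continuous U)
    (f : Lp ℝ 2 (surface D R)) : inner ℝ f (toL2 hR hU) = ∫ v, U v * f v ∂surface D R := by
  rw [L2.inner_def]
  refine integral_congr_ae ?_
  filter_upwards [coeFn_toL2 hR hU] with v h1
  rw [h1]
  simp

theorem toL2_polyFun_mem {R : ℝ} (hR : 0 < R) {l : ℕ} {p : MvPolynomial (Fin (D + 1)) ℝ}
    (hp : p.IsHomogeneous l) (hh : ∑ i, pderiv i (pderiv i p) = 0) :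
    toL2 hR (continuous_polyFun R p) ∈ sphericalHarmonics D R l :=
  ⟨p, hp, hh, coeFn_toL2 _ _⟩

theorem exists_polyFun_of_mem {R : ℝ} (hR : 0 < R) {l : ℕ} {u : Lp ℝ 2 (surface D R)}
    (hu : u ∈ sphericalHarmonics D R l) : ∃ p : MvPolynomial (Fin (D + 1)) ℝ,
      p.IsHomogeneous l ∧ ∑ i, pderiv i (pderiv i p) = 0 ∧
      u = toL2 hR (continuous_polyFun R p) := by
  obtain ⟨p, hp, hh, he⟩ := hu
  exact ⟨p, hp, hh, Lp.ext (he.trans (coeFn_toL2 hR (continuous_polyFun R p)).symm)⟩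

theorem eig_injective [NeZero D] {R : ℝ} (hR : 0 < R) {l l' : ℕ} (h : eig D R l = eig D R l') :
    l = l' := by
  have hD : (1 : ℝ) ≤ D := by exact_mod_cast NeZero.one_le
  have h1 : (l : ℝ) * (l + D - 1) = l' * (l' + D - 1) := by
    unfold eig at h
    field_simp at h
    exact h
  have h2 : ((l : ℝ) - l') * (l + l' + (D - 1)) = 0 := by linarith
  rcases mul_eq_zero.1 h2 with h3 | h3
  · exact_mod_cast sub_eq_zero.1 h3
  · have h4 : (l : ℝ) = 0 := by linarith [Nat.cast_nonneg (α := ℝ) l, Nat.cast_nonneg (α := ℝ) l']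
    have h5 : (l' : ℝ) = 0 := by linarith [Nat.cast_nonneg (α := ℝ) l, Nat.cast_nonneg (α := ℝ) l']
    exact_mod_cast h4.trans h5.symm

/-- Eigenfunctions of the symmetric operator `lap` with distinct eigenvalues are orthogonal. -/
theorem inner_eq_zero_of_degree_ne [NeZero D] {R : ℝ} (hR : 0 < R) {l l' : ℕ} (hl : l ≠ l')
    {u w : Lp ℝ 2 (surface D R)} (hu : u ∈ sphericalHarmonics D R l)
    (hw : w ∈ sphericalHarmonics D R l') : inner ℝ u w = 0 := by
  obtain ⟨p, hp, hph, rfl⟩ := exists_polyFun_of_mem hR hu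
  obtain ⟨q, hq, hqh, rfl⟩ := exists_polyFun_of_mem hR hw
  rw [inner_toL2]
  have h := integral_lap_mul hR (contDiff_polyFun R p) (contDiff_polyFun R q)
  simp only [lap_polyFun hR hp hph, lap_polyFun hR hq hqh] at h
  simp only [mul_assoc, mul_left_comm _ (-eig D R l')] at h
  rw [integral_const_mul, integral_const_mul] at h
  have h2 : (eig D R l - eig D R l') * ∫ v, polyFun R p v * polyFun R q v ∂surface D R = 0 := by
    linarith
  exact (mul_eq_zero.1 h2).resolve_left (sub_ne_zero.2 fun h => hl (eig_injective hR h))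

theorem eval_smul_of_isHomogeneous {l : ℕ} {p : MvPolynomial (Fin (D + 1)) ℝ}
    (hp : p.IsHomogeneous l) (c : ℝ) (x : Fin (D + 1) → ℝ) :
    eval (c • x) p = c ^ l * eval x p := by
  rw [eval_eq, eval_eq, Finset.mul_sum]
  refine Finset.sum_congr rfl fun d hd => ?_
  have : d.degree = l := by
    have := hp (mem_support_iff.1 hd)
    rwa [Finsupp.degree_eq_weight_one]
  rw [← this, Finsupp.degree_apply]
  simp only [Pi.smul_apply, smul_eq_mul, mul_pow, Finset.prod_mul_distrib, Finset.prod_pow_eq_pow_sum]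
  ring

theorem eq_zero_of_polyFun_eq_zero {R : ℝ} (hR : 0 < R) {l : ℕ}
    {p : MvPolynomial (Fin (D + 1)) ℝ} (hp : p.IsHomogeneous l)
    (h : ∀ v ∈ Metric.sphere (center D R) R, polyFun R p v = 0) : p = 0 := by
  refine MvPolynomial.funext fun x => ?_
  obtain ⟨c, y, hy, rfl⟩ : ∃ (c : ℝ) (y : Ambient D), ‖y‖ = R ∧ x = c • (y : Fin (D + 1) → ℝ) := by
    by_cases hx : WithLp.toLp 2 x = (0 : Ambient D)
    · refine ⟨0, EuclideanSpace.single 0 R, by simp [hR.le], ?_⟩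
      rw [zero_smul]
      exact congrArg WithLp.ofLp hx
    · have hn := norm_ne_zero_iff.2 hx
      refine ⟨‖(WithLp.toLp 2 x : Ambient D)‖ / R, (R / ‖(WithLp.toLp 2 x : Ambient D)‖) •
        (WithLp.toLp 2 x : Ambient D), ?_, ?_⟩
      · rw [norm_smul, norm_div, norm_norm, Real.norm_of_nonneg hR.le, div_mul_cancel₀ _ hn]
      · ext i
        simp only [WithLp.ofLp_smul, Pi.smul_apply, smul_eq_mul]
        field_simp
  have h1 := h (center D R + y) (by simpa [mem_sphere_iff_norm] using hy)
  rw [polyFun, add_sub_cancel_left] at h1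
  rw [eval_smul_of_isHomogeneous hp, h1, mul_zero, map_zero]

/-- The span of the spherical harmonics of degree less than `n`. -/
def lowHarmonics (D : ℕ) (R : ℝ) (n : ℕ) : Submodule ℝ (Lp ℝ 2 (surface D R)) :=
  ⨆ (l : ℕ) (_ : l < n), sphericalHarmonics D R l

theorem lowHarmonics_mono (D : ℕ) (R : ℝ) {m n : ℕ} (h : m ≤ n) :
    lowHarmonics D R m ≤ lowHarmonics D R n :=
  iSup₂_le fun l hl => le_iSup₂_of_le l (hl.trans_le h) le_rfl

theorem inner_eq_zero_of_mem_lowHarmonics [NeZero D] {R : ℝ} (hR : 0 < R) {l n : ℕ} (hl : n ≤ l)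
    {u w : Lp ℝ 2 (surface D R)} (hu : u ∈ sphericalHarmonics D R l)
    (hw : w ∈ lowHarmonics D R n) : inner ℝ u w = 0 := by
  have : lowHarmonics D R n ≤ (ℝ ∙ u)ᗮ := iSup₂_le fun l' hl' w hw =>
    Submodule.mem_orthogonal_singleton_iff_inner_right.2
      (inner_eq_zero_of_degree_ne hR (hl'.trans_le hl).ne' hu hw)
  exact Submodule.mem_orthogonal_singleton_iff_inner_right.1 (this hw)

theorem laplacian_mem {l : ℕ} {p : MvPolynomial (Fin (D + 1)) ℝ} (hp : p.IsHomogeneous (l + 2)) :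
    ∑ i, pderiv i (pderiv i p) ∈ homogeneousSubmodule (Fin (D + 1)) ℝ l :=
  sum_mem fun i _ => (mem_homogeneousSubmodule _ _).2 (by
    have := (hp.pderiv (i := i)).pderiv (i := i)
    rwa [show l + 2 - 1 - 1 = l by omega] at this)

theorem polyFun_sq_mul {R : ℝ} (p : MvPolynomial (Fin (D + 1)) ℝ)
    {v : Ambient D} (hv : v ∈ Metric.sphere (center D R) R) :
    polyFun R ((∑ a, X a ^ 2) * p) v = R ^ 2 * polyFun R p v := by
  rw [mem_sphere_iff_norm] at hv
  have : ∑ a, ((v - center D R) a) ^ 2 = R ^ 2 := by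
    have h := EuclideanSpace.norm_sq_eq (v - center D R)
    rw [hv] at h
    simpa using h.symm
  simp only [polyFun, map_mul, map_sum, map_pow, eval_X, this]

theorem isHomogeneous_sq_mul {l : ℕ} {p : MvPolynomial (Fin (D + 1)) ℝ}
    (hp : p.IsHomogeneous l) : ((∑ a : Fin (D + 1), X a ^ 2) * p).IsHomogeneous (l + 2) := by
  have h : (∑ a : Fin (D + 1), (X a : MvPolynomial (Fin (D + 1)) ℝ) ^ 2).IsHomogeneous 2 :=
    IsHomogeneous.sum _ _ _ fun a _ => by simpa using (isHomogeneous_X ℝ a).pow 2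
  have h2 := h.mul hp
  rwa [add_comm 2 l] at h2

/-- Every homogeneous polynomial is, on the sphere, a sum of spherical harmonics. -/
theorem toL2_polyFun_mem_lowHarmonics [NeZero D] {R : ℝ} (hR : 0 < R) {l : ℕ}
    {p : MvPolynomial (Fin (D + 1)) ℝ} (hp : p.IsHomogeneous l) :
    toL2 hR (continuous_polyFun R p) ∈ lowHarmonics D R (l + 1) := by
  induction l using Nat.strong_induction_on generalizing p with
  | _ l ih =>
  by_cases hl : l < 2
  · refine le_iSup₂ (f := fun (l' : ℕ) (_ : l' < l + 1) => sphericalHarmonics D R l') l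
      (Nat.lt_succ_self l) (toL2_polyFun_mem hR hp (Finset.sum_eq_zero fun i _ => ?_))
    have h1 : (pderiv i p).IsHomogeneous 0 := by
      have := hp.pderiv (i := i)
      rwa [show l - 1 = 0 by omega] at this
    rw [totalDegree_eq_zero_iff_eq_C.1 ((totalDegree_zero_iff_isHomogeneous _).2 h1), pderiv_C]
  obtain ⟨n, rfl⟩ : ∃ n, l = n + 2 := ⟨l - 2, by omega⟩
  let V := homogeneousSubmodule (Fin (D + 1)) ℝ n
  have : FiniteDimensional ℝ V := Module.Finite.iff_fg.2 (homogeneousSubmodule_fg _ _ n)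
  have hmem : ∀ q ∈ V, ∑ i, pderiv i (pderiv i ((∑ a, X a ^ 2) * q)) ∈ V := fun q hq =>
    laplacian_mem (isHomogeneous_sq_mul ((mem_homogeneousSubmodule n q).1 hq))
  let T₀ : MvPolynomial (Fin (D + 1)) ℝ →ₗ[ℝ] MvPolynomial (Fin (D + 1)) ℝ :=
    { toFun := fun q => ∑ i, pderiv i (pderiv i ((∑ a, X a ^ 2) * q))
      map_add' := fun q q' => by simp only [mul_add, map_add, Finset.sum_add_distrib]
      map_smul' := fun c q => by
        simp only [mul_smul_comm, Derivation.map_smul, Finset.smul_sum, RingHom.id_apply] }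
  let T : V →ₗ[ℝ] V := T₀.restrict hmem
  -- If `|X|² q` is harmonic, it is a spherical harmonic of degree `n + 2`, orthogonal to everything
  -- of lower degree. By induction `q` is of lower degree on the sphere. As `|X|² = R²` there, `q`
  -- is orthogonal to itself.
  have hT : Function.Injective T := by
    refine (injective_iff_map_eq_zero T).2 fun q hq => ?_
    have h1 : ∑ i, pderiv i (pderiv i ((∑ a, X a ^ 2) * q.1)) = 0 := congrArg Subtype.val hq
    have h2 := toL2_polyFun_mem hR (isHomogeneous_sq_mul q.2) h1
    have h3 := inner_eq_zero_of_mem_lowHarmonics hR (Nat.le_succ (n + 1)) h2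
      (ih n (by omega) q.2)
    rw [inner_toL2] at h3
    have h4 : ∫ v, polyFun R ((∑ a, X a ^ 2) * q.1) v * polyFun R q.1 v ∂surface D R =
        R ^ 2 * ∫ v, polyFun R q.1 v * polyFun R q.1 v ∂surface D R := by
      rw [← integral_const_mul]
      refine integral_congr_ae ((ae_mem_sphere hR).mono fun v hv => ?_)
      simp only [polyFun_sq_mul q.1 hv, mul_assoc]
    rw [h4, mul_eq_zero, or_iff_right (by positivity), integral_eq_zero_iff_of_nonneg
      (fun v => mul_self_nonneg _) (integrable_of_continuous hR
        ((continuous_polyFun R q.1).mul (continuous_polyFun R q.1)))] at h3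
    refine Subtype.ext (eq_zero_of_polyFun_eq_zero hR q.2 ?_)
    exact eqOn_zero_of_integral_eq_zero hR (continuous_polyFun R q.1)
      (h3.mono fun v hv => mul_self_eq_zero.1 hv)
  -- In finite dimension `T` is then onto, so some `q` makes `p - |X|² q` harmonic. On the sphere
  -- `p` is this harmonic plus `R² q`, to which the induction hypothesis applies.
  obtain ⟨q, hq⟩ := LinearMap.injective_iff_surjective.1 hT
    ⟨∑ i, pderiv i (pderiv i p), laplacian_mem hp⟩
  have hq' : ∑ i, pderiv i (pderiv i ((∑ a, X a ^ 2) * q.1)) = ∑ i, pderiv i (pderiv i p) :=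
    congrArg Subtype.val hq
  have h5 : toL2 hR (continuous_polyFun R (p - (∑ a, X a ^ 2) * q.1)) ∈
      lowHarmonics D R (n + 2 + 1) := by
    refine le_iSup₂ (f := fun (l' : ℕ) (_ : l' < n + 2 + 1) => sphericalHarmonics D R l') (n + 2)
      (Nat.lt_succ_self _) (toL2_polyFun_mem hR (hp.sub (isHomogeneous_sq_mul q.2)) ?_)
    simp only [map_sub, Finset.sum_sub_distrib, hq', sub_self]
  have h6 := lowHarmonics_mono D R (show n + 1 ≤ n + 2 + 1 by omega) (ih n (by omega) q.2)
  have h7 : toL2 hR (continuous_polyFun R p) =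
      toL2 hR (continuous_polyFun R (p - (∑ a, X a ^ 2) * q.1)) +
        R ^ 2 • toL2 hR (continuous_polyFun R q.1) := by
    refine Lp.ext ?_
    filter_upwards [coeFn_toL2 hR (continuous_polyFun R p),
      coeFn_toL2 hR (continuous_polyFun R (p - (∑ a, X a ^ 2) * q.1)),
      coeFn_toL2 hR (continuous_polyFun R q.1), ae_mem_sphere hR,
      Lp.coeFn_add (toL2 hR (continuous_polyFun R (p - (∑ a, X a ^ 2) * q.1)))
        (R ^ 2 • toL2 hR (continuous_polyFun R q.1)),
      Lp.coeFn_smul (R ^ 2) (toL2 hR (continuous_polyFun R q.1))] with v e1 e2 e3 hv e4 e5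
    rw [e4, Pi.add_apply, e5, Pi.smul_apply, e1, e2, e3, smul_eq_mul, ← polyFun_sq_mul q.1 hv]
    simp [polyFun]
  rw [h7]
  exact add_mem h5 (Submodule.smul_mem _ _ h6)

/-- The span of all spherical harmonics. -/
def allHarmonics (D : ℕ) (R : ℝ) : Submodule ℝ (Lp ℝ 2 (surface D R)) :=
  ⨆ l, sphericalHarmonics D R l

theorem toL2_polyFun_mem_allHarmonics [NeZero D] {R : ℝ} (hR : 0 < R)
    (p : MvPolynomial (Fin (D + 1)) ℝ) :
    toL2 hR (continuous_polyFun R p) ∈ allHarmonics D R := by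
  have h1 : ∀ i, toL2 hR (continuous_polyFun R (homogeneousComponent i p)) ∈ allHarmonics D R :=
    fun i => (iSup₂_le fun l _ => le_iSup (sphericalHarmonics D R) l :
      lowHarmonics D R (i + 1) ≤ allHarmonics D R)
      (toL2_polyFun_mem_lowHarmonics hR (homogeneousComponent_isHomogeneous i p))
  have h2 : toL2 hR (continuous_polyFun R p) = ∑ i ∈ Finset.range (p.totalDegree + 1),
      toL2 hR (continuous_polyFun R (homogeneousComponent i p)) := by
    refine Lp.ext ?_
    have h3 := fun i => coeFn_toL2 hR (continuous_polyFun R (homogeneousComponent i p))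
    filter_upwards [coeFn_toL2 hR (continuous_polyFun R p), ae_all_iff.2 h3,
      Lp.coeFn_finsetSum (Finset.range (p.totalDegree + 1)) fun i =>
        toL2 hR (continuous_polyFun R (homogeneousComponent i p))] with v e1 e2 e3
    rw [e1, e3, Finset.sum_apply]
    simp only [e2]
    conv_lhs => rw [← sum_homogeneousComponent p]
    simp [polyFun]
  rw [h2]
  exact sum_mem fun i _ => h1 i

/-- Bounded continuous functions are dense in `L²`, and by Stone-Weierstrass polynomials approximate
them uniformly on the sphere. -/
theorem dense_allHarmonics [NeZero D] {R : ℝ} (hR : 0 < R) :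
    (allHarmonics D R).topologicalClosure = ⊤ := by
  have hd := BoundedContinuousFunction.toLp_denseRange (E := ℝ) (p := 2) (surface D R) ℝ
    (by simp)
  rw [← Submodule.dense_iff_topologicalClosure_eq_top]
  refine Dense.of_closure (hd.mono ?_)
  rintro _ ⟨f, rfl⟩
  refine Metric.mem_closure_iff.2 fun δ hδ => ?_
  let coord : Fin (D + 1) → C(Ambient D, ℝ) := fun i => ⟨fun v => (v - center D R) i, by fun_prop⟩
  have hcoord : ∀ q : MvPolynomial (Fin (D + 1)) ℝ, ∀ v, aeval coord q v = polyFun R q v := by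
    intro q v
    induction q using MvPolynomial.induction_on with
    | C a => simp [polyFun]
    | add p q hp hq => simp_all [polyFun]
    | mul_X p i hp => simp_all [polyFun, coord]
  have hsep : (aeval (R := ℝ) coord).range.SeparatesPoints := by
    intro v w hvw
    obtain ⟨i, hi⟩ : ∃ i, v i ≠ w i := by
      by_contra! hc
      exact hvw (PiLp.ext hc)
    refine ⟨coord i, ⟨coord i, ⟨X i, by simp⟩, rfl⟩, ?_⟩
    simpa [coord] using hi
  -- The square root of the total mass, which converts a uniform bound into an `L²` bound.
  let M : ℝ := (measureUnivNNReal (surface D R) : ℝ) ^ (2 : ℝ≥0∞).toReal⁻¹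
  have hM : 0 ≤ M := by positivity
  obtain ⟨_, ⟨q, rfl⟩, hq⟩ :=
    ContinuousMap.exists_mem_subalgebra_near_continuous_of_isCompact_of_separatesPoints hsep
      f.toContinuousMap (isCompact_sphere (center D R) R) (show 0 < δ / (M + 1) by positivity)
  refine ⟨_, toL2_polyFun_mem_allHarmonics hR q, ?_⟩
  have hb : ∀ᵐ v ∂surface D R, ‖(BoundedContinuousFunction.toLp 2 (surface D R) ℝ f -
      toL2 hR (continuous_polyFun R q) : Lp ℝ 2 (surface D R)) v‖ ≤ δ / (M + 1) := by
    filter_upwards [Lp.coeFn_sub (BoundedContinuousFunction.toLp 2 (surface D R) ℝ f)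
      (toL2 hR (continuous_polyFun R q)), BoundedContinuousFunction.coeFn_toLp 2 (surface D R) ℝ f,
      coeFn_toL2 hR (continuous_polyFun R q), ae_mem_sphere hR] with v e1 e2 e3 hv
    rw [e1, Pi.sub_apply, e2, e3, norm_sub_rev, ← hcoord]
    exact (hq v hv).le
  rw [dist_eq_norm]
  refine (Lp.norm_le_of_ae_bound (by positivity) hb).trans_lt ?_
  change M * (δ / (M + 1)) < δ
  rw [mul_div_assoc', div_lt_iff₀ (by positivity)]
  nlinarith

variable {R : ℝ}

/-- The members of a basis of harmonics, as elements of `L²(S_R)`. -/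
def basisFun (Y : HarmonicBasis D R) (i : Modes D R) : Lp ℝ 2 (surface D R) :=
  (Y i.1 i.2 : sphericalHarmonics D R i.1)

theorem basisFun_mem (Y : HarmonicBasis D R) (i : Modes D R) :
    basisFun Y i ∈ sphericalHarmonics D R i.1 := (Y i.1 i.2).2

theorem orthonormal_basisFun [NeZero D] (hR : 0 < R) (Y : HarmonicBasis D R) :
    Orthonormal ℝ (basisFun Y) := by
  refine ⟨fun i => (Y i.1).orthonormal.1 i.2, ?_⟩
  rintro ⟨l, m⟩ ⟨l', m'⟩ h
  by_cases hl : l = l'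
  · subst hl
    exact (Y l).orthonormal.2 fun hm => h (congrArg (Sigma.mk l) hm)
  · exact inner_eq_zero_of_degree_ne hR hl (basisFun_mem Y ⟨l, m⟩) (basisFun_mem Y ⟨l', m'⟩)

theorem harmonics_le_span (Y : HarmonicBasis D R) (l : ℕ) :
    sphericalHarmonics D R l ≤
      Submodule.span ℝ (Set.range fun m => basisFun Y ⟨l, m⟩) := by
  intro u hu
  have h1 : (⟨u, hu⟩ : sphericalHarmonics D R l) ∈ Submodule.span ℝ (Set.range (Y l)) := by
    rw [← OrthonormalBasis.coe_toBasis, Module.Basis.span_eq]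
    trivial
  have h2 := Submodule.mem_map_of_mem (f := (sphericalHarmonics D R l).subtype) h1
  rw [Submodule.map_span, ← Set.range_comp] at h2
  exact h2

/-- The Hilbert basis of `L²(S_R)` formed by the spherical harmonics. -/
def hilbertBasis [NeZero D] (hR : 0 < R) (Y : HarmonicBasis D R) :
    HilbertBasis (Modes D R) ℝ (Lp ℝ 2 (surface D R)) :=
  HilbertBasis.mk (orthonormal_basisFun hR Y) (by
    rw [← dense_allHarmonics hR]
    refine Submodule.topologicalClosure_mono (iSup_le fun l => (harmonics_le_span Y l).trans ?_)
    refine Submodule.span_mono ?_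
    rintro _ ⟨m, rfl⟩
    exact ⟨⟨l, m⟩, rfl⟩)

theorem coe_hilbertBasis [NeZero D] (hR : 0 < R) (Y : HarmonicBasis D R) (i : Modes D R) :
    hilbertBasis hR Y i = basisFun Y i := by
  rw [hilbertBasis, HilbertBasis.coe_mk]

theorem coeff_eq_inner [NeZero D] (hR : 0 < R) (Y : HarmonicBasis D R) {U : Ambient D → ℝ}
    (hU : Continuous U) (i : Modes D R) :
    coeff Y U i = inner ℝ (hilbertBasis hR Y i) (toL2 hR hU) := by
  rw [inner_toL2_right, coe_hilbertBasis]
  rfl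

theorem hasSum_coeff_mul_coeff [NeZero D] (hR : 0 < R) (Y : HarmonicBasis D R)
    {U V : Ambient D → ℝ} (hU : Continuous U) (hV : Continuous V) :
    HasSum (fun i => coeff Y U i * coeff Y V i) (∫ v, U v * V v ∂surface D R) := by
  have := (hilbertBasis hR Y).hasSum_inner_mul_inner (toL2 hR hU) (toL2 hR hV)
  rw [inner_toL2] at this
  simpa only [coeff_eq_inner hR Y hU, coeff_eq_inner hR Y hV, real_inner_comm] using this

theorem coeff_congr (hR : 0 < R) (Y : HarmonicBasis D R) {u w : Ambient D → ℝ}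
    (h : ∀ v ∈ Metric.sphere (center D R) R, u v = w v) : coeff Y u = coeff Y w := by
  ext i
  refine integral_congr_ae ((ae_mem_sphere hR).mono fun v hv => ?_)
  simp only [h v hv]

end

section

open MvPolynomial

variable {R : ℝ}

/-! ### Decay of the coefficients -/

theorem eig_nonneg [NeZero D] (R : ℝ) (l : ℕ) : 0 ≤ eig D R l := by
  have hD : (1 : ℝ) ≤ D := by exact_mod_cast NeZero.one_le
  have : (0 : ℝ) ≤ l + D - 1 := by linarith [Nat.cast_nonneg (α := ℝ) l]
  unfold eig
  positivity

theorem one_le_eig_add_one [NeZero D] (R : ℝ) (l : ℕ) : 1 ≤ eig D R l + 1 := by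
  linarith [eig_nonneg (D := D) R l]

theorem eig_add_one_pos [NeZero D] (R : ℝ) (l : ℕ) : 0 < eig D R l + 1 := by
  linarith [eig_nonneg (D := D) R l]

theorem exists_polyFun_basisFun (hR : 0 < R) (Y : HarmonicBasis D R) (i : Modes D R) :
    ∃ p : MvPolynomial (Fin (D + 1)) ℝ, p.IsHomogeneous i.1 ∧
      ∑ i, pderiv i (pderiv i p) = 0 ∧ basisFun Y i = toL2 hR (continuous_polyFun R p) ∧
      ∀ u, coeff Y u i = ∫ v, u v * polyFun R p v ∂surface D R := by
  obtain ⟨p, hp, hh, he⟩ := exists_polyFun_of_mem hR (basisFun_mem Y i)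
  refine ⟨p, hp, hh, he, fun u => ?_⟩
  refine integral_congr_ae ?_
  have h := coeFn_toL2 hR (continuous_polyFun R p)
  rw [← he] at h
  filter_upwards [h] with v hv
  rw [← hv]
  rfl

theorem coeff_sub (hR : 0 < R) (Y : HarmonicBasis D R) {U V : Ambient D → ℝ} (hU : Continuous U)
    (hV : Continuous V) (i : Modes D R) :
    coeff Y (fun v => U v - V v) i = coeff Y U i - coeff Y V i := by
  obtain ⟨p, -, -, -, h⟩ := exists_polyFun_basisFun hR Y i
  simp only [h, sub_mul]
  exact integral_sub (integrable_of_continuous hR (hU.mul (continuous_polyFun R p)))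
    (integrable_of_continuous hR (hV.mul (continuous_polyFun R p)))

theorem coeff_add (hR : 0 < R) (Y : HarmonicBasis D R) {U V : Ambient D → ℝ} (hU : Continuous U)
    (hV : Continuous V) (i : Modes D R) :
    coeff Y (fun v => U v + V v) i = coeff Y U i + coeff Y V i := by
  obtain ⟨p, -, -, -, h⟩ := exists_polyFun_basisFun hR Y i
  simp only [h, add_mul]
  exact integral_add (integrable_of_continuous hR (hU.mul (continuous_polyFun R p)))
    (integrable_of_continuous hR (hV.mul (continuous_polyFun R p)))

theorem coeff_const_mul (Y : HarmonicBasis D R) (a : ℝ) (u : Ambient D → ℝ) (i : Modes D R) :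
    coeff Y (fun v => a * u v) i = a * coeff Y u i := by
  simp only [coeff, mul_assoc, integral_const_mul]

theorem coeff_lap (hR : 0 < R) (Y : HarmonicBasis D R) {U : Ambient D → ℝ}
    (hU : ContDiff ℝ ∞ U) (i : Modes D R) :
    coeff Y (lap (1 / (2 * R)) U) i = -eig D R i.1 * coeff Y U i := by
  obtain ⟨p, hp, hh, -, h⟩ := exists_polyFun_basisFun hR Y i
  simp only [h, integral_lap_mul hR hU (contDiff_polyFun R p), lap_polyFun hR hp hh]
  rw [← integral_const_mul]
  congr 1 with v
  ring

theorem coeff_lap_iterate (hR : 0 < R) (Y : HarmonicBasis D R) {U : Ambient D → ℝ}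
    (hU : ContDiff ℝ ∞ U) (j : ℕ) (i : Modes D R) :
    coeff Y ((lap (1 / (2 * R)))^[j] U) i = (-eig D R i.1) ^ j * coeff Y U i := by
  induction j with
  | zero => simp
  | succ j ih =>
    rw [Function.iterate_succ_apply', coeff_lap hR Y (contDiff_lap_iterate hU _ j), ih]
    ring

theorem coeff_oneSubLap_iterate (hR : 0 < R) (Y : HarmonicBasis D R) {U : Ambient D → ℝ}
    (hU : ContDiff ℝ ∞ U) (j : ℕ) (i : Modes D R) :
    coeff Y ((oneSubLap (1 / (2 * R)))^[j] U) i = (eig D R i.1 + 1) ^ j * coeff Y U i := by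
  induction j with
  | zero => simp
  | succ j ih =>
    have hj := contDiff_oneSubLap_iterate hU (1 / (2 * R)) j
    have h := coeff_sub hR Y hj.continuous (contDiff_lap hj (1 / (2 * R))).continuous i
    rw [coeff_lap hR Y hj, ih] at h
    rw [Function.iterate_succ_apply']
    refine h.trans ?_
    ring

/-- Coefficients that decay faster than any power of the eigenvalues. -/
def IsRapid {D : ℕ} {R : ℝ} (c : Modes D R → ℝ) : Prop :=
  ∀ p : ℕ, Summable fun i => (eig D R i.1 + 1) ^ p * c i ^ 2

/-- Parseval for `(1 - ∇²)^j U`. It yields both the rapid decay of the coefficients and the Sobolev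
estimates that are uniform in `R`. -/
theorem hasSum_coeff_sq [NeZero D] (hR : 0 < R) (Y : HarmonicBasis D R) {U : Ambient D → ℝ}
    (hU : ContDiff ℝ ∞ U) (j : ℕ) :
    HasSum (fun i => (eig D R i.1 + 1) ^ (2 * j) * coeff Y U i ^ 2)
      (∫ v, ((oneSubLap (1 / (2 * R)))^[j] U v) ^ 2 ∂surface D R) := by
  have hj := (contDiff_oneSubLap_iterate hU (1 / (2 * R)) j).continuous
  have h := hasSum_coeff_mul_coeff hR Y hj hj
  simp only [coeff_oneSubLap_iterate hR Y hU] at h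
  convert h using 2 with i
  · ring
  · ext v
    ring

theorem isRapid_coeff [NeZero D] (hR : 0 < R) (Y : HarmonicBasis D R) {U : Ambient D → ℝ}
    (hU : ContDiff ℝ ∞ U) : IsRapid (coeff Y U) := by
  intro p
  refine (hasSum_coeff_sq hR Y hU p).summable.of_nonneg_of_le (fun i => ?_) fun i => ?_
  · have := eig_add_one_pos (D := D) R i.1
    positivity
  · exact mul_le_mul_of_nonneg_right (pow_le_pow_right₀ (one_le_eig_add_one R i.1) (by omega))
      (sq_nonneg _)

/-! ### Tempered fields -/

/-- Fields in a Sobolev space of sufficiently negative order. -/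
def IsTempered {D : ℕ} {R : ℝ} (φ : Field D R) : Prop :=
  Summable fun i => ((eig D R i.1 + 1) ^ (D + 2))⁻¹ * φ i ^ 2

theorem abs_mul_le_of_weight {x y t : ℝ} (ht : 0 < t) :
    |x * y| ≤ t⁻¹ * x ^ 2 + t * y ^ 2 := by
  have h1 : t⁻¹ * x ^ 2 + t * y ^ 2 = (t⁻¹ * x) ^ 2 * t + t * y ^ 2 := by field_simp
  have h2 : x * y = (t⁻¹ * x) * y * t := by field_simp
  rw [h1, h2, abs_mul, abs_of_pos ht, abs_mul]
  nlinarith [sq_nonneg (|t⁻¹ * x| - |y|), sq_abs (t⁻¹ * x), sq_abs y, mul_pos ht ht,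
    mul_nonneg ht.le (sq_nonneg (|t⁻¹ * x| - |y|)), mul_nonneg ht.le (sq_nonneg (|t⁻¹ * x|)),
    mul_nonneg ht.le (sq_nonneg (|y|))]

theorem IsTempered.summable_mul [NeZero D] {φ c : Field D R} (hφ : IsTempered φ)
    (hc : IsRapid c) : Summable fun i => φ i * c i := by
  refine Summable.of_norm ((hφ.add (hc (D + 2))).of_nonneg_of_le (fun i => norm_nonneg _)
    fun i => ?_)
  exact abs_mul_le_of_weight (pow_pos (eig_add_one_pos R i.1) _)

/-- The class in `L²(S_R)` of a polynomial, as a linear map. -/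
def polyL2 (D : ℕ) {R : ℝ} (hR : 0 < R) :
    MvPolynomial (Fin (D + 1)) ℝ →ₗ[ℝ] Lp ℝ 2 (surface D R) where
  toFun p := toL2 hR (continuous_polyFun R p)
  map_add' p q := by
    have : polyFun R (p + q) = polyFun R p + polyFun R q := by ext; simp [polyFun]
    simp only [toL2, this]
    exact MemLp.toLp_add _ _
  map_smul' a p := by
    have : polyFun R (a • p) = a • polyFun R p := by ext; simp [polyFun, smul_eval]
    simp only [toL2, this, RingHom.id_apply]
    exact MemLp.toLp_const_smul _ _

/-- The harmonics of degree `l` lie in the span of the monomials with all exponents at most `l`.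
This crude count suffices for the summability below. -/
theorem finrank_sphericalHarmonics_le (hR : 0 < R) (l : ℕ) :
    Module.finrank ℝ (sphericalHarmonics D R l) ≤ (l + 1) ^ (D + 1) := by
  let b : (Fin (D + 1) → Fin (l + 1)) → Lp ℝ 2 (surface D R) := fun d =>
    polyL2 D hR (monomial (Finsupp.equivFunOnFinite.symm fun i => (d i : ℕ)) 1)
  have hle : sphericalHarmonics D R l ≤ Submodule.span ℝ (Set.range b) := by
    intro u hu
    obtain ⟨p, hp, -, rfl⟩ := exists_polyFun_of_mem hR hu
    change polyL2 D hR p ∈ _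
    rw [p.as_sum, map_sum]
    refine sum_mem fun d hd => ?_
    have hdeg : d.degree = l := by
      have := hp (mem_support_iff.1 hd)
      rwa [Finsupp.degree_eq_weight_one]
    have hdi : ∀ i, d i < l + 1 := fun i => Nat.lt_succ_of_le (hdeg ▸ Finsupp.le_degree i d)
    have h1 : monomial d (MvPolynomial.coeff d p) =
        MvPolynomial.coeff d p • monomial (Finsupp.equivFunOnFinite.symm fun i =>
          ((⟨d i, hdi i⟩ : Fin (l + 1)) : ℕ)) (1 : ℝ) := by
      rw [smul_monomial, smul_eq_mul, mul_one]
      refine congrArg (fun e : Fin (D + 1) →₀ ℕ => monomial e (MvPolynomial.coeff d p)) ?_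
      ext i
      rfl
    rw [h1, map_smul]
    exact Submodule.smul_mem _ _ (Submodule.subset_span ⟨fun i => ⟨d i, hdi i⟩, rfl⟩)
  have : FiniteDimensional ℝ (Submodule.span ℝ (Set.range b)) :=
    FiniteDimensional.span_of_finite ℝ (Set.finite_range b)
  refine (Submodule.finrank_mono hle).trans ((finrank_range_le_card b).trans ?_)
  simp

theorem sq_le_eig (D : ℕ) [NeZero D] (hR : 0 < R) (l : ℕ) :
    ((l : ℝ) + 1) ^ 2 ≤ (2 * R ^ 2 + 2) * (eig D R l + 1) := by
  have hD : (1 : ℝ) ≤ D := by exact_mod_cast NeZero.one_le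
  have hl := Nat.cast_nonneg (α := ℝ) l
  have h1 : (l : ℝ) ^ 2 / R ^ 2 ≤ eig D R l := by
    unfold eig
    gcongr
    nlinarith
  have h2 : R ^ 2 * ((l : ℝ) ^ 2 / R ^ 2) = l ^ 2 := by field_simp
  have h3 := eig_nonneg (D := D) R l
  nlinarith [sq_nonneg ((l : ℝ) - 1), mul_le_mul_of_nonneg_left h1 (sq_nonneg R), sq_nonneg R]

/-- The exponent is the `D + 2` of `IsTempered` plus one for the variance `(eig + 1)⁻¹` of a mode.
The multiplicity grows at most like `(l + 1)^(D + 1)`, while `eig + 1` grows like `(l + 1)²`. -/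
theorem summable_modes (D : ℕ) [NeZero D] (hR : 0 < R) :
    Summable fun i : Modes D R => ((eig D R i.1 + 1) ^ (D + 3))⁻¹ := by
  have hpos := fun l => eig_add_one_pos (D := D) R l
  refine (summable_sigma_of_nonneg fun i => (inv_pos.2 (pow_pos (hpos i.1) _)).le).2
    ⟨fun l => Summable.of_finite, ?_⟩
  simp only [tsum_fintype, Finset.sum_const, Finset.card_univ, Fintype.card_fin, nsmul_eq_mul]
  have hs : Summable fun l : ℕ => (2 * R ^ 2 + 2) ^ (D + 3) * (((l + 1 : ℕ) : ℝ) ^ 2)⁻¹ :=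
    ((summable_nat_add_iff 1).2 (Real.summable_nat_pow_inv.2 one_lt_two)).mul_left _
  refine hs.of_nonneg_of_le (fun l => ?_) fun l => ?_
  · have := hpos l
    positivity
  · have h1 : (Module.finrank ℝ (sphericalHarmonics D R l) : ℝ) ≤ ((l : ℝ) + 1) ^ (D + 1) := by
      exact_mod_cast finrank_sphericalHarmonics_le hR l
    have h2 := pow_le_pow_left₀ (by positivity) (sq_le_eig D hR l) (D + 3)
    rw [mul_pow] at h2
    have h3 := pow_pos (hpos l) (D + 3)
    rw [← div_eq_mul_inv, ← div_eq_mul_inv, div_le_div_iff₀ h3 (by positivity)]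
    refine le_trans ?_ h2
    push_cast
    calc (Module.finrank ℝ (sphericalHarmonics D R l) : ℝ) * ((l : ℝ) + 1) ^ 2
        ≤ ((l : ℝ) + 1) ^ (D + 1) * ((l : ℝ) + 1) ^ 2 := by gcongr
      _ = ((l : ℝ) + 1) ^ (D + 3) := by ring
      _ ≤ ((l : ℝ) + 1) ^ (2 * (D + 3)) :=
          pow_le_pow_right₀ (by linarith [Nat.cast_nonneg (α := ℝ) l]) (by omega)
      _ = _ := by rw [pow_mul]

instance (D : ℕ) (R : ℝ) : IsProbabilityMeasure (freeMeasure D R) := by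
  unfold freeMeasure
  infer_instance

theorem lintegral_sq_gaussianReal (v : ℝ≥0) :
    ∫⁻ x, ENNReal.ofReal (x ^ 2) ∂gaussianReal 0 v = v := by
  have h1 := variance_id_gaussianReal (μ := 0) (v := v)
  have h2 : MemLp id 2 (gaussianReal 0 v) := memLp_id_gaussianReal 2
  rw [variance_of_integral_eq_zero aemeasurable_id (by simp)] at h1
  have h3 := ofReal_integral_eq_lintegral_ofReal h2.integrable_sq
    (Eventually.of_forall fun x => sq_nonneg x)
  rw [h1] at h3
  simpa using h3.symm

theorem measurePreserving_eval (i : Modes D R) :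
    MeasurePreserving (fun φ : Field D R => φ i) (freeMeasure D R)
      (gaussianReal 0 (Real.toNNReal (eig D R i.1 + 1)⁻¹)) :=
  measurePreserving_eval_infinitePi _ i

theorem lintegral_sq_freeMeasure (i : Modes D R) :
    ∫⁻ φ, ENNReal.ofReal (φ i ^ 2) ∂freeMeasure D R =
      ENNReal.ofReal (eig D R i.1 + 1)⁻¹ := by
  have := (measurePreserving_eval i).lintegral_comp (f := fun x : ℝ => ENNReal.ofReal (x ^ 2))
    (by fun_prop)
  rw [this, lintegral_sq_gaussianReal]
  rfl

theorem measurable_weighted_sq (a : ℝ) (i : Modes D R) :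
    Measurable fun φ : Field D R => ENNReal.ofReal (a * φ i ^ 2) := by
  have h : Measurable fun φ : Field D R => φ i := measurable_pi_apply i
  exact ((h.pow_const 2).const_mul a).ennreal_ofReal

/-- The expectation of the weighted sum of squares is finite, so the sum is finite almost surely. -/
theorem ae_isTempered [NeZero D] (hR : 0 < R) : ∀ᵐ φ ∂freeMeasure D R, IsTempered φ := by
  have hpos := fun l => eig_add_one_pos (D := D) R l
  have h1 : ∫⁻ φ : Field D R, ∑' i, ENNReal.ofReal (((eig D R i.1 + 1) ^ (D + 2))⁻¹ * φ i ^ 2)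
      ∂freeMeasure D R ≠ ⊤ := by
    rw [lintegral_tsum fun i => (measurable_weighted_sq _ i).aemeasurable]
    have h2 : ∀ i : Modes D R, ∫⁻ φ : Field D R,
        ENNReal.ofReal (((eig D R i.1 + 1) ^ (D + 2))⁻¹ * φ i ^ 2) ∂freeMeasure D R =
        ENNReal.ofReal ((eig D R i.1 + 1) ^ (D + 3))⁻¹ := by
      intro i
      have h3 : (0 : ℝ) ≤ ((eig D R i.1 + 1) ^ (D + 2))⁻¹ := (inv_pos.2 (pow_pos (hpos _) _)).le
      simp only [ENNReal.ofReal_mul h3]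
      rw [lintegral_const_mul _ (Measurable.ennreal_ofReal (Measurable.pow_const (measurable_pi_apply i) 2)), lintegral_sq_freeMeasure, ← ENNReal.ofReal_mul h3]
      congr 1
      rw [pow_succ _ (D + 2), mul_inv]
    simp only [h2]
    exact (summable_modes D hR).tsum_ofReal_ne_top
  refine (ae_lt_top (Measurable.tsum fun i => measurable_weighted_sq _ i) h1).mono fun φ hφ => ?_
  have h4 := ENNReal.summable_toReal hφ.ne
  refine h4.congr fun i => ENNReal.toReal_ofReal ?_
  have := hpos i.1
  positivity

end

section

open MvPolynomial

variable {R : ℝ}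

/-! ### Isometries acting on spherical harmonics -/

theorem pderiv_aeval (f : Fin (D + 1) → MvPolynomial (Fin (D + 1)) ℝ) (i : Fin (D + 1))
    (p : MvPolynomial (Fin (D + 1)) ℝ) :
    pderiv i (bind₁ f p) = ∑ j, bind₁ f (pderiv j p) * pderiv i (f j) := by
  induction p using MvPolynomial.induction_on with
  | C a => simp
  | add p q hp hq => simp [hp, hq, add_mul, Finset.sum_add_distrib]
  | mul_X p k hp =>
    have : ∀ j, bind₁ f (pderiv j (p * X k)) * pderiv i (f j) =
        f k * (bind₁ f (pderiv j p) * pderiv i (f j)) +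
          (if j = k then bind₁ f p * pderiv i (f j) else 0) := by
      intro j
      by_cases hj : j = k
      · subst hj
        simp [Derivation.leibniz]
        ring
      · simp [Derivation.leibniz, hj, pderiv_X_of_ne (Ne.symm hj)]
        ring
    rw [Finset.sum_congr rfl fun j _ => this j]
    simp only [Finset.sum_add_distrib, ← Finset.mul_sum, ← hp, Finset.sum_ite_eq',
      Finset.mem_univ, if_true, map_mul, bind₁_X_right, Derivation.leibniz, smul_eq_mul]
    ring

/-- The matrix entries of a linear isometry. -/
def isoEntry (A : Ambient D ≃ₗᵢ[ℝ] Ambient D) (j k : Fin (D + 1)) : ℝ :=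
  A (EuclideanSpace.single k 1) j

theorem isoEntry_eq (A : Ambient D ≃ₗᵢ[ℝ] Ambient D) (j k : Fin (D + 1)) :
    isoEntry A j k = A.symm (EuclideanSpace.single j 1) k := by
  have h1 : isoEntry A j k = inner ℝ (EuclideanSpace.single j (1 : ℝ) : Ambient D)
      (A (EuclideanSpace.single k 1)) := by
    simp [isoEntry, EuclideanSpace.inner_single_left]
  have h2 := A.symm.inner_map_map (EuclideanSpace.single j (1 : ℝ) : Ambient D)
    (A (EuclideanSpace.single k 1))
  rw [h1, ← h2, A.symm_apply_apply, EuclideanSpace.inner_single_right]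
  simp

theorem sum_isoEntry_mul (A : Ambient D ≃ₗᵢ[ℝ] Ambient D) (j k : Fin (D + 1)) :
    ∑ i, isoEntry A j i * isoEntry A k i = if j = k then 1 else 0 := by
  have h := A.symm.inner_map_map (EuclideanSpace.single k (1 : ℝ) : Ambient D)
    (EuclideanSpace.single j 1)
  rw [EuclideanSpace.inner_single_left] at h
  rw [PiLp.inner_apply] at h
  simp only [isoEntry_eq]
  simpa [mul_comm, Pi.single_apply, eq_comm] using h

/-- Substitution of a linear isometry into a polynomial. -/
def polyComp (A : Ambient D ≃ₗᵢ[ℝ] Ambient D) (p : MvPolynomial (Fin (D + 1)) ℝ) :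
    MvPolynomial (Fin (D + 1)) ℝ :=
  bind₁ (fun j => ∑ k, C (isoEntry A j k) * X k) p

theorem pderiv_polyComp (A : Ambient D ≃ₗᵢ[ℝ] Ambient D) (i : Fin (D + 1))
    (p : MvPolynomial (Fin (D + 1)) ℝ) :
    pderiv i (polyComp A p) = ∑ j, C (isoEntry A j i) * polyComp A (pderiv j p) := by
  rw [polyComp, pderiv_aeval]
  refine Finset.sum_congr rfl fun j _ => ?_
  have : pderiv i (∑ k, C (isoEntry A j k) * X k : MvPolynomial (Fin (D + 1)) ℝ) =
      C (isoEntry A j i) := by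
    rw [map_sum, Finset.sum_eq_single i]
    · simp
    · intro k _ hk
      simp [pderiv_X_of_ne hk]
    · simp
  rw [this, mul_comm]
  rfl

theorem laplacian_polyComp (A : Ambient D ≃ₗᵢ[ℝ] Ambient D) (p : MvPolynomial (Fin (D + 1)) ℝ) :
    ∑ i, pderiv i (pderiv i (polyComp A p)) = polyComp A (∑ i, pderiv i (pderiv i p)) := by
  have h1 : ∀ i, pderiv i (pderiv i (polyComp A p)) = ∑ j, ∑ k,
      C (isoEntry A j i * isoEntry A k i) * polyComp A (pderiv k (pderiv j p)) := by
    intro i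
    rw [pderiv_polyComp, map_sum]
    refine Finset.sum_congr rfl fun j _ => ?_
    rw [pderiv_C_mul, pderiv_polyComp, Finset.mul_sum]
    refine Finset.sum_congr rfl fun k _ => ?_
    rw [C_mul]
    ring
  simp only [h1]
  rw [Finset.sum_comm]
  rw [polyComp, map_sum]
  refine Finset.sum_congr rfl fun j _ => ?_
  rw [Finset.sum_comm]
  simp only [← Finset.sum_mul, ← map_sum, sum_isoEntry_mul]
  rw [Finset.sum_eq_single j]
  · simp [polyComp]
  · intro k _ hk
    simp [Ne.symm hk]
  · simp

theorem polyFun_polyComp (R : ℝ) (A : Ambient D ≃ₗᵢ[ℝ] Ambient D)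
    (p : MvPolynomial (Fin (D + 1)) ℝ) (v : Ambient D) :
    polyFun R (polyComp A p) v = polyFun R p (sphereIso R A v) := by
  have h : ∀ w : Ambient D, ∀ j, ∑ k, isoEntry A j k * w k = A w j := by
    intro w j
    have h1 := A.inner_map_map (A.symm (EuclideanSpace.single j (1 : ℝ))) w
    rw [A.apply_symm_apply, EuclideanSpace.inner_single_left, PiLp.inner_apply] at h1
    simp only [isoEntry_eq]
    simpa [mul_comm] using h1.symm
  unfold polyFun polyComp
  rw [sphereIso, add_sub_cancel_left]
  generalize v - center D R = w
  induction p using MvPolynomial.induction_on with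
  | C a => simp
  | add p q hp hq => simp [hp, hq]
  | mul_X p k hp => simp [hp, h]

theorem isHomogeneous_polyComp (A : Ambient D ≃ₗᵢ[ℝ] Ambient D) {l : ℕ}
    {p : MvPolynomial (Fin (D + 1)) ℝ} (hp : p.IsHomogeneous l) :
    (polyComp A p).IsHomogeneous l := by
  have h := hp.aeval (fun j => ∑ k, C (isoEntry A j k) * X k : Fin (D + 1) →
    MvPolynomial (Fin (D + 1)) ℝ) (n := 1) fun j => IsHomogeneous.sum _ _ _ fun k _ => by
      simpa using (isHomogeneous_C (Fin (D + 1)) (isoEntry A j k)).mul (isHomogeneous_X ℝ k)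
  rwa [one_mul] at h

/-- A polynomial representing `Y_{l,m}`. -/
def harmPoly (hR : 0 < R) (Y : HarmonicBasis D R) (i : Modes D R) :
    MvPolynomial (Fin (D + 1)) ℝ := (exists_polyFun_basisFun hR Y i).choose

/-- `Y_{l,m}` as a function. -/
def harmFun (hR : 0 < R) (Y : HarmonicBasis D R) (i : Modes D R) : Ambient D → ℝ :=
  polyFun R (harmPoly hR Y i)

theorem continuous_harmFun (hR : 0 < R) (Y : HarmonicBasis D R) (i : Modes D R) :
    Continuous (harmFun hR Y i) := continuous_polyFun _ _

theorem contDiff_harmFun (hR : 0 < R) (Y : HarmonicBasis D R) (i : Modes D R) :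
    ContDiff ℝ ∞ (harmFun hR Y i) := contDiff_polyFun _ _

theorem coeff_eq (hR : 0 < R) (Y : HarmonicBasis D R) (u : Ambient D → ℝ) (i : Modes D R) :
    coeff Y u i = ∫ v, u v * harmFun hR Y i v ∂surface D R :=
  (exists_polyFun_basisFun hR Y i).choose_spec.2.2.2 u

theorem coeff_harmFun [NeZero D] (hR : 0 < R) (Y : HarmonicBasis D R) (i j : Modes D R) :
    coeff Y (harmFun hR Y i) j = if i = j then 1 else 0 := by
  rw [coeff_eq hR, ← inner_toL2 hR (continuous_harmFun hR Y i) (continuous_harmFun hR Y j)]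
  have h : ∀ i, toL2 hR (continuous_harmFun hR Y i) = basisFun Y i := fun i =>
    (exists_polyFun_basisFun hR Y i).choose_spec.2.2.1.symm
  rw [h, h, orthonormal_iff_ite.1 (orthonormal_basisFun hR Y)]

/-- The matrix of an isometry in the basis of spherical harmonics. -/
def isoMat (hR : 0 < R) (Y : HarmonicBasis D R) (A : Ambient D ≃ₗᵢ[ℝ] Ambient D)
    (i j : Modes D R) : ℝ :=
  coeff Y (fun v => harmFun hR Y i (sphereIso R A v)) j

theorem continuous_harmFun_comp (hR : 0 < R) (Y : HarmonicBasis D R)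
    (A : Ambient D ≃ₗᵢ[ℝ] Ambient D) (i : Modes D R) :
    Continuous fun v => harmFun hR Y i (sphereIso R A v) :=
  (continuous_harmFun hR Y i).comp (continuous_sphereIso R A)

theorem integral_mul_comp_sphereIso (A : Ambient D ≃ₗᵢ[ℝ] Ambient D) (u w : Ambient D → ℝ) :
    ∫ v, u (sphereIso R A v) * w v ∂surface D R =
      ∫ v, u v * w (sphereIso R A.symm v) ∂surface D R := by
  rw [← integral_comp_sphereIso R A fun v => u v * w (sphereIso R A.symm v)]
  simp only [sphereIso_symm_apply]

theorem isoMat_symm (hR : 0 < R) (Y : HarmonicBasis D R) (A : Ambient D ≃ₗᵢ[ℝ] Ambient D)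
    (i j : Modes D R) : isoMat hR Y A.symm i j = isoMat hR Y A j i := by
  rw [isoMat, isoMat, coeff_eq hR, coeff_eq hR, integral_mul_comp_sphereIso]
  simp only [mul_comm]
  rfl

/-- Substitution of an isometry into a harmonic polynomial keeps it harmonic of the same degree. The
matrix is therefore block diagonal with finite blocks. -/
theorem isoMat_eq_zero [NeZero D] (hR : 0 < R) (Y : HarmonicBasis D R)
    (A : Ambient D ≃ₗᵢ[ℝ] Ambient D) {i j : Modes D R} (hij : i.1 ≠ j.1) :
    isoMat hR Y A i j = 0 := by
  obtain ⟨hp, hh, -⟩ := (exists_polyFun_basisFun hR Y i).choose_spec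
  obtain ⟨hq, hqh, -⟩ := (exists_polyFun_basisFun hR Y j).choose_spec
  have h := inner_eq_zero_of_degree_ne hR hij
    (toL2_polyFun_mem hR (isHomogeneous_polyComp A hp) (by
      rw [laplacian_polyComp, hh]
      simp [polyComp])) (toL2_polyFun_mem hR hq hqh)
  rw [inner_toL2] at h
  rw [isoMat, coeff_eq hR, ← h]
  simp only [polyFun_polyComp]
  rfl

theorem eq_sum_of_hasSum_of_block {f : Modes D R → ℝ} {a : ℝ} (l : ℕ)
    (h0 : ∀ i : Modes D R, i.1 ≠ l → f i = 0) (h : HasSum f a) : a = ∑ m, f ⟨l, m⟩ := by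
  have h1 : HasSum f (∑ i ∈ Finset.univ.map (Function.Embedding.sigmaMk l), f i) :=
    hasSum_sum_of_ne_finset_zero fun i hi => h0 i fun hl => hi (by
      obtain ⟨l', m⟩ := i
      subst hl
      simp)
  rw [h.unique h1]
  simp

/-- The isometry preserves the `L²` inner product. Parseval expresses this through the matrix
entries, of which only one block survives. -/
theorem sum_isoMat_row [NeZero D] (hR : 0 < R) (Y : HarmonicBasis D R)
    (A : Ambient D ≃ₗᵢ[ℝ] Ambient D) (i j : Modes D R) :
    ∑ m, isoMat hR Y A i ⟨i.1, m⟩ * isoMat hR Y A j ⟨i.1, m⟩ = if i = j then 1 else 0 := by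
  have h := hasSum_coeff_mul_coeff hR Y (continuous_harmFun_comp hR Y A i)
    (continuous_harmFun_comp hR Y A j)
  rw [integral_comp_sphereIso R A fun v => harmFun hR Y i v * harmFun hR Y j v, ← coeff_eq hR,
    coeff_harmFun] at h
  exact (eq_sum_of_hasSum_of_block i.1 (fun k hk => by
    rw [← isoMat, isoMat_eq_zero hR Y A (Ne.symm hk), zero_mul]) h).symm

theorem sum_isoMat_col [NeZero D] (hR : 0 < R) (Y : HarmonicBasis D R)
    (A : Ambient D ≃ₗᵢ[ℝ] Ambient D) (i j : Modes D R) :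
    ∑ m, isoMat hR Y A ⟨i.1, m⟩ i * isoMat hR Y A ⟨i.1, m⟩ j = if i = j then 1 else 0 := by
  rw [← sum_isoMat_row hR Y A.symm]
  simp only [isoMat_symm]

theorem coeff_comp_sphereIso [NeZero D] (hR : 0 < R) (Y : HarmonicBasis D R)
    (A : Ambient D ≃ₗᵢ[ℝ] Ambient D) {U : Ambient D → ℝ} (hU : Continuous U) (i : Modes D R) :
    coeff Y (fun v => U (sphereIso R A v)) i =
      ∑ m, coeff Y U ⟨i.1, m⟩ * isoMat hR Y A ⟨i.1, m⟩ i := by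
  have h := hasSum_coeff_mul_coeff hR Y hU (continuous_harmFun_comp hR Y A.symm i)
  rw [← integral_mul_comp_sphereIso, ← coeff_eq hR] at h
  rw [eq_sum_of_hasSum_of_block i.1 (fun k hk => by
    rw [← isoMat, isoMat_eq_zero hR Y A.symm (Ne.symm hk), mul_zero]) h]
  exact Finset.sum_congr rfl fun m _ => congrArg _ (isoMat_symm hR Y A _ _)

theorem sum_sq_of_orthogonal {ι : Type*} [Fintype ι] [DecidableEq ι] {M : ι → ι → ℝ}
    (hM : ∀ j k, ∑ i, M i j * M i k = if j = k then 1 else 0) (x : ι → ℝ) :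
    ∑ i, (∑ j, M i j * x j) ^ 2 = ∑ j, x j ^ 2 := by
  simp only [sq, Finset.sum_mul_sum]
  rw [Finset.sum_comm]
  refine Finset.sum_congr rfl fun j _ => ?_
  rw [Finset.sum_comm]
  have h : ∀ k, ∑ i, M i j * x j * (M i k * x k) = if j = k then x j * x k else 0 := by
    intro k
    have := congrArg (x j * x k * ·) (hM j k)
    simp only [Finset.mul_sum, mul_ite, mul_one, mul_zero] at this
    rw [← this]
    exact Finset.sum_congr rfl fun i _ => by ring
  simp [h]

theorem sum_coeff_sq_comp_sphereIso [NeZero D] (hR : 0 < R) (Y : HarmonicBasis D R)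
    (A : Ambient D ≃ₗᵢ[ℝ] Ambient D) {U : Ambient D → ℝ} (hU : Continuous U) (l : ℕ) :
    ∑ m, coeff Y (fun v => U (sphereIso R A v)) ⟨l, m⟩ ^ 2 = ∑ m, coeff Y U ⟨l, m⟩ ^ 2 := by
  have h := sum_sq_of_orthogonal (M := fun m m' => isoMat hR Y A ⟨l, m'⟩ ⟨l, m⟩) (fun m m' =>
    (sum_isoMat_row hR Y A ⟨l, m⟩ ⟨l, m'⟩).trans (by simp)) fun m => coeff Y U ⟨l, m⟩
  simp only [coeff_comp_sphereIso hR Y A hU, ← h, mul_comm]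

/-! ### Isometries acting on fields -/

/-- The action of an isometry on fields. -/
def rotField (hR : 0 < R) (Y : HarmonicBasis D R) (A : Ambient D ≃ₗᵢ[ℝ] Ambient D)
    (φ : Field D R) : Field D R :=
  fun i => ∑ m, isoMat hR Y A i ⟨i.1, m⟩ * φ ⟨i.1, m⟩

theorem measurable_rotField (hR : 0 < R) (Y : HarmonicBasis D R)
    (A : Ambient D ≃ₗᵢ[ℝ] Ambient D) : Measurable (rotField hR Y A) :=
  measurable_pi_lambda _ fun _ => Finset.measurable_sum _ fun _ _ =>
    (measurable_pi_apply _).const_mul _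

theorem sum_rotField_sq [NeZero D] (hR : 0 < R) (Y : HarmonicBasis D R)
    (A : Ambient D ≃ₗᵢ[ℝ] Ambient D) (φ : Field D R) (l : ℕ) :
    ∑ m, rotField hR Y A φ ⟨l, m⟩ ^ 2 = ∑ m, φ ⟨l, m⟩ ^ 2 := by
  exact sum_sq_of_orthogonal (M := fun m m' => isoMat hR Y A ⟨l, m⟩ ⟨l, m'⟩) (fun m m' =>
    (sum_isoMat_col hR Y A ⟨l, m⟩ ⟨l, m'⟩).trans (by simp)) fun m => φ ⟨l, m⟩

theorem isTempered_iff [NeZero D] {φ : Field D R} : IsTempered φ ↔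
    Summable fun l : ℕ => ((eig D R l + 1) ^ (D + 2))⁻¹ * ∑ m, φ ⟨l, m⟩ ^ 2 := by
  have h : ∀ i : Modes D R, 0 ≤ ((eig D R i.1 + 1) ^ (D + 2))⁻¹ * φ i ^ 2 := fun i => by
    have := eig_add_one_pos (D := D) R i.1
    positivity
  rw [IsTempered, summable_sigma_of_nonneg h]
  simp only [tsum_fintype, Finset.mul_sum]
  exact and_iff_right fun l => Summable.of_finite

theorem IsTempered.rotField [NeZero D] (hR : 0 < R) (Y : HarmonicBasis D R)
    (A : Ambient D ≃ₗᵢ[ℝ] Ambient D) {φ : Field D R} (hφ : IsTempered φ) :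
    IsTempered (rotField hR Y A φ) := by
  rw [isTempered_iff] at hφ ⊢
  simpa only [sum_rotField_sq] using hφ

/-- Both series are summed degree by degree, and within a degree the identity is an exchange of two
finite sums. Temperedness and rapid decay make the regrouping legitimate. -/
theorem pair_rotField [NeZero D] (hR : 0 < R) (Y : HarmonicBasis D R)
    (A : Ambient D ≃ₗᵢ[ℝ] Ambient D) {φ : Field D R} (hφ : IsTempered φ) {U : Ambient D → ℝ}
    (hU : ContDiff ℝ ∞ U) :
    pair Y (rotField hR Y A φ) U = pair Y φ fun v => U (sphereIso R A v) := by
  have h1 := (hφ.rotField hR Y A).summable_mul (isRapid_coeff hR Y hU)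
  have h2 := hφ.summable_mul (isRapid_coeff hR Y (hU.comp (contDiff_sphereIso R A)))
  rw [pair, pair, h1.tsum_sigma]
  refine Eq.trans ?_ h2.tsum_sigma.symm
  refine tsum_congr fun l => ?_
  have h3 : ∑ m, (∑ m', isoMat hR Y A ⟨l, m⟩ ⟨l, m'⟩ * φ ⟨l, m'⟩) * coeff Y U ⟨l, m⟩ =
      ∑ m', φ ⟨l, m'⟩ * ∑ m, coeff Y U ⟨l, m⟩ * isoMat hR Y A ⟨l, m⟩ ⟨l, m'⟩ := by
    simp only [Finset.sum_mul, Finset.mul_sum]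
    rw [Finset.sum_comm]
    exact Finset.sum_congr rfl fun m _ => Finset.sum_congr rfl fun m' _ => by ring
  rw [tsum_fintype, tsum_fintype]
  refine h3.trans (Finset.sum_congr rfl fun m _ => ?_)
  exact congrArg _ (coeff_comp_sphereIso hR Y A hU.continuous ⟨l, m⟩).symm

end

section

variable {R : ℝ}

/-! ### The law of the free field -/

/-- The covariance of the free field. -/
def freeCov {D : ℕ} {R : ℝ} (c d : Modes D R → ℝ) : ℝ := ∑' i, (eig D R i.1 + 1)⁻¹ * (c i * d i)

theorem measurable_tsum_mul (c : Modes D R → ℝ) :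
    Measurable fun φ : Field D R => ∑' i, φ i * c i :=
  Measurable.tsum fun i => Measurable.mul_const (measurable_pi_apply i) _

theorem measurable_pair (Y : HarmonicBasis D R) (u : Ambient D → ℝ) :
    Measurable fun φ : Field D R => pair Y φ u := measurable_tsum_mul _

theorem IsRapid.summable_cov [NeZero D] {c d : Modes D R → ℝ} (hc : IsRapid c)
    (hd : IsRapid d) : Summable fun i => (eig D R i.1 + 1)⁻¹ * (c i * d i) := by
  refine Summable.of_norm (((hc 0).add (hd 0)).of_nonneg_of_le (fun i => norm_nonneg _)
    fun i => ?_)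
  have h1 := eig_add_one_pos (D := D) R i.1
  have h2 : (eig D R i.1 + 1)⁻¹ ≤ 1 := inv_le_one_of_one_le₀ (one_le_eig_add_one R i.1)
  rw [norm_mul, Real.norm_of_nonneg (inv_pos.2 h1).le, pow_zero, one_mul, one_mul, norm_mul,
    Real.norm_eq_abs, Real.norm_eq_abs]
  refine (mul_le_of_le_one_left (by positivity) h2).trans ?_
  nlinarith [sq_nonneg (|c i| - |d i|), sq_abs (c i), sq_abs (d i), sq_nonneg (c i),
    sq_nonneg (d i)]

theorem IsRapid.sum [NeZero D] {J : Type*} [Fintype J] {c : J → Modes D R → ℝ}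
    (hc : ∀ j, IsRapid (c j)) (t : J → ℝ) : IsRapid fun i => ∑ j, t j * c j i := by
  intro p
  have h1 : Summable fun i => ∑ j, (∑ j, t j ^ 2) * ((eig D R i.1 + 1) ^ p * c j i ^ 2) :=
    summable_sum fun j _ => (hc j p).mul_left _
  refine h1.of_nonneg_of_le (fun i => ?_) fun i => ?_
  · have := eig_add_one_pos (D := D) R i.1
    positivity
  · have h2 := eig_add_one_pos (D := D) R i.1
    have h3 := Finset.sum_mul_sq_le_sq_mul_sq Finset.univ t fun j => c j i
    calc _ ≤ (eig D R i.1 + 1) ^ p * ((∑ j, t j ^ 2) * ∑ j, c j i ^ 2) := by gcongr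
      _ = _ := by
        rw [Finset.mul_sum, Finset.mul_sum]
        exact Finset.sum_congr rfl fun j _ => by ring

/-- For finite partial sums independence factorizes the integral into one-dimensional Gaussian
characteristic functions. The limit is taken by dominated convergence, the integrand having modulus
1. -/
theorem integral_cexp_tsum [NeZero D] (hR : 0 < R) {c : Modes D R → ℝ} (hc : IsRapid c) :
    ∫ φ : Field D R, Complex.exp ((∑' i, φ i * c i : ℝ) * Complex.I) ∂freeMeasure D R =
      Complex.exp (-((freeCov c c : ℝ) / 2 : ℂ)) := by
  have h1 : Tendsto (fun s : Finset (Modes D R) => ∫ φ : Field D R,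
      Complex.exp ((∑ i ∈ s, φ i * c i : ℝ) * Complex.I) ∂freeMeasure D R) atTop
      (𝓝 (∫ φ : Field D R, Complex.exp ((∑' i, φ i * c i : ℝ) * Complex.I) ∂freeMeasure D R)) := by
    refine tendsto_integral_filter_of_dominated_convergence (fun _ => 1)
      (Eventually.of_forall fun s => ?_) (Eventually.of_forall fun s =>
        Eventually.of_forall fun φ => ?_) (integrable_const _) ?_
    · have : Measurable fun φ : Field D R => ∑ i ∈ s, φ i * c i :=
        Finset.measurable_sum _ fun i _ => Measurable.mul_const (measurable_pi_apply i) _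
      exact (by fun_prop : Measurable _).aestronglyMeasurable
    · rw [Complex.norm_exp_ofReal_mul_I]
    · filter_upwards [ae_isTempered hR] with φ hφ
      have h2 := (hφ.summable_mul hc).hasSum
      refine (Complex.continuous_exp.tendsto _).comp (Tendsto.mul_const _ ?_)
      exact (Complex.continuous_ofReal.tendsto _).comp h2
  have h2 : ∀ s : Finset (Modes D R), ∫ φ : Field D R,
      Complex.exp ((∑ i ∈ s, φ i * c i : ℝ) * Complex.I) ∂freeMeasure D R =
      Complex.exp (-((∑ i ∈ s, (eig D R i.1 + 1)⁻¹ * (c i * c i) : ℝ) / 2 : ℂ)) := by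
    intro s
    have h3 : ∀ φ : Field D R, Complex.exp ((∑ i ∈ s, φ i * c i : ℝ) * Complex.I) =
        ∏ i : s, Complex.exp (c i * φ i * Complex.I) := by
      intro φ
      rw [← Complex.exp_sum]
      congr 1
      rw [← Finset.sum_mul, Complex.ofReal_sum, ← Finset.sum_coe_sort s]
      simp [mul_comm]
    have h3' := integral_restrict_infinitePi (s := s)
      (μ := fun i : Modes D R => gaussianReal 0 (Real.toNNReal (eig D R i.1 + 1)⁻¹))
      (f := fun x : s → ℝ => ∏ i : s, Complex.exp (c i * x i * Complex.I))
      (Continuous.aestronglyMeasurable (by fun_prop))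
    refine (integral_congr_ae (Eventually.of_forall h3)).trans (h3'.trans ?_)
    rw [integral_fintype_prod_eq_prod (fun (i : s) (x : ℝ) => Complex.exp (c i * x * Complex.I))]
    have h4 : ∀ i : s, ∫ x, Complex.exp (c i * x * Complex.I)
        ∂(gaussianReal 0 (Real.toNNReal (eig D R i.1.1 + 1)⁻¹)) =
        Complex.exp (-(((eig D R i.1.1 + 1)⁻¹ * (c i * c i) : ℝ) / 2 : ℂ)) := by
      intro i
      have h5 := charFun_gaussianReal (μ := 0) (v := Real.toNNReal (eig D R i.1.1 + 1)⁻¹) (c i)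
      rw [charFun_apply_real] at h5
      rw [h5, Real.coe_toNNReal _ (inv_pos.2 (eig_add_one_pos R i.1.1)).le]
      congr 1
      push_cast
      ring
    simp only [h4]
    rw [← Complex.exp_sum, Finset.sum_coe_sort s fun i : Modes D R =>
      (-(((eig D R i.1 + 1)⁻¹ * (c i * c i) : ℝ) / 2 : ℂ))]
    congr 1
    rw [Finset.sum_neg_distrib, ← Finset.sum_div, Complex.ofReal_sum]
  refine tendsto_nhds_unique h1 ?_
  simp only [h2]
  refine (Complex.continuous_exp.tendsto _).comp (Tendsto.neg (Tendsto.div_const ?_ _))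
  exact (Complex.continuous_ofReal.tendsto _).comp (hc.summable_cov hc).hasSum

/-- The joint law of finitely many linear functionals of the free field. -/
theorem charFun_map_tsum [NeZero D] (hR : 0 < R) {J : Type*} [Fintype J] {c : J → Modes D R → ℝ}
    (hc : ∀ j, IsRapid (c j)) (t : EuclideanSpace ℝ J) :
    charFun ((freeMeasure D R).map fun φ => (WithLp.toLp 2 fun j => ∑' i, φ i * c j i :
      EuclideanSpace ℝ J)) t =
      Complex.exp (-((freeCov (fun i => ∑ j, t j * c j i) (fun i => ∑ j, t j * c j i) : ℝ) / 2 :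
        ℂ)) := by
  rw [← integral_cexp_tsum hR (IsRapid.sum hc t), charFun_apply, integral_map]
  · refine integral_congr_ae ((ae_isTempered hR).mono fun φ hφ => ?_)
    have h1 : ∑' i, φ i * ∑ j, t j * c j i = ∑ j, t j * ∑' i, φ i * c j i := by
      simp only [← tsum_mul_left]
      rw [← Summable.tsum_finsetSum fun j _ => ((hφ.summable_mul (hc j)).mul_left _)]
      refine tsum_congr fun i => ?_
      rw [Finset.mul_sum]
      exact Finset.sum_congr rfl fun j _ => by ring
    simp only [h1, PiLp.inner_apply]
    simp
  · refine Measurable.aemeasurable ?_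
    refine (WithLp.measurable_toLp 2 _).comp (measurable_pi_lambda _ fun j => ?_)
    exact measurable_tsum_mul _
  · exact (by fun_prop : Continuous _).aestronglyMeasurable

theorem freeCov_comm (c d : Modes D R → ℝ) : freeCov c d = freeCov d c := by
  simp only [freeCov, mul_comm]

theorem freeCov_sum_left [NeZero D] {J : Type*} [Fintype J] {c : J → Modes D R → ℝ}
    (hc : ∀ j, IsRapid (c j)) {d : Modes D R → ℝ} (hd : IsRapid d) (t : J → ℝ) :
    freeCov (fun i => ∑ j, t j * c j i) d = ∑ j, t j * freeCov (c j) d := by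
  simp only [freeCov, ← tsum_mul_left]
  rw [← Summable.tsum_finsetSum fun j _ => ((hc j).summable_cov hd).mul_left _]
  refine tsum_congr fun i => ?_
  rw [Finset.sum_mul, Finset.mul_sum]
  exact Finset.sum_congr rfl fun j _ => by ring

theorem freeCov_sum_sum [NeZero D] {J : Type*} [Fintype J] {c : J → Modes D R → ℝ}
    (hc : ∀ j, IsRapid (c j)) (t : J → ℝ) :
    freeCov (fun i => ∑ j, t j * c j i) (fun i => ∑ j, t j * c j i) =
      ∑ j, ∑ k, t j * (t k * freeCov (c j) (c k)) := by
  rw [freeCov_sum_left hc (IsRapid.sum hc t)]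
  refine Finset.sum_congr rfl fun j _ => ?_
  rw [freeCov_comm, freeCov_sum_left hc (hc j), Finset.mul_sum]
  exact Finset.sum_congr rfl fun k _ => by rw [freeCov_comm]

/-- The joint law of finitely many linear functionals is determined by their covariances. -/
theorem map_tsum_congr [NeZero D] (hR : 0 < R) {J : Type*} [Fintype J]
    {c c' : J → Modes D R → ℝ} (hc : ∀ j, IsRapid (c j)) (hc' : ∀ j, IsRapid (c' j))
    (h : ∀ j k, freeCov (c j) (c k) = freeCov (c' j) (c' k)) :
    (freeMeasure D R).map (fun φ j => ∑' i, φ i * c j i) =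
      (freeMeasure D R).map (fun φ j => ∑' i, φ i * c' j i) := by
  have hm : ∀ c : J → Modes D R → ℝ, Measurable fun (φ : Field D R) j => ∑' i, φ i * c j i :=
    fun c => measurable_pi_lambda _ fun j => measurable_tsum_mul _
  have hm' : ∀ c : J → Modes D R → ℝ, Measurable fun (φ : Field D R) =>
      (WithLp.toLp 2 fun j => ∑' i, φ i * c j i : EuclideanSpace ℝ J) :=
    fun c => (WithLp.measurable_toLp 2 _).comp (hm c)
  have h1 : (freeMeasure D R).map (fun φ => (WithLp.toLp 2 fun j => ∑' i, φ i * c j i :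
      EuclideanSpace ℝ J)) = (freeMeasure D R).map (fun φ => (WithLp.toLp 2 fun j =>
        ∑' i, φ i * c' j i : EuclideanSpace ℝ J)) := by
    have := Measure.isProbabilityMeasure_map (μ := freeMeasure D R) (hm' c).aemeasurable
    have := Measure.isProbabilityMeasure_map (μ := freeMeasure D R) (hm' c').aemeasurable
    refine Measure.ext_of_charFun (funext fun t => ?_)
    rw [charFun_map_tsum hR hc, charFun_map_tsum hR hc', freeCov_sum_sum hc, freeCov_sum_sum hc']
    simp only [h]
  have h2 := congrArg (Measure.map (WithLp.ofLp : EuclideanSpace ℝ J → J → ℝ)) h1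
  rwa [Measure.map_map (WithLp.measurable_ofLp 2 _) (hm' c),
    Measure.map_map (WithLp.measurable_ofLp 2 _) (hm' c')] at h2

theorem isRapid_of_block (l : ℕ) {c : Modes D R → ℝ} (h : ∀ i : Modes D R, i.1 ≠ l → c i = 0) :
    IsRapid c := by
  intro p
  refine summable_of_ne_finset_zero
    (s := Finset.univ.map (Function.Embedding.sigmaMk (β := fun l => Fin (Module.finrank ℝ
      (sphericalHarmonics D R l))) l)) fun i hi => ?_
  rw [h i fun hl => hi (by
      obtain ⟨l', m⟩ := i
      subst hl
      simp)]
  simp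

theorem tsum_of_block {f : Modes D R → ℝ} (l : ℕ) (h0 : ∀ i : Modes D R, i.1 ≠ l → f i = 0) :
    ∑' i, f i = ∑ m, f ⟨l, m⟩ := by
  refine eq_sum_of_hasSum_of_block l h0 (Summable.hasSum ?_)
  refine summable_of_ne_finset_zero
    (s := Finset.univ.map (Function.Embedding.sigmaMk (β := fun l => Fin (Module.finrank ℝ
      (sphericalHarmonics D R l))) l)) fun i hi => h0 i fun hl => hi (by
      obtain ⟨l', m⟩ := i
      subst hl
      simp)

/-- The variance depends only on the degree and each block is orthogonal, so every finite family of
rotated modes has the same covariance as the original modes. A measure on the product is determined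
by its finite marginals. -/
theorem map_rotField [NeZero D] (hR : 0 < R) (Y : HarmonicBasis D R)
    (A : Ambient D ≃ₗᵢ[ℝ] Ambient D) :
    (freeMeasure D R).map (rotField hR Y A) = freeMeasure D R := by
  classical
  have h1 : IsProjectiveLimit (freeMeasure D R) _ := Measure.isProjectiveLimit_infinitePi
    fun i : Modes D R => gaussianReal 0 (Real.toNNReal (eig D R i.1 + 1)⁻¹)
  refine IsProjectiveLimit.unique (fun I => ?_) h1
  rw [← h1 I, Measure.map_map (Finset.measurable_restrict I) (measurable_rotField hR Y A)]
  -- Two families of functionals are compared: the coordinates themselves, as delta coefficients,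
  -- and the corresponding rows of the matrix.
  have h2 := map_tsum_congr hR (J := I) (c := fun i j => if j = i.1 then 1 else 0)
    (c' := fun i j => isoMat hR Y A i.1 j) (fun i => isRapid_of_block i.1.1 fun j hj =>
      if_neg fun h => hj (by rw [h])) (fun i => isRapid_of_block i.1.1 fun j hj =>
      isoMat_eq_zero hR Y A (Ne.symm hj)) fun i k => by
    rw [freeCov, freeCov, tsum_of_block (l := i.1.1) fun j hj => ?_,
      tsum_of_block (l := i.1.1) fun j hj => ?_]
    · refine Eq.trans ?_ ((Finset.mul_sum _ _ _).symm.trans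
        (congrArg ((eig D R i.1.1 + 1)⁻¹ * ·) (sum_isoMat_row hR Y A i.1 k.1))).symm
      obtain ⟨⟨l, m⟩, hi⟩ := i
      rw [Finset.sum_eq_single m]
      · simp
      · intro m' _ hm
        simp [hm]
      · simp
    · rw [isoMat_eq_zero hR Y A (Ne.symm hj)]; simp
    · rw [if_neg fun h => hj (by rw [h])]; simp
  convert h2.symm using 2
  · funext φ i
    refine Eq.trans ?_ (tsum_of_block (l := i.1.1) fun j hj => ?_).symm
    · show ∑ m, isoMat hR Y A i.1 ⟨i.1.1, m⟩ * φ ⟨i.1.1, m⟩ = _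
      exact Finset.sum_congr rfl fun m _ => mul_comm _ _
    · rw [isoMat_eq_zero hR Y A (Ne.symm hj), mul_zero]
  · funext φ i
    simp

end

section

variable {R : ℝ}

/-! ### Pull-backs by the stereographic projection -/

/-- The first `D` coordinates. -/
def horiz (v : Ambient D) : Space D := WithLp.toLp 2 fun i => v i.castSucc

theorem contDiff_horiz : ContDiff ℝ ∞ (horiz : Ambient D → Space D) := by
  rw [contDiff_euclidean]
  intro i
  show ContDiff ℝ ∞ fun v : Ambient D => v i.castSucc
  fun_prop

theorem norm_sq_horiz_add (v : Ambient D) : ‖v‖ ^ 2 = ‖horiz v‖ ^ 2 + v (Fin.last D) ^ 2 := by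
  rw [EuclideanSpace.norm_sq_eq, EuclideanSpace.norm_sq_eq, Fin.sum_univ_castSucc]
  simp [horiz]

theorem mem_sphere_iff (hR : 0 < R) {v : Ambient D} : v ∈ Metric.sphere (center D R) R ↔
    ‖horiz v‖ ^ 2 = v (Fin.last D) * (2 * R - v (Fin.last D)) := by
  have h1 : ‖v - center D R‖ ^ 2 = ‖horiz v‖ ^ 2 + (v (Fin.last D) - R) ^ 2 := by
    rw [norm_sq_horiz_add]
    have : horiz (v - center D R) = horiz v := by
      ext i
      simp [horiz, center, Fin.castSucc_ne_last]
    rw [this]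
    simp [center]
  rw [mem_sphere_iff_norm, ← sq_eq_sq₀ (norm_nonneg _) hR.le, h1]
  constructor <;> intro h <;> linarith

theorem norm_sq_of_mem_sphere (hR : 0 < R) {v : Ambient D}
    (hv : v ∈ Metric.sphere (center D R) R) : ‖v‖ ^ 2 = 2 * R * v (Fin.last D) := by
  rw [norm_sq_horiz_add, (mem_sphere_iff hR).1 hv]
  ring

theorem last_nonneg (hR : 0 < R) {v : Ambient D} (hv : v ∈ Metric.sphere (center D R) R) :
    0 ≤ v (Fin.last D) := by
  have := norm_sq_of_mem_sphere hR hv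
  by_contra! h
  nlinarith [sq_nonneg ‖v‖]

theorem last_le (hR : 0 < R) {v : Ambient D} (hv : v ∈ Metric.sphere (center D R) R) :
    v (Fin.last D) ≤ 2 * R := by
  have h1 := (mem_sphere_iff hR).1 hv
  by_contra! h
  nlinarith [sq_nonneg ‖horiz v‖]

theorem stereo_eq (hR : 0 < R) {v : Ambient D} (hv : v (Fin.last D) ≠ 2 * R) :
    stereo R v = (1 - 1 / (2 * R) * v (Fin.last D))⁻¹ • horiz v := by
  ext i
  have : 2 * R - v (Fin.last D) ≠ 0 := sub_ne_zero.2 hv.symm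
  have h : 1 - 1 / (2 * R) * v (Fin.last D) ≠ 0 := by
    intro h
    field_simp at h
    exact this (by linarith)
  simp only [stereo, horiz, PiLp.smul_apply, smul_eq_mul]
  field_simp

theorem norm_sq_stereo (hR : 0 < R) {v : Ambient D} (hv : v ∈ Metric.sphere (center D R) R) :
    ‖stereo R v‖ ^ 2 * (2 * R - v (Fin.last D)) ^ 2 =
      4 * R ^ 2 * (v (Fin.last D) * (2 * R - v (Fin.last D))) := by
  by_cases h : v (Fin.last D) = 2 * R
  · simp [h]
  · have h1 : 2 * R - v (Fin.last D) ≠ 0 := sub_ne_zero.2 (Ne.symm h)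
    have h2 : stereo R v = (2 * R / (2 * R - v (Fin.last D))) • horiz v := by
      ext i
      simp [stereo, horiz]
    rw [h2, norm_smul, mul_pow, Real.norm_eq_abs, sq_abs, (mem_sphere_iff hR).1 hv]
    field_simp
    ring

theorem norm_sq_stereo_mul (hR : 0 < R) {v : Ambient D} (hv : v ∈ Metric.sphere (center D R) R)
    (h : v (Fin.last D) ≠ 2 * R) :
    ‖stereo R v‖ ^ 2 * (2 * R - v (Fin.last D)) = 4 * R ^ 2 * v (Fin.last D) := by
  have h1 : 2 * R - v (Fin.last D) ≠ 0 := sub_ne_zero.2 (Ne.symm h)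
  have h2 := norm_sq_stereo hR hv
  apply mul_right_cancel₀ h1
  linarith

/-- On the sphere `|𝔰(v)|² (2R - y) = 4R² y`, which turns a bound on the support of `f` into a bound
on the height `y`. -/
theorem last_le_of_pull_ne_zero (hR : 0 < R) {f : Space D → ℝ} {B : ℝ}
    (hf : ∀ x, f x ≠ 0 → ‖x‖ ≤ B)
    {v : Ambient D} (hv : v ∈ Metric.sphere (center D R) R) (h : pull R f v ≠ 0) :
    v (Fin.last D) * (4 * R ^ 2 + B ^ 2) ≤ 2 * R * B ^ 2 := by
  rw [pull] at h
  split_ifs at h with h1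
  · exact absurd rfl h
  · have h2 := norm_sq_stereo_mul hR hv h1
    have h3 : ‖stereo R v‖ ^ 2 ≤ B ^ 2 := by
      gcongr
      exact hf _ h
    have h4 := mul_le_mul_of_nonneg_right h3 (sub_nonneg.2 (last_le hR hv))
    linarith

theorem norm_le_of_pull_ne_zero (hR : 0 < R) {f : Space D → ℝ} {B : ℝ} (hB : 0 ≤ B)
    (hf : ∀ x, f x ≠ 0 → ‖x‖ ≤ B)
    {v : Ambient D} (hv : v ∈ Metric.sphere (center D R) R) (h : pull R f v ≠ 0) : ‖v‖ ≤ B := by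
  have h1 := last_le_of_pull_ne_zero hR hf hv h
  refine (sq_le_sq₀ (norm_nonneg _) hB).1 ?_
  rw [norm_sq_of_mem_sphere hR hv]
  have h2 := last_nonneg hR hv
  have h3 : v (Fin.last D) * (4 * R ^ 2) ≤ 2 * R * B ^ 2 := by nlinarith [sq_nonneg B]
  have h4 : 2 * R * (2 * R * v (Fin.last D)) ≤ 2 * R * B ^ 2 := by linarith
  exact le_of_mul_le_mul_left h4 (by positivity)

/-- An extension to the ambient space of the pull-back of `f` to the sphere of radius
`1 / (2 * ε)`, smooth in `ε` up to `ε = 0`. -/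
def pullExt (a : ℝ) (f : Space D → ℝ) (ε : ℝ) (v : Ambient D) : ℝ :=
  Real.smoothTransition ((1 + a - 2 * (ε * v (Fin.last D))) / (1 - a)) *
    f ((1 - ε * v (Fin.last D))⁻¹ • horiz v)

theorem pullExt_eq_zero {a : ℝ} (ha : a < 1) (f : Space D → ℝ) {ε : ℝ} {v : Ambient D}
    (h : (1 + a) / 2 ≤ ε * v (Fin.last D)) : pullExt a f ε v = 0 := by
  rw [pullExt, Real.smoothTransition.zero_of_nonpos, zero_mul]
  exact div_nonpos_of_nonpos_of_nonneg (by linarith) (by linarith)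

theorem pullExt_eq {a : ℝ} (ha : a < 1) (f : Space D → ℝ) {ε : ℝ} {v : Ambient D}
    (h : ε * v (Fin.last D) ≤ a) :
    pullExt a f ε v = f ((1 - ε * v (Fin.last D))⁻¹ • horiz v) := by
  rw [pullExt, Real.smoothTransition.one_of_one_le, one_mul]
  rw [le_div_iff₀ (by linarith)]
  linarith

/-- The only singularity, `1 - ε y = 0`, lies in the region `ε y > (1 + a) / 2`, where the cutoff
vanishes identically. -/
theorem jointSmooth_pullExt {a : ℝ} (ha : a < 1) {f : Space D → ℝ} (hf : ContDiff ℝ ∞ f) :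
    JointSmooth (pullExt a f) := by
  have h1 : ContDiff ℝ ∞ fun p : ℝ × Ambient D => p.1 * p.2 (Fin.last D) := by fun_prop
  refine contDiff_iff_contDiffAt.2 fun p => ?_
  by_cases hp : p.1 * p.2 (Fin.last D) < 1
  · refine ContDiffAt.mul ?_ ?_
    · refine (Real.smoothTransition.contDiff.comp ?_).contDiffAt
      exact (contDiff_const.sub (contDiff_const.mul h1)).div_const _
    · have h2 : ContDiffAt ℝ ∞ (fun p : ℝ × Ambient D => (1 - p.1 * p.2 (Fin.last D))⁻¹) p :=
        ContDiffAt.inv (contDiff_const.sub h1).contDiffAt (sub_pos.2 hp).ne'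
      exact hf.contDiffAt.comp p (h2.smul (contDiff_horiz.comp contDiff_snd).contDiffAt)
  · have h2 : ∀ᶠ q : ℝ × Ambient D in 𝓝 p, (1 + a) / 2 < q.1 * q.2 (Fin.last D) :=
      h1.continuous.continuousAt.eventually (lt_mem_nhds (by linarith))
    refine (contDiffAt_const (c := (0 : ℝ))).congr_of_eventuallyEq ?_
    filter_upwards [h2] with q hq
    exact pullExt_eq_zero ha f hq.le

theorem pull_eq_pullExt (hR : 0 < R) {f : Space D → ℝ} {B : ℝ}
    (hf : ∀ x, f x ≠ 0 → ‖x‖ ≤ B) {a : ℝ} (ha : a < 1) (hBa : B ^ 2 ≤ a * (4 * R ^ 2 + B ^ 2))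
    {v : Ambient D} (hv : v ∈ Metric.sphere (center D R) R) :
    pull R f v = pullExt a f (1 / (2 * R)) v := by
  by_cases h : v (Fin.last D) = 2 * R
  · rw [pull, if_pos h, pullExt_eq_zero ha]
    rw [h]
    field_simp
    linarith
  · have h2 : pull R f v = f ((1 - 1 / (2 * R) * v (Fin.last D))⁻¹ • horiz v) := by
      rw [pull, if_neg h, stereo_eq hR h]
    by_cases h3 : pull R f v = 0
    · rw [pullExt, ← h2, h3, mul_zero]
    · rw [pullExt_eq ha, h2]
      have h4 := last_le_of_pull_ne_zero hR hf hv h3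
      have h5 : v (Fin.last D) * (4 * R ^ 2 + B ^ 2) ≤ (2 * R * a) * (4 * R ^ 2 + B ^ 2) := by
        nlinarith
      have h6 := le_of_mul_le_mul_right h5 (by positivity)
      rw [one_div, inv_mul_le_iff₀ (by positivity)]
      exact h6

/-- An extension for a fixed `R`. The last clause says that the extension is nonzero only where `f`
is nonzero at a positive multiple of the horizontal part, so a support in a half-space through the
origin is inherited. -/
theorem exists_pull_ext (hR : 0 < R) {f : Space D → ℝ} (hf : ContDiff ℝ ∞ f) {B B' : ℝ}
    (hB : 0 < B) (hBB' : B < B') (hfB : ∀ x, f x ≠ 0 → ‖x‖ ≤ B) :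
    ∃ U : Ambient D → ℝ, ContDiff ℝ ∞ U ∧
      (∀ v ∈ Metric.sphere (center D R) R, pull R f v = U v) ∧
      (∀ v, U v ≠ 0 → ‖v‖ ≤ B') ∧ ∀ v, U v ≠ 0 → ∃ c : ℝ, 0 < c ∧ f (c • horiz v) ≠ 0 := by
  set a := B ^ 2 / (4 * R ^ 2 + B ^ 2) with ha_def
  have ha : a < 1 := by
    rw [ha_def, div_lt_one (by positivity)]
    have : 0 < R ^ 2 := by positivity
    linarith
  let χ : ContDiffBump (0 : Ambient D) := ⟨B, B', hB, hBB'⟩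
  refine ⟨fun v => χ v * pullExt a f (1 / (2 * R)) v,
    χ.contDiff.mul ((jointSmooth_pullExt ha hf).slice _), fun v hv => ?_, fun v h => ?_,
    fun v h => ?_⟩
  · have h1 := pull_eq_pullExt hR hfB ha (by rw [ha_def]; field_simp; rfl) hv
    beta_reduce
    rw [← h1]
    by_cases h2 : pull R f v = 0
    · simp [h2]
    · rw [ χ.one_of_mem_closedBall, one_mul]
      simpa using norm_le_of_pull_ne_zero hR hB.le hfB hv h2
  · by_contra! h'
    exact left_ne_zero_of_mul h (by rw [χ.zero_of_le_dist (by simpa using h'.le)])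
  · have h1 := right_ne_zero_of_mul h
    refine ⟨(1 - 1 / (2 * R) * v (Fin.last D))⁻¹, ?_, right_ne_zero_of_mul h1⟩
    by_contra! h2
    rw [inv_nonpos] at h2
    exact h1 (pullExt_eq_zero ha f (by linarith))

end

section

variable {R Λ : ℝ} {h : Space D → ℝ}

/-! ### The mollifier -/

theorem eq_of_norm_eq_of_radial (hr : ∀ (O : Space D ≃ₗᵢ[ℝ] Space D) (x : Space D), h (O x) = h x)
    {x y : Space D} (hxy : ‖x‖ = ‖y‖) : h x = h y := by
  rw [← Submodule.reflection_sub hxy, hr]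

/-- The reflection taking `θ` to the origin. -/
def toOrigin (θ : Ambient D) : Ambient D ≃ₗᵢ[ℝ] Ambient D :=
  Submodule.reflection (Submodule.span ℝ {θ})ᗮ

theorem mollifierAt_eq (R Λ : ℝ) (h : Space D → ℝ) (θ v : Ambient D) :
    mollifierAt R Λ h θ v = mollifier R Λ h (sphereIso R (toOrigin θ) v) := rfl

theorem toOrigin_sub_center (hR : 0 < R) {θ : Ambient D}
    (hθ : θ ∈ Metric.sphere (center D R) R) :
    toOrigin θ (θ - center D R) = - center D R := by
  have h1 : ‖θ - center D R‖ = ‖-center D R‖ := by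
    rw [mem_sphere_iff_norm.1 hθ, norm_neg, center]
    simp [abs_of_pos hR]
  have h2 := Submodule.reflection_sub h1
  rwa [sub_neg_eq_add, sub_add_cancel] at h2

theorem sphereIso_toOrigin (hR : 0 < R) {θ : Ambient D}
    (hθ : θ ∈ Metric.sphere (center D R) R) : sphereIso R (toOrigin θ) θ = 0 := by
  rw [sphereIso, toOrigin_sub_center hR hθ, add_neg_cancel]

theorem norm_sphereIso_toOrigin (hR : 0 < R) {θ : Ambient D}
    (hθ : θ ∈ Metric.sphere (center D R) R) (v : Ambient D) :
    ‖sphereIso R (toOrigin θ) v‖ = ‖v - θ‖ := by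
  have h1 : sphereIso R (toOrigin θ) v = toOrigin θ (v - θ) := by
    have h2 := sphereIso_toOrigin hR hθ
    rw [sphereIso] at h2
    have h3 : v - center D R = (v - θ) + (θ - center D R) := by abel
    rw [sphereIso, h3, map_add, add_left_comm, h2, add_zero]
  rw [h1, LinearIsometryEquiv.norm_map]

/-- The height after recentring depends only on the angle between `v` and `θ` seen from the centre.
A zonal function thus gives a kernel that is invariant under all isometries. -/
theorem sphereIso_toOrigin_last (hR : 0 < R) {θ v : Ambient D}
    (hθ : θ ∈ Metric.sphere (center D R) R) (hv : v ∈ Metric.sphere (center D R) R) :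
    sphereIso R (toOrigin θ) v (Fin.last D) =
      R - inner ℝ (v - center D R) (θ - center D R) / R := by
  have h1 := norm_sphereIso_toOrigin hR hθ v
  have h2 := norm_sq_of_mem_sphere hR (sphereIso_mem (toOrigin θ) hv)
  have h3 : v - θ = (v - center D R) - (θ - center D R) := by abel
  rw [h1, h3, norm_sub_sq_real, mem_sphere_iff_norm.1 hv, mem_sphere_iff_norm.1 hθ] at h2
  field_simp
  linarith

theorem pull_congr_of_last (hR : 0 < R)
    (hr : ∀ (O : Space D ≃ₗᵢ[ℝ] Space D) (x : Space D), h (O x) = h x) {v w : Ambient D}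
    (hv : v ∈ Metric.sphere (center D R) R) (hw : w ∈ Metric.sphere (center D R) R)
    (hvw : v (Fin.last D) = w (Fin.last D)) :
    pull R (fun x => h (Λ • x)) v = pull R (fun x => h (Λ • x)) w := by
  by_cases h1 : v (Fin.last D) = 2 * R
  · rw [pull, pull, if_pos h1, if_pos (hvw ▸ h1)]
  · rw [pull, pull, if_neg h1, if_neg (hvw ▸ h1)]
    refine eq_of_norm_eq_of_radial hr ?_
    rw [norm_smul, norm_smul]
    congr 1
    have h2 := norm_sq_stereo_mul hR hv h1
    have h3 := norm_sq_stereo_mul hR hw (hvw ▸ h1)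
    rw [hvw] at h2 h1
    have h4 : ‖stereo R v‖ ^ 2 = ‖stereo R w‖ ^ 2 :=
      mul_right_cancel₀ (sub_ne_zero.2 (Ne.symm h1)) (h2.trans h3.symm)
    exact (sq_eq_sq₀ (norm_nonneg _) (norm_nonneg _)).1 h4

theorem mollifier_congr_of_last (hR : 0 < R)
    (hr : ∀ (O : Space D ≃ₗᵢ[ℝ] Space D) (x : Space D), h (O x) = h x) {v w : Ambient D}
    (hv : v ∈ Metric.sphere (center D R) R) (hw : w ∈ Metric.sphere (center D R) R)
    (hvw : v (Fin.last D) = w (Fin.last D)) : mollifier R Λ h v = mollifier R Λ h w := by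
  rw [mollifier, mollifier, pull_congr_of_last hR hr hv hw hvw]

theorem mollifierAt_congr (hR : 0 < R)
    (hr : ∀ (O : Space D ≃ₗᵢ[ℝ] Space D) (x : Space D), h (O x) = h x) {θ v θ' v' : Ambient D}
    (hθ : θ ∈ Metric.sphere (center D R) R) (hv : v ∈ Metric.sphere (center D R) R)
    (hθ' : θ' ∈ Metric.sphere (center D R) R) (hv' : v' ∈ Metric.sphere (center D R) R)
    (h1 : inner ℝ (v - center D R) (θ - center D R) =
      inner ℝ (v' - center D R) (θ' - center D R)) :
    mollifierAt R Λ h θ v = mollifierAt R Λ h θ' v' := by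
  rw [mollifierAt_eq, mollifierAt_eq]
  refine mollifier_congr_of_last hR hr (sphereIso_mem _ hv) (sphereIso_mem _ hv') ?_
  rw [sphereIso_toOrigin_last hR hθ hv, sphereIso_toOrigin_last hR hθ' hv', h1]

theorem mollifierAt_sphereIso (hR : 0 < R)
    (hr : ∀ (O : Space D ≃ₗᵢ[ℝ] Space D) (x : Space D), h (O x) = h x)
    (A : Ambient D ≃ₗᵢ[ℝ] Ambient D) {θ v : Ambient D}
    (hθ : θ ∈ Metric.sphere (center D R) R) (hv : v ∈ Metric.sphere (center D R) R) :
    mollifierAt R Λ h (sphereIso R A θ) (sphereIso R A v) = mollifierAt R Λ h θ v := by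
  refine mollifierAt_congr hR hr (sphereIso_mem A hθ) (sphereIso_mem A hv) hθ hv ?_
  simp only [sphereIso, add_sub_cancel_left, LinearIsometryEquiv.inner_map_map]

/-- The radius of a ball that carries the function `h`. -/
theorem exists_radius (hs : HasCompactSupport h) : ∃ B : ℝ, 0 < B ∧ ∀ x, h x ≠ 0 → ‖x‖ ≤ B := by
  obtain ⟨B, hB⟩ := hs.isCompact.isBounded.exists_norm_le
  exact ⟨max B 1, by positivity, fun x hx =>
    (hB x (subset_tsupport h (Function.mem_support.2 hx))).trans (le_max_left _ _)⟩

/-- On the sphere the mollifier has range `B / Λ`; the factor 2 is room for the cutoff that extends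
it smoothly to the ambient space. -/
theorem exists_mollifierAt_ext (hR : 0 < R) (hΛ : 0 < Λ) (hh : ContDiff ℝ ∞ h) {B : ℝ}
    (hB : 0 < B) (hB' : ∀ x, h x ≠ 0 → ‖x‖ ≤ B) {θ : Ambient D}
    (hθ : θ ∈ Metric.sphere (center D R) R) :
    ∃ U : Ambient D → ℝ, ContDiff ℝ ∞ U ∧
      (∀ v ∈ Metric.sphere (center D R) R, mollifierAt R Λ h θ v = U v) ∧
      ∀ v, U v ≠ 0 → ‖v - θ‖ ≤ 2 * B / Λ := by
  have h1 : ContDiff ℝ ∞ fun x => h (Λ • x) := hh.comp (contDiff_const_smul Λ)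
  obtain ⟨U, hU, hUe, hUs, -⟩ := exists_pull_ext hR h1 (B := B / Λ) (B' := 2 * B / Λ)
    (by positivity) (by gcongr; linarith) fun x hx => by
      have := hB' _ hx
      rw [norm_smul, Real.norm_eq_abs, abs_of_pos hΛ] at this
      rwa [le_div_iff₀' hΛ]
  refine ⟨fun v => U (sphereIso R (toOrigin θ) v) /
    ∫ w, pull R (fun x => h (Λ • x)) w ∂(surface D R),
    (hU.comp (contDiff_sphereIso R _)).div_const _, fun v hv => ?_, fun v hv => ?_⟩
  · rw [mollifierAt_eq, mollifier, hUe _ (sphereIso_mem _ hv)]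
  · rw [← norm_sphereIso_toOrigin hR hθ]
    exact hUs _ (left_ne_zero_of_mul hv)

/-! ### Measurability of the smoothed field -/

theorem measurable_pull {f : Space D → ℝ} (hf : Measurable f) : Measurable (pull R f) := by
  have h1 : Measurable fun v : Ambient D => v (Fin.last D) := by fun_prop
  have h2 : Measurable (stereo R : Ambient D → Space D) := by
    refine (WithLp.measurable_toLp 2 _).comp (measurable_pi_lambda _ fun i => ?_)
    fun_prop
  exact Measurable.ite (measurableSet_eq_fun h1 measurable_const) measurable_const (hf.comp h2)

/-- A point of the sphere of a given height. -/
def pointAt (D : ℕ) [NeZero D] (R y : ℝ) : Ambient D :=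
  EuclideanSpace.single (lastIdx D).castSucc √(y * (2 * R - y)) +
    EuclideanSpace.single (Fin.last D) y

theorem pointAt_last [NeZero D] (R y : ℝ) : pointAt D R y (Fin.last D) = y := by
  simp [pointAt, (Fin.castSucc_ne_last _).symm]

theorem pointAt_mem [NeZero D] (hR : 0 < R) {y : ℝ} (h0 : 0 ≤ y) (h2 : y ≤ 2 * R) :
    pointAt D R y ∈ Metric.sphere (center D R) R := by
  rw [mem_sphere_iff hR, pointAt_last]
  have h1 : horiz (pointAt D R y) = EuclideanSpace.single (lastIdx D) √(y * (2 * R - y)) := by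
    ext i
    simp [horiz, pointAt, Fin.castSucc_ne_last]
  rw [h1, PiLp.norm_single, Real.norm_eq_abs, sq_abs, Real.sq_sqrt]
  exact mul_nonneg h0 (by linarith)

/-- The kernel is evaluated on one fixed meridian. This replaces the reflection, which depends on
`θ`, by an expression that is visibly measurable in `(θ, v)` jointly. -/
theorem mollifierAt_eq_pointAt [NeZero D] (hR : 0 < R)
    (hr : ∀ (O : Space D ≃ₗᵢ[ℝ] Space D) (x : Space D), h (O x) = h x) {θ v : Ambient D}
    (hθ : θ ∈ Metric.sphere (center D R) R) (hv : v ∈ Metric.sphere (center D R) R) :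
    mollifierAt R Λ h θ v = mollifier R Λ h
      (pointAt D R (R - inner ℝ (v - center D R) (θ - center D R) / R)) := by
  have h1 := sphereIso_toOrigin_last hR hθ hv
  have h2 := sphereIso_mem (toOrigin θ) hv
  rw [mollifierAt_eq]
  refine mollifier_congr_of_last hR hr h2 (pointAt_mem hR ?_ ?_) ?_
  · rw [← h1]; exact last_nonneg hR h2
  · rw [← h1]; exact last_le hR h2
  · rw [h1, pointAt_last]

theorem measurable_mollifier (hh : Measurable h) : Measurable (mollifier R Λ h) :=
  (measurable_pull (hh.comp (measurable_const_smul Λ))).div_const _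

theorem exists_measurable_coeff_mollifierAt [NeZero D] (hR : 0 < R) (Y : HarmonicBasis D R)
    (hh : Measurable h) (hr : ∀ (O : Space D ≃ₗᵢ[ℝ] Space D) (x : Space D), h (O x) = h x)
    (i : Modes D R) : ∃ c : Ambient D → ℝ, Measurable c ∧
      ∀ θ ∈ Metric.sphere (center D R) R, coeff Y (mollifierAt R Λ h θ) i = c θ := by
  have h1 : Measurable (pointAt D R) := by
    refine (WithLp.measurable_toLp 2 _).comp (measurable_pi_lambda
      (fun y : ℝ => (pointAt D R y).ofLp) fun i => ?_)
    simp only [pointAt, PiLp.add_apply, PiLp.single_apply]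
    split_ifs <;> fun_prop
  refine ⟨fun θ => ∫ v, mollifier R Λ h
    (pointAt D R (R - inner ℝ (v - center D R) (θ - center D R) / R)) * harmFun hR Y i v
      ∂surface D R, ?_, fun θ hθ => ?_⟩
  · refine StronglyMeasurable.measurable (StronglyMeasurable.integral_prod_right
      (f := fun θ v => mollifier R Λ h
        (pointAt D R (R - inner ℝ (v - center D R) (θ - center D R) / R)) * harmFun hR Y i v) ?_)
    refine Measurable.stronglyMeasurable (Measurable.mul ?_ ?_)
    · refine (measurable_mollifier hh).comp (h1.comp ?_)
      fun_prop
    · exact (continuous_harmFun hR Y i).measurable.comp measurable_snd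
  · rw [coeff_eq hR]
    refine integral_congr_ae ((ae_mem_sphere hR).mono fun v hv => ?_)
    simp only [mollifierAt_eq_pointAt hR hr hθ hv]

theorem smoothed_laplacianPow (Y : HarmonicBasis D R) (Λ : ℝ) (h : Space D → ℝ) (j : ℕ)
    (φ : Field D R) (θ : Ambient D) : smoothed Y Λ h (laplacianPow j φ) θ =
      ∑' i, φ i * ((-eig D R i.1) ^ j * coeff Y (mollifierAt R Λ h θ) i) :=
  tsum_congr fun i => by
    rw [laplacianPow]
    ring

theorem exists_measurable_smoothed [NeZero D] (hR : 0 < R) (Y : HarmonicBasis D R)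
    (hh : Measurable h) (hr : ∀ (O : Space D ≃ₗᵢ[ℝ] Space D) (x : Space D), h (O x) = h x)
    (j : ℕ) : ∃ X : Field D R × Ambient D → ℝ, Measurable X ∧
      ∀ φ, ∀ θ ∈ Metric.sphere (center D R) R,
        smoothed Y Λ h (laplacianPow j φ) θ = X (φ, θ) := by
  choose c hc hce using exists_measurable_coeff_mollifierAt (Λ := Λ) hR Y hh hr
  refine ⟨fun p => ∑' i, p.1 i * ((-eig D R i.1) ^ j * c i p.2), Measurable.tsum fun i => ?_,
    fun φ θ hθ => ?_⟩
  · refine Measurable.mul ?_ (((hc i).comp measurable_snd).const_mul _)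
    exact (measurable_pi_apply i).comp measurable_fst
  · rw [smoothed_laplacianPow]
    exact tsum_congr fun i => by rw [hce i θ hθ]

theorem exists_measurable_lagrangian [NeZero D] (hR : 0 < R) (Y : HarmonicBasis D R)
    (hh : Measurable h) (hr : ∀ (O : Space D ≃ₗᵢ[ℝ] Space D) (x : Space D), h (O x) = h x)
    {N : ℕ} {𝓛 : (Fin (N + 1) → ℝ) → ℝ} (h𝓛 : Measurable 𝓛) :
    ∃ X : Field D R × Ambient D → ℝ, Measurable X ∧
      ∀ φ, ∀ θ ∈ Metric.sphere (center D R) R,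
        𝓛 (fun j => smoothed Y Λ h (laplacianPow (j : ℕ) φ) θ) = X (φ, θ) := by
  choose X hX hXe using exists_measurable_smoothed (Λ := Λ) hR Y hh hr
  refine ⟨fun p => 𝓛 fun j => X j p, h𝓛.comp (measurable_pi_lambda _ fun j => hX j),
    fun φ θ hθ => ?_⟩
  simp only [hXe _ φ θ hθ]

/-- The part of the action that comes from the region `s` of the sphere. -/
def actionOn (Y : HarmonicBasis D R) (Λ : ℝ) (h : Space D → ℝ) {N : ℕ}
    (𝓛 : (Fin (N + 1) → ℝ) → ℝ) (s : Set (Ambient D)) (φ : Field D R) : ℝ :=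
  ∫ θ in s, 𝓛 (fun j => smoothed Y Λ h (laplacianPow (j : ℕ) φ) θ) ∂(surface D R)

theorem action_eq_actionOn (Y : HarmonicBasis D R) (Λ : ℝ) (h : Space D → ℝ) {N : ℕ}
    (𝓛 : (Fin (N + 1) → ℝ) → ℝ) : action Y Λ h 𝓛 = actionOn Y Λ h 𝓛 Set.univ := by
  funext φ
  rw [action, actionOn, Measure.restrict_univ]

theorem measurable_actionOn [NeZero D] (hR : 0 < R) (Y : HarmonicBasis D R)
    (hh : Measurable h) (hr : ∀ (O : Space D ≃ₗᵢ[ℝ] Space D) (x : Space D), h (O x) = h x)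
    {N : ℕ} {𝓛 : (Fin (N + 1) → ℝ) → ℝ} (h𝓛 : Measurable 𝓛) (s : Set (Ambient D)) :
    Measurable (actionOn Y Λ h 𝓛 s) := by
  obtain ⟨X, hX, hXe⟩ := exists_measurable_lagrangian (Λ := Λ) hR Y hh hr h𝓛
  have h1 : actionOn Y Λ h 𝓛 s = fun φ => ∫ θ in s, X (φ, θ) ∂surface D R := by
    funext φ
    exact integral_congr_ae (ae_restrict_of_ae ((ae_mem_sphere hR).mono fun θ hθ => hXe φ θ hθ))
  rw [h1]
  exact (StronglyMeasurable.integral_prod_right' hX.stronglyMeasurable).measurable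

theorem integrable_lagrangian [NeZero D] (hR : 0 < R) (Y : HarmonicBasis D R)
    (hh : Measurable h) (hr : ∀ (O : Space D ≃ₗᵢ[ℝ] Space D) (x : Space D), h (O x) = h x)
    {N : ℕ} {𝓛 : (Fin (N + 1) → ℝ) → ℝ} (h𝓛 : Measurable 𝓛) {C : ℝ} (hC : ∀ x, |𝓛 x| ≤ C)
    (φ : Field D R) :
    Integrable (fun θ => 𝓛 (fun j => smoothed Y Λ h (laplacianPow (j : ℕ) φ) θ))
      (surface D R) := by
  obtain ⟨X, hX, hXe⟩ := exists_measurable_lagrangian (Λ := Λ) hR Y hh hr h𝓛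
  refine Integrable.of_bound (AEStronglyMeasurable.congr (f := fun θ => X (φ, θ))
    (hX.comp measurable_prodMk_left).aestronglyMeasurable
    ((ae_mem_sphere hR).mono fun θ hθ => (hXe φ θ hθ).symm)) C (Eventually.of_forall fun θ => hC _)

theorem abs_actionOn_le (Y : HarmonicBasis D R) {N : ℕ} {𝓛 : (Fin (N + 1) → ℝ) → ℝ} {C : ℝ}
    (hC : ∀ x, |𝓛 x| ≤ C) (s : Set (Ambient D)) (φ : Field D R) :
    |actionOn Y Λ h 𝓛 s φ| ≤ C * (surface D R).real s := by
  rw [actionOn, ← Real.norm_eq_abs]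
  exact (norm_setIntegral_le_of_norm_le_const (measure_lt_top _ s) fun θ _ => hC _)

end

section

variable {R Λ : ℝ} {h : Space D → ℝ} {N : ℕ} {𝓛 : (Fin (N + 1) → ℝ) → ℝ}

/-! ### The regularized measure -/

/-- The properties of the ultraviolet regulator that are used. -/
structure IsRegulator (h : Space D → ℝ) : Prop where
  smooth : ContDiff ℝ ∞ h
  hasCompactSupport : HasCompactSupport h
  radial : ∀ (O : Space D ≃ₗᵢ[ℝ] Space D) (x : Space D), h (O x) = h x

theorem IsRegulator.measurable (hh : IsRegulator h) : Measurable h :=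
  hh.smooth.continuous.measurable

theorem pair_congr (hR : 0 < R) (Y : HarmonicBasis D R) (φ : Field D R) {u w : Ambient D → ℝ}
    (huw : ∀ v ∈ Metric.sphere (center D R) R, u v = w v) : pair Y φ u = pair Y φ w := by
  rw [pair, pair, coeff_congr hR Y huw]

theorem smoothed_laplacianPow_eq_pair [NeZero D] (hR : 0 < R) (Y : HarmonicBasis D R) (j : ℕ)
    (φ : Field D R) {θ : Ambient D} {U : Ambient D → ℝ} (hU : ContDiff ℝ ∞ U)
    (hUe : ∀ v ∈ Metric.sphere (center D R) R, mollifierAt R Λ h θ v = U v) :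
    smoothed Y Λ h (laplacianPow j φ) θ = pair Y φ ((lap (1 / (2 * R)))^[j] U) := by
  rw [smoothed_laplacianPow, pair, coeff_congr hR Y hUe]
  exact tsum_congr fun i => by rw [coeff_lap_iterate hR Y hU]

/-- The recentred mollifier is invariant when both points are moved by the isometry, and powers of
the Laplacian are constant on each block of the matrix of the isometry. -/
theorem smoothed_rotField [NeZero D] (hR : 0 < R) (hΛ : 0 < Λ) (hh : IsRegulator h)
    (Y : HarmonicBasis D R) (A : Ambient D ≃ₗᵢ[ℝ] Ambient D) (j : ℕ) {φ : Field D R}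
    (hφ : IsTempered φ) {θ : Ambient D} (hθ : θ ∈ Metric.sphere (center D R) R) :
    smoothed Y Λ h (laplacianPow j (rotField hR Y A φ)) (sphereIso R A θ) =
      smoothed Y Λ h (laplacianPow j φ) θ := by
  obtain ⟨B, hB, hB'⟩ := exists_radius hh.hasCompactSupport
  obtain ⟨U, hU, hUe, -⟩ := exists_mollifierAt_ext hR hΛ hh.smooth hB hB' (sphereIso_mem A hθ)
  rw [smoothed_laplacianPow_eq_pair hR Y j _ hU hUe,
    pair_rotField hR Y A hφ (contDiff_lap_iterate hU _ j), smoothed_laplacianPow, pair]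
  refine tsum_congr fun i => ?_
  congr 1
  rw [coeff_comp_sphereIso hR Y A (contDiff_lap_iterate hU _ j).continuous,
    coeff_congr hR Y (u := mollifierAt R Λ h θ) (w := fun v => U (sphereIso R A v))
    (fun v hv => by
      rw [← hUe _ (sphereIso_mem A hv), mollifierAt_sphereIso hR hh.radial A hθ hv]),
    coeff_comp_sphereIso hR Y A hU.continuous, Finset.mul_sum]
  refine Finset.sum_congr rfl fun m _ => ?_
  rw [coeff_lap_iterate hR Y hU, mul_assoc]

theorem actionOn_rotField [NeZero D] (hR : 0 < R) (hΛ : 0 < Λ) (hh : IsRegulator h)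
    (Y : HarmonicBasis D R) (A : Ambient D ≃ₗᵢ[ℝ] Ambient D) {φ : Field D R}
    (hφ : IsTempered φ) {s : Set (Ambient D)} (hs : MeasurableSet s) :
    actionOn Y Λ h 𝓛 s (rotField hR Y A φ) = actionOn Y Λ h 𝓛 (sphereIso R A ⁻¹' s) φ := by
  have hm : MeasurableSet (sphereIso R A ⁻¹' s) := (continuous_sphereIso R A).measurable hs
  rw [actionOn, actionOn, ← integral_indicator hs, ← integral_comp_sphereIso R A,
    ← integral_indicator hm]
  refine integral_congr_ae ((ae_mem_sphere hR).mono fun θ hθ => ?_)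
  beta_reduce
  by_cases h1 : sphereIso R A θ ∈ s
  · rw [Set.indicator_of_mem h1, Set.indicator_of_mem (Set.mem_preimage.2 h1)]
    simp only [smoothed_rotField hR hΛ hh Y A _ hφ hθ]
  · rw [Set.indicator_of_notMem h1, Set.indicator_of_notMem]
    exact fun h2 => h1 h2

theorem action_rotField [NeZero D] (hR : 0 < R) (hΛ : 0 < Λ) (hh : IsRegulator h)
    (Y : HarmonicBasis D R) (A : Ambient D ≃ₗᵢ[ℝ] Ambient D) {φ : Field D R}
    (hφ : IsTempered φ) : action Y Λ h 𝓛 (rotField hR Y A φ) = action Y Λ h 𝓛 φ := by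
  rw [action_eq_actionOn, actionOn_rotField hR hΛ hh Y A hφ MeasurableSet.univ, Set.preimage_univ]

/-- The properties of the Lagrangian that are used. -/
structure IsLagrangian (𝓛 : (Fin (N + 1) → ℝ) → ℝ) : Prop where
  measurable : Measurable 𝓛
  exists_bound : ∃ C : ℝ, ∀ x, |𝓛 x| ≤ C

theorem measurable_action [NeZero D] (hR : 0 < R) (hh : IsRegulator h) (h𝓛 : IsLagrangian 𝓛)
    (Y : HarmonicBasis D R) : Measurable (action Y Λ h 𝓛) := by
  rw [action_eq_actionOn]
  exact measurable_actionOn hR Y hh.measurable hh.radial h𝓛.measurable _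

/-- The regularized interacting measure. -/
def gibbs (Y : HarmonicBasis D R) (Λ : ℝ) (h : Space D → ℝ) (𝓛 : (Fin (N + 1) → ℝ) → ℝ) :
    Measure (Field D R) := (freeMeasure D R).tilted fun φ => -action Y Λ h 𝓛 φ

theorem integrable_exp_action [NeZero D] (hR : 0 < R) (hh : IsRegulator h)
    (h𝓛 : IsLagrangian 𝓛) (Y : HarmonicBasis D R) :
    Integrable (fun φ => Real.exp (-action Y Λ h 𝓛 φ)) (freeMeasure D R) := by
  obtain ⟨C, hC⟩ := h𝓛.exists_bound
  refine Integrable.of_bound (measurable_action hR hh h𝓛 Y).neg.exp.aestronglyMeasurable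
    (Real.exp (C * (surface D R).real Set.univ)) (Eventually.of_forall fun φ => ?_)
  rw [Real.norm_eq_abs, Real.abs_exp, Real.exp_le_exp, action_eq_actionOn]
  exact (neg_le_abs _).trans (abs_actionOn_le Y hC _ φ)

theorem isProbabilityMeasure_gibbs [NeZero D] (hR : 0 < R) (hh : IsRegulator h)
    (h𝓛 : IsLagrangian 𝓛) (Y : HarmonicBasis D R) : IsProbabilityMeasure (gibbs Y Λ h 𝓛) :=
  isProbabilityMeasure_tilted (integrable_exp_action hR hh h𝓛 Y)

theorem gibbs_absolutelyContinuous (Y : HarmonicBasis D R) :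
    gibbs Y Λ h 𝓛 ≪ freeMeasure D R := tilted_absolutelyContinuous _ _

theorem expect_eq_integral (Y : HarmonicBasis D R) (G : Field D R → ℝ) :
    expect Y Λ h 𝓛 G = ∫ φ, G φ ∂gibbs Y Λ h 𝓛 := by
  rw [gibbs, integral_tilted, expect, ← integral_div]
  exact integral_congr_ae (Eventually.of_forall fun φ => by
    simp only [smul_eq_mul]
    ring)

theorem expect_comp_rotField [NeZero D] (hR : 0 < R) (hΛ : 0 < Λ) (hh : IsRegulator h)
    (h𝓛 : IsLagrangian 𝓛) (Y : HarmonicBasis D R) (A : Ambient D ≃ₗᵢ[ℝ] Ambient D)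
    {G : Field D R → ℝ} (hG : Measurable G) :
    expect Y Λ h 𝓛 (fun φ => G (rotField hR Y A φ)) = expect Y Λ h 𝓛 G := by
  rw [expect, expect]
  congr 1
  have h1 := integral_map (μ := freeMeasure D R) (measurable_rotField hR Y A).aemeasurable
    (f := fun φ => G φ * Real.exp (-action Y Λ h 𝓛 φ))
    (hG.mul (measurable_action hR hh h𝓛 Y).neg.exp).aestronglyMeasurable
  rw [map_rotField] at h1
  rw [h1]
  exact integral_congr_ae ((ae_isTempered hR).mono fun φ hφ => by
    simp only [action_rotField hR hΛ hh Y A hφ])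

end

section

variable {R : ℝ}

/-! ### Positivity of the reflected covariance -/

/-- The reflection of the ambient space in a horizontal coordinate. -/
def flip (j : Fin D) : Ambient D ≃ₗᵢ[ℝ] Ambient D :=
  Submodule.reflection (ℝ ∙ (EuclideanSpace.single j.castSucc (1 : ℝ) : Ambient D))ᗮ

theorem sphereIso_flip (R : ℝ) (j : Fin D) (v : Ambient D) : sphereIso R (flip j) v =
    v - (2 * v j.castSucc) • (EuclideanSpace.single j.castSucc (1 : ℝ) : Ambient D) := by
  rw [flip, sphereIso_reflection]
  simp [center, EuclideanSpace.inner_single_left, Fin.castSucc_ne_last]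

theorem sphereIso_flip_same (R : ℝ) (j : Fin D) (v : Ambient D) :
    sphereIso R (flip j) v j.castSucc = - v j.castSucc := by
  rw [sphereIso_flip]
  simp
  ring

theorem sphereIso_flip_flip (R : ℝ) (j : Fin D) (v : Ambient D) :
    sphereIso R (flip j) (sphereIso R (flip j) v) = v :=
  sphereIso_symm_apply R (flip j) v

theorem sphereIso_flip_eq_self (R : ℝ) (j : Fin D) {v : Ambient D} (hv : v j.castSucc = 0) :
    sphereIso R (flip j) v = v := by
  rw [sphereIso_flip, hv]
  simp

/-- A smooth soft threshold function. -/
theorem exists_softThreshold : ∃ ψ : ℝ → ℝ, ContDiff ℝ ∞ ψ ∧ (∀ t, |t| ≤ 1 → ψ t = 0) ∧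
    (∀ t, |deriv ψ t| ≤ 1) ∧ ∃ C, ∀ t, |ψ t - t| ≤ C := by
  -- The prescribed derivative: zero for `|s| ≤ 1`, one for `s² ≥ 2`, and between zero and one
  -- otherwise. Since `χ - 1` has compact support, the primitive of `χ` stays at bounded distance
  -- from the identity.
  let χ : ℝ → ℝ := fun s => Real.smoothTransition (s ^ 2 - 1)
  have hχ : ContDiff ℝ ∞ χ := Real.smoothTransition.contDiff.comp (by fun_prop)
  have hχc : Continuous χ := hχ.continuous
  have hd : ∀ t, HasDerivAt (fun t => ∫ s in (0 : ℝ)..t, χ s) (χ t) t := fun t =>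
    intervalIntegral.integral_hasDerivAt_right (hχc.intervalIntegrable _ _)
      hχc.stronglyMeasurable.stronglyMeasurableAtFilter hχc.continuousAt
  have hd' : deriv (fun t => ∫ s in (0 : ℝ)..t, χ s) = χ := funext fun t => (hd t).deriv
  refine ⟨fun t => ∫ s in (0 : ℝ)..t, χ s, ?_, fun t ht => ?_, fun t => ?_, ?_⟩
  · rw [contDiff_infty_iff_deriv, hd']
    exact ⟨fun t => (hd t).differentiableAt, hχ⟩
  · refine intervalIntegral.integral_zero_ae (Eventually.of_forall fun s hs => ?_)
    refine Real.smoothTransition.zero_of_nonpos ?_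
    have h1 : |s| ≤ 1 := by
      rcases Set.mem_uIoc.1 hs with h | h <;> rw [abs_le] at ht ⊢ <;> constructor <;> linarith
    have := abs_le.1 h1
    nlinarith
  · rw [hd', abs_of_nonneg (Real.smoothTransition.nonneg _)]
    exact Real.smoothTransition.le_one _
  · have hs : HasCompactSupport fun s => χ s - 1 := by
      refine HasCompactSupport.intro (isCompact_Icc (a := -2) (b := 2)) fun s hs => ?_
      have h1 : 1 ≤ s ^ 2 - 1 := by
        rw [Set.mem_Icc, not_and_or, not_le, not_le] at hs
        rcases hs with h | h <;> nlinarith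
      simp only [χ, Real.smoothTransition.one_of_one_le h1, sub_self]
    have hi : Integrable fun s => χ s - 1 := (hχc.sub continuous_const).integrable_of_hasCompactSupport hs
    refine ⟨∫ s, ‖χ s - 1‖, fun t => ?_⟩
    have h1 : (∫ s in (0 : ℝ)..t, χ s) - t = ∫ s in (0 : ℝ)..t, (χ s - 1) := by
      rw [intervalIntegral.integral_sub (hχc.intervalIntegrable _ _) (by simp)]
      simp
    rw [h1, ← Real.norm_eq_abs]
    refine (intervalIntegral.norm_integral_le_integral_norm_uIoc).trans ?_
    exact setIntegral_le_integral hi.norm (Eventually.of_forall fun s => norm_nonneg _)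

theorem integrable_mul_of_continuous (hR : 0 < R) {U V : Ambient D → ℝ} (hU : Continuous U)
    (hV : Continuous V) : Integrable (fun v => U v * V v) (surface D R) :=
  integrable_of_continuous hR (hU.mul hV)

/-- The square of the `H^1` norm. -/
def sobolevSq (R : ℝ) (U : Ambient D → ℝ) : ℝ :=
  (∫ v, U v * U v ∂surface D R) +
    (∑ a, ∑ b, ∫ v, rotD (1 / (2 * R)) a b U v * rotD (1 / (2 * R)) a b U v ∂surface D R) / 2

/-- By Green's formula the `H¹` norm squared is the pairing of `U` with `(1 - ∇²) U`, to which
Parseval applies. -/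
theorem hasSum_sobolevSq [NeZero D] (hR : 0 < R) (Y : HarmonicBasis D R) {U : Ambient D → ℝ}
    (hU : ContDiff ℝ ∞ U) :
    HasSum (fun i => (eig D R i.1 + 1) * coeff Y U i ^ 2) (sobolevSq R U) := by
  have h1 := hasSum_coeff_mul_coeff hR Y hU.continuous
    (contDiff_oneSubLap hU (1 / (2 * R))).continuous
  have h2 : ∫ v, U v * oneSubLap (1 / (2 * R)) U v ∂surface D R = sobolevSq R U := by
    simp only [oneSubLap, mul_sub]
    rw [integral_sub (integrable_mul_of_continuous hR hU.continuous hU.continuous)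
      (integrable_mul_of_continuous hR hU.continuous (contDiff_lap hU _).continuous),
      integral_mul_lap hR hU hU, sub_neg_eq_add, sobolevSq]
  rw [h2] at h1
  refine h1.congr_fun fun i => ?_
  have h3 := coeff_oneSubLap_iterate hR Y hU 1 i
  rw [Function.iterate_one, pow_one] at h3
  rw [h3]
  ring

theorem sobolevSq_mono (hR : 0 < R) {U V : Ambient D → ℝ} (hU : ContDiff ℝ ∞ U)
    (hV : ContDiff ℝ ∞ V) (h0 : ∀ v, |V v| ≤ |U v|)
    (h1 : ∀ a b v, |rotD (1 / (2 * R)) a b V v| ≤ |rotD (1 / (2 * R)) a b U v|) :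
    sobolevSq R V ≤ sobolevSq R U := by
  have h2 : ∀ {f g : Ambient D → ℝ}, Continuous f → Continuous g → (∀ v, |f v| ≤ |g v|) →
      ∫ v, f v * f v ∂surface D R ≤ ∫ v, g v * g v ∂surface D R := by
    intro f g hf hg hfg
    refine integral_mono (integrable_of_continuous hR (hf.mul hf))
      (integrable_of_continuous hR (hg.mul hg)) fun v => ?_
    exact abs_le_iff_mul_self_le.1 (hfg v)
  refine add_le_add (h2 hV.continuous hU.continuous h0) (div_le_div_of_nonneg_right
    (Finset.sum_le_sum fun a _ => Finset.sum_le_sum fun b _ => ?_) zero_le_two)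
  exact h2 (contDiff_rotD hV _ a b).continuous (contDiff_rotD hU _ a b).continuous (h1 a b)

/-- Completing the square in each mode. This is one half of the duality that writes the covariance
as a supremum of `2 ∫ U V - ‖V‖²` over `V`. -/
theorem two_mul_integral_sub_sobolevSq_le [NeZero D] (hR : 0 < R) (Y : HarmonicBasis D R)
    {U V : Ambient D → ℝ} (hU : ContDiff ℝ ∞ U) (hV : ContDiff ℝ ∞ V) :
    2 * ∫ v, U v * V v ∂surface D R ≤ freeCov (coeff Y U) (coeff Y U) + sobolevSq R V := by
  have h1 := (hasSum_coeff_mul_coeff hR Y hU.continuous hV.continuous).mul_left 2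
  have hc := isRapid_coeff hR Y hU
  have h2 := (hc.summable_cov hc).hasSum.add (hasSum_sobolevSq hR Y hV)
  refine hasSum_le (fun i => ?_) h1 h2
  have h3 := eig_add_one_pos (D := D) R i.1
  have h4 : 0 ≤ (eig D R i.1 + 1)⁻¹ * (coeff Y U i - (eig D R i.1 + 1) * coeff Y V i) ^ 2 := by
    positivity
  have h5 : (eig D R i.1 + 1)⁻¹ * (coeff Y U i - (eig D R i.1 + 1) * coeff Y V i) ^ 2 =
      (eig D R i.1 + 1)⁻¹ * (coeff Y U i * coeff Y U i) - 2 * (coeff Y U i * coeff Y V i) +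
        (eig D R i.1 + 1) * coeff Y V i ^ 2 := by
    field_simp
    ring
  linarith

/-- Symmetrization of an antisymmetric function by soft thresholds. -/
theorem exists_symmetrization (hR : 0 < R) (j : Fin D) {w : Ambient D → ℝ}
    (hw : ContDiff ℝ ∞ w) (hw0 : ∀ v, v j.castSucc = 0 → w v = 0) :
    ∃ C, ∀ δ > 0, ∃ V : Ambient D → ℝ, ContDiff ℝ ∞ V ∧ sobolevSq R V ≤ sobolevSq R w ∧
      ∀ v, |V v - SignType.sign (v j.castSucc) * w v| ≤ C * δ := by
  obtain ⟨ψ, hψ, hψ0, hψ1, C, hC⟩ := exists_softThreshold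
  refine ⟨C, fun δ hδ => ?_⟩
  -- The rescaled threshold kills the values of `w` of size at most `δ`, moves the others by at most
  -- `C δ`, and increases neither `w` nor its derivatives in modulus.
  let p : Ambient D → ℝ := fun v => δ * ψ (w v / δ)
  have hp : ContDiff ℝ ∞ p := contDiff_const.mul (hψ.comp (hw.div_const _))
  have hψ2 : ∀ t, |ψ t| ≤ |t| := by
    intro t
    have h1 := Convex.norm_image_sub_le_of_norm_deriv_le (f := ψ) (C := 1) (s := Set.univ)
      (x := 0) (y := t) (fun x _ => hψ.differentiable (by simp) x) (fun x _ => hψ1 x)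
      convex_univ trivial trivial
    simpa [hψ0 0] using h1
  have hpw : ∀ v, |p v| ≤ |w v| := by
    intro v
    have := hψ2 (w v / δ)
    rw [abs_div, abs_of_pos hδ, le_div_iff₀ hδ] at this
    rw [abs_mul, abs_of_pos hδ, mul_comm]
    exact this
  have hrot : ∀ a b v, |rotD (1 / (2 * R)) a b p v| ≤ |rotD (1 / (2 * R)) a b w v| := by
    intro a b v
    have h1 : HasFDerivAt p (deriv ψ (w v / δ) • fderiv ℝ w v) v := by
      have h2 := ((hψ.differentiable (by simp) (w v / δ)).hasDerivAt.comp_hasFDerivAt v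
        (((hw.differentiable (by simp) v).hasFDerivAt.mul_const δ⁻¹))).const_mul δ
      have h3 : δ • deriv ψ (w v / δ) • δ⁻¹ • fderiv ℝ w v = deriv ψ (w v / δ) • fderiv ℝ w v := by
        rw [smul_comm, smul_smul δ, mul_inv_cancel₀ hδ.ne', one_smul]
      rw [h3] at h2
      exact h2
    rw [rotD, h1.fderiv, _root_.smul_apply, smul_eq_mul, abs_mul]
    exact mul_le_of_le_one_left (abs_nonneg _) (hψ1 _)
  -- Multiplication by the sign is harmless: `w` vanishes on the hyperplane, so `p` is identically
  -- zero near each of its points and `V` is smooth across it.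
  let V : Ambient D → ℝ := fun v => SignType.sign (v j.castSucc) * p v
  have hloc : ∀ v, V =ᶠ[𝓝 v] p ∨ V =ᶠ[𝓝 v] fun v => - p v := by
    intro v
    have hc : Continuous fun v : Ambient D => v j.castSucc := by fun_prop
    rcases lt_trichotomy (v j.castSucc) 0 with h | h | h
    · refine Or.inr ?_
      filter_upwards [hc.continuousAt.eventually (gt_mem_nhds h)] with u hu
      simp [V, sign_neg hu]
    · refine Or.inl ?_
      have h1 : ∀ᶠ u in 𝓝 v, |w u| < δ := by
        refine (hw.continuous.abs.continuousAt (x := v)).eventually (gt_mem_nhds ?_)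
        simp [hw0 v h, hδ]
      filter_upwards [h1] with u hu
      have h2 : p u = 0 := by
        simp only [p]
        rw [hψ0, mul_zero]
        rw [abs_div, abs_of_pos hδ, div_le_one hδ]
        exact hu.le
      simp [V, h2]
    · refine Or.inl ?_
      filter_upwards [hc.continuousAt.eventually (lt_mem_nhds h)] with u hu
      simp [V, sign_pos hu]
  have hV : ContDiff ℝ ∞ V := contDiff_iff_contDiffAt.2 fun v => by
    rcases hloc v with h | h
    · exact hp.contDiffAt.congr_of_eventuallyEq h
    · exact hp.neg.contDiffAt.congr_of_eventuallyEq h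
  refine ⟨V, hV, sobolevSq_mono hR hw hV (fun v => ?_) (fun a b v => ?_), fun v => ?_⟩
  · refine le_trans (le_of_eq ?_) (hpw v)
    rcases hloc v with h | h <;> rw [h.eq_of_nhds]
    rw [abs_neg]
  · refine le_trans (le_of_eq ?_) (hrot a b v)
    rw [rotD, rotD]
    rcases hloc v with h | h <;> rw [h.fderiv_eq]
    rw [fderiv_fun_neg, _root_.neg_apply, abs_neg]
  · have h1 : V v - SignType.sign (v j.castSucc) * w v =
        SignType.sign (v j.castSucc) * (δ * (ψ (w v / δ) - w v / δ)) := by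
      simp only [V, p]
      field_simp
    have h2 : |((SignType.sign (v j.castSucc) : SignType) : ℝ)| ≤ 1 := by
      rcases SignType.sign (v j.castSucc) with _ | _ | _ <;> simp
    rw [h1, abs_mul, abs_mul, abs_of_pos hδ, mul_comm C]
    exact (mul_le_of_le_one_left (by positivity) h2).trans
      (mul_le_mul_of_nonneg_left (hC _) hδ.le)

/-- The Dirichlet covariance is bounded by the Neumann covariance. -/
theorem two_mul_integral_le_of_antisymm [NeZero D] (hR : 0 < R) (Y : HarmonicBasis D R)
    (j : Fin D) {u e w : Ambient D → ℝ} (hu : ContDiff ℝ ∞ u) (he : ContDiff ℝ ∞ e)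
    (hue : ∀ v, e v * SignType.sign (v j.castSucc) = u v) (hw : ContDiff ℝ ∞ w)
    (hw0 : ∀ v, v j.castSucc = 0 → w v = 0) :
    2 * ∫ v, u v * w v ∂surface D R ≤ freeCov (coeff Y e) (coeff Y e) + sobolevSq R w := by
  obtain ⟨C, hC⟩ := exists_symmetrization hR j hw hw0
  have hei := integrable_of_continuous hR he.continuous.abs
  -- Since `u = e · sign`, the integral of `u w` is that of `e · (sign · w)`. Replacing `sign · w`
  -- by the smooth `V` costs a multiple of `δ`, and the duality inequality applies to `e` and `V`.
  have key : ∀ δ > 0, 2 * ∫ v, u v * w v ∂surface D R ≤ freeCov (coeff Y e) (coeff Y e) +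
      sobolevSq R w + δ * (2 * (C * ∫ v, |e v| ∂surface D R)) := by
    intro δ hδ
    obtain ⟨V, hV, hVs, hVe⟩ := hC δ hδ
    have h1 := two_mul_integral_sub_sobolevSq_le hR Y he hV
    have h2 : ∫ v, u v * w v ∂surface D R ≤
        ∫ v, (e v * V v + C * δ * |e v|) ∂surface D R := by
      refine integral_mono (integrable_of_continuous hR (hu.continuous.mul hw.continuous))
        ((integrable_of_continuous hR (he.continuous.mul hV.continuous)).add
          (hei.const_mul _)) fun v => ?_
      have h3 : u v * w v = e v * V v - e v * (V v - SignType.sign (v j.castSucc) * w v) := by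
        rw [← hue]; ring
      have h4 := neg_le_abs (e v * (V v - SignType.sign (v j.castSucc) * w v))
      rw [abs_mul] at h4
      have h5 := mul_le_mul_of_nonneg_left (hVe v) (abs_nonneg (e v))
      simp only
      linarith
    rw [integral_add (integrable_mul_of_continuous hR he.continuous hV.continuous)
      (hei.const_mul _), integral_const_mul] at h2
    linarith
  refine le_of_forall_pos_le_add fun η hη => ?_
  set K := 2 * (C * ∫ v, |e v| ∂surface D R)
  have h6 := key (η / (|K| + 1)) (by positivity)
  refine h6.trans (add_le_add_right ?_ _)
  rw [div_mul_eq_mul_div, div_le_iff₀ (by positivity)]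
  have := le_abs_self K
  nlinarith

theorem coeff_finsetSum (hR : 0 < R) (Y : HarmonicBasis D R) {J : Type*} (I : Finset J)
    {U : J → Ambient D → ℝ} (hU : ∀ j, Continuous (U j)) (t : J → ℝ) (i : Modes D R) :
    coeff Y (fun v => ∑ j ∈ I, t j * U j v) i = ∑ j ∈ I, t j * coeff Y (U j) i := by
  simp only [coeff_eq hR, Finset.sum_mul]
  rw [integral_finsetSum]
  · exact Finset.sum_congr rfl fun j _ => by simp only [mul_assoc, integral_const_mul]
  · exact fun j _ => integrable_mul_of_continuous hR (continuous_const.mul (hU j))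
      (continuous_harmFun hR Y i)

/-- The supremum in the duality is approached by truncations of `C u`, for which `2 ∫ u w - ‖w‖²` is
exactly a partial sum of the covariance of `u`. Each such value is bounded by the Dirichlet-Neumann
comparison. -/
theorem freeCov_self_le_of_antisymm [NeZero D] (hR : 0 < R) (Y : HarmonicBasis D R)
    (j : Fin D) {u e : Ambient D → ℝ} (hu : ContDiff ℝ ∞ u) (he : ContDiff ℝ ∞ e)
    (hue : ∀ v, e v * SignType.sign (v j.castSucc) = u v)
    (hu' : ∀ v, u (sphereIso R (flip j) v) = - u v) :
    freeCov (coeff Y u) (coeff Y u) ≤ freeCov (coeff Y e) (coeff Y e) := by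
  classical
  have hnn : ∀ i : Modes D R, 0 ≤ (eig D R i.1 + 1)⁻¹ * (coeff Y u i * coeff Y u i) := fun i =>
    mul_nonneg (inv_pos.2 (eig_add_one_pos R i.1)).le (mul_self_nonneg _)
  have hcu : ∀ i, coeff Y (fun v => u (sphereIso R (flip j) v)) i = - coeff Y u i := by
    intro i
    have := coeff_const_mul Y (-1) u i
    simp only [neg_one_mul] at this
    rw [← this]
    simp only [hu']
  refine Real.tsum_le_of_sum_le hnn fun I => ?_
  obtain ⟨M, hM⟩ : ∃ M : ℕ, ∀ i ∈ I, i.1 < M :=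
    ⟨I.sup (fun i => i.1 + 1), fun i hi => Finset.le_sup (f := fun i : Modes D R => i.1 + 1) hi⟩
  -- Enlarging the finite set to all modes of degree less than `M` makes the truncation commute with
  -- isometries.
  let I' : Finset (Modes D R) := (Finset.range M).sigma fun _ => Finset.univ
  have hI' : ∀ i : Modes D R, i ∈ I' ↔ i.1 < M := fun i => by simp [I']
  let w : Ambient D → ℝ := fun v =>
    ∑ i ∈ I', ((eig D R i.1 + 1)⁻¹ * coeff Y u i) * harmFun hR Y i v
  have hw : ContDiff ℝ ∞ w := ContDiff.sum fun i _ => contDiff_const.mul (contDiff_harmFun hR Y i)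
  have hcw : ∀ i, coeff Y w i = if i.1 < M then (eig D R i.1 + 1)⁻¹ * coeff Y u i else 0 := by
    intro i
    rw [coeff_finsetSum hR Y I' (continuous_harmFun hR Y)]
    simp [coeff_harmFun, hI']
  have hcw' : ∀ i, coeff Y (fun v => w (sphereIso R (flip j) v)) i = - coeff Y w i := by
    intro i
    rw [coeff_comp_sphereIso hR Y _ hw.continuous]
    have h1 := hcu i
    rw [coeff_comp_sphereIso hR Y _ hu.continuous] at h1
    simp only [hcw]
    split_ifs with h2
    · rw [← mul_neg, ← h1, Finset.mul_sum]
      exact Finset.sum_congr rfl fun m _ => mul_assoc _ _ _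
    · simp
  -- Antisymmetrization makes `w` vanish on the hyperplane pointwise. It does not change the
  -- coefficients, because those of `w` are already odd.
  let w' : Ambient D → ℝ := fun v => (1 / 2) * (w v - w (sphereIso R (flip j) v))
  have hws := hw.comp (contDiff_sphereIso R (flip j))
  have hw' : ContDiff ℝ ∞ w' := contDiff_const.mul (hw.sub hws)
  have hcw'' : ∀ i, coeff Y w' i = coeff Y w i := by
    intro i
    have h1 : coeff Y (fun v => w v - w (sphereIso R (flip j) v)) i = _ :=
      coeff_sub hR Y hw.continuous hws.continuous i
    have h2 : coeff Y (w ∘ sphereIso R (flip j)) i = _ := hcw' i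
    rw [coeff_const_mul, h1, h2]
    ring
  have h1 := two_mul_integral_le_of_antisymm hR Y j hu he hue hw' fun v hv => by
    simp only [w', sphereIso_flip_eq_self R j hv, sub_self, mul_zero]
  have h2 := ((hasSum_coeff_mul_coeff hR Y hu.continuous hw'.continuous).mul_left 2).sub
    (hasSum_sobolevSq hR Y hw')
  have h3 : HasSum (fun i => 2 * (coeff Y u i * coeff Y w' i) -
      (eig D R i.1 + 1) * coeff Y w' i ^ 2) (∑ i ∈ I', (2 * (coeff Y u i * coeff Y w' i) -
      (eig D R i.1 + 1) * coeff Y w' i ^ 2)) := by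
    refine hasSum_sum_of_ne_finset_zero fun i hi => ?_
    rw [hcw'', hcw, if_neg (fun h => hi ((hI' i).2 h))]
    ring
  have h4 : ∑ i ∈ I', (2 * (coeff Y u i * coeff Y w' i) -
      (eig D R i.1 + 1) * coeff Y w' i ^ 2) =
      ∑ i ∈ I', (eig D R i.1 + 1)⁻¹ * (coeff Y u i * coeff Y u i) := by
    refine Finset.sum_congr rfl fun i hi => ?_
    rw [hcw'', hcw, if_pos ((hI' i).1 hi)]
    have := eig_add_one_pos (D := D) R i.1
    field_simp
    ring
  have h5 := h2.unique h3
  rw [h4] at h5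
  have h6 := Finset.sum_le_sum_of_subset_of_nonneg (s := I) (t := I')
    (fun i hi => (hI' i).2 (hM i hi)) fun i _ _ => hnn i
  linarith

/-- Reflection positivity of the covariance of the free field. -/
theorem freeCov_reflection_nonneg [NeZero D] (hR : 0 < R) (Y : HarmonicBasis D R)
    (j : Fin D) {u : Ambient D → ℝ} (hu : ContDiff ℝ ∞ u) (hu0 : ∀ v, v j.castSucc ≤ 0 → u v = 0) :
    0 ≤ freeCov (coeff Y u) (coeff Y fun v => u (sphereIso R (flip j) v)) := by
  have hus := hu.comp (contDiff_sphereIso R (flip j))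
  -- Polarization: the covariance of the even part minus that of the odd part is four times the
  -- covariance of `u` with its reflection.
  have h1 := freeCov_self_le_of_antisymm hR Y j
    (u := fun v => u v - u (sphereIso R (flip j) v))
    (e := fun v => u v + u (sphereIso R (flip j) v)) (hu.sub hus) (hu.add hus) (fun v => ?_)
    (fun v => ?_)
  · have hc := isRapid_coeff hR Y hu
    have hcs := isRapid_coeff hR Y hus
    have e1 : ∀ i, coeff Y (fun v => u v - u (sphereIso R (flip j) v)) i =
      coeff Y u i - coeff Y (fun v => u (sphereIso R (flip j) v)) i :=
      coeff_sub hR Y hu.continuous hus.continuous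
    have e2 : ∀ i, coeff Y (fun v => u v + u (sphereIso R (flip j) v)) i =
      coeff Y u i + coeff Y (fun v => u (sphereIso R (flip j) v)) i :=
      coeff_add hR Y hu.continuous hus.continuous
    have h2 := isRapid_coeff hR Y (hu.sub hus)
    have h3 := isRapid_coeff hR Y (hu.add hus)
    have h4 := (h3.summable_cov h3).hasSum.sub (h2.summable_cov h2).hasSum
    have h5 := (hc.summable_cov hcs).hasSum.mul_left 4
    have h6 := h4.unique (h5.congr_fun fun i => by
      have e1' := e1 i
      have e2' := e2 i
      simp only [Function.comp_def]
      rw [e1', e2']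
      ring)
    unfold freeCov at h1 ⊢
    simp only [Function.comp_def] at h6
    linarith
  · rcases lt_trichotomy (v j.castSucc) 0 with h | h | h
    · simp [sign_neg h, hu0 v h.le]
    · simp [h, hu0 v h.le, hu0 (sphereIso R (flip j) v) (by rw [sphereIso_flip_same, h, neg_zero])]
    · rw [sign_pos h, hu0 (sphereIso R (flip j) v) (by rw [sphereIso_flip_same]; linarith)]
      simp
  · simp only [sphereIso_flip_flip, neg_sub]

end

section

variable {R : ℝ}

/-! ### Positivity for functionals of finitely many Gaussian variables -/

theorem freeCov_add_self [NeZero D] {c d : Modes D R → ℝ} (hc : IsRapid c) (hd : IsRapid d) :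
    freeCov (fun i => c i + d i) (fun i => c i + d i) =
      freeCov c c + 2 * freeCov c d + freeCov d d := by
  have h1 := (((hc.summable_cov hc).hasSum).add ((hc.summable_cov hd).hasSum.mul_left 2)).add
    (hd.summable_cov hd).hasSum
  rw [freeCov, ← (h1.congr_fun fun i => by ring :
    HasSum (fun i => (eig D R i.1 + 1)⁻¹ * ((c i + d i) * (c i + d i))) _).tsum_eq.symm]
  rfl

theorem freeCov_self_nonneg [NeZero D] (c : Modes D R → ℝ) : 0 ≤ freeCov c c :=
  tsum_nonneg fun i => mul_nonneg (inv_pos.2 (eig_add_one_pos R i.1)).le (mul_self_nonneg _)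

theorem freeCov_self_comp_sphereIso [NeZero D] (hR : 0 < R) (Y : HarmonicBasis D R)
    (A : Ambient D ≃ₗᵢ[ℝ] Ambient D) {U : Ambient D → ℝ} (hU : ContDiff ℝ ∞ U) :
    freeCov (coeff Y fun v => U (sphereIso R A v)) (coeff Y fun v => U (sphereIso R A v)) =
      freeCov (coeff Y U) (coeff Y U) := by
  have hc := isRapid_coeff hR Y hU
  have hc' : IsRapid (coeff Y fun v => U (sphereIso R A v)) :=
    isRapid_coeff hR Y (hU.comp (contDiff_sphereIso R A))
  have h1 := (hc.summable_cov hc).tsum_sigma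
  have h2 := (hc'.summable_cov hc').tsum_sigma
  refine h2.trans (Eq.trans ?_ h1.symm)
  refine tsum_congr fun l => ?_
  rw [tsum_fintype, tsum_fintype]
  simp only [← pow_two]
  refine (Finset.mul_sum _ _ _).symm.trans (Eq.trans ?_ (Finset.mul_sum _ _ _))
  exact congrArg _ (sum_coeff_sq_comp_sphereIso hR Y A hU.continuous l)

theorem freeCov_comp_sphereIso [NeZero D] (hR : 0 < R) (Y : HarmonicBasis D R)
    (A : Ambient D ≃ₗᵢ[ℝ] Ambient D) {U V : Ambient D → ℝ} (hU : ContDiff ℝ ∞ U)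
    (hV : ContDiff ℝ ∞ V) :
    freeCov (coeff Y fun v => U (sphereIso R A v)) (coeff Y fun v => V (sphereIso R A v)) =
      freeCov (coeff Y U) (coeff Y V) := by
  have hU' : ContDiff ℝ ∞ fun v => U (sphereIso R A v) := hU.comp (contDiff_sphereIso R A)
  have hV' : ContDiff ℝ ∞ fun v => V (sphereIso R A v) := hV.comp (contDiff_sphereIso R A)
  have h1 := freeCov_self_comp_sphereIso hR Y A hU
  have h2 := freeCov_self_comp_sphereIso hR Y A hV
  have h3 := freeCov_self_comp_sphereIso hR Y A (hU.add hV)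
  have e1 : coeff Y (fun v => U v + V v) = fun i => coeff Y U i + coeff Y V i :=
    funext fun i => coeff_add hR Y hU.continuous hV.continuous i
  have e2 : coeff Y (fun v => U (sphereIso R A v) + V (sphereIso R A v)) = fun i =>
      coeff Y (fun v => U (sphereIso R A v)) i + coeff Y (fun v => V (sphereIso R A v)) i :=
    funext fun i => coeff_add hR Y hU'.continuous hV'.continuous i
  rw [e1, e2, freeCov_add_self (isRapid_coeff hR Y hU) (isRapid_coeff hR Y hV),
    freeCov_add_self (isRapid_coeff hR Y hU') (isRapid_coeff hR Y hV'), h1, h2] at h3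
  linarith

section

variable {J : Type*}

/-- The sum of a common and of two conditionally independent summands. -/
def gaussianPair (p : EuclideanSpace ℝ J × EuclideanSpace ℝ J × EuclideanSpace ℝ J) :
    EuclideanSpace ℝ (J ⊕ J) :=
  WithLp.toLp 2 (Sum.elim (p.1 + p.2.1).ofLp (p.1 + p.2.2).ofLp)

theorem measurable_gaussianPair : Measurable (gaussianPair (J := J)) := by
  refine (WithLp.measurable_toLp 2 _).comp (measurable_pi_lambda _ fun k => ?_)
  rcases k with k | k
  · show Measurable fun p : EuclideanSpace ℝ J × EuclideanSpace ℝ J × EuclideanSpace ℝ J =>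
      p.1 k + p.2.1 k
    fun_prop
  · show Measurable fun p : EuclideanSpace ℝ J × EuclideanSpace ℝ J × EuclideanSpace ℝ J =>
      p.1 k + p.2.2 k
    fun_prop

variable [Fintype J]

theorem charFun_map_gaussianPair (P Q : Measure (EuclideanSpace ℝ J)) [IsProbabilityMeasure P]
    [IsProbabilityMeasure Q] (t : EuclideanSpace ℝ (J ⊕ J)) :
    charFun ((P.prod (Q.prod Q)).map gaussianPair) t =
      charFun P (WithLp.toLp 2 fun k => t (Sum.inl k) + t (Sum.inr k)) *
        (charFun Q (WithLp.toLp 2 fun k => t (Sum.inl k)) *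
          charFun Q (WithLp.toLp 2 fun k => t (Sum.inr k))) := by
  rw [charFun_apply, integral_map measurable_gaussianPair.aemeasurable
    (Continuous.aestronglyMeasurable (by fun_prop)), charFun_apply, charFun_apply, charFun_apply,
    ← integral_prod_mul, ← integral_prod_mul]
  refine integral_congr_ae (Eventually.of_forall fun p => ?_)
  simp only [← Complex.exp_add, gaussianPair, PiLp.inner_apply, Fintype.sum_sum_type]
  congr 1
  simp only [Sum.elim_inl, Sum.elim_inr, PiLp.add_apply, ← add_mul, ← Complex.ofReal_add,
    ← Finset.sum_add_distrib]
  congr 2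
  refine Finset.sum_congr rfl fun k _ => ?_
  simp
  ring

/-- Conditionally on the common summand the two arguments are independent with the same law, so the
inner integral is a square. -/
theorem integral_gaussianPair_nonneg (P Q : Measure (EuclideanSpace ℝ J)) [IsProbabilityMeasure P]
    [IsProbabilityMeasure Q] {g : (J → ℝ) → ℝ} (hg : Measurable g) {M : ℝ}
    (hM : ∀ x, |g x| ≤ M) :
    0 ≤ ∫ x, g (fun k => x (Sum.inl k)) * g (fun k => x (Sum.inr k))
      ∂((P.prod (Q.prod Q)).map gaussianPair) := by
  have hm1 : ∀ ι : J → J ⊕ J, Measurable fun (x : EuclideanSpace ℝ (J ⊕ J)) k => x (ι k) :=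
    fun ι => measurable_pi_lambda _ fun k => by fun_prop
  have hm : Measurable fun x : EuclideanSpace ℝ (J ⊕ J) =>
      g (fun k => x (Sum.inl k)) * g (fun k => x (Sum.inr k)) :=
    (hg.comp (hm1 _)).mul (hg.comp (hm1 _))
  rw [integral_map measurable_gaussianPair.aemeasurable hm.aestronglyMeasurable,
    integral_prod]
  · refine integral_nonneg fun z => ?_
    have h1 := integral_prod_mul (μ := Q) (ν := Q) (fun x => g (fun k => (z + x) k))
      (fun x => g (fun k => (z + x) k))
    refine (mul_self_nonneg (∫ x, g (fun k => (z + x) k) ∂Q)).trans_eq (h1.symm.trans ?_)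
    rfl
  · refine Integrable.of_bound (hm.comp measurable_gaussianPair).aestronglyMeasurable (M * M)
      (Eventually.of_forall fun p => ?_)
    rw [norm_mul]
    exact mul_le_mul (hM _) (hM _) (norm_nonneg _) ((abs_nonneg _).trans (hM fun _ => 0))

end

/-- Positivity of the free field for the reflection of finitely many smooth functions which
vanish on the negative side. -/
theorem integral_mul_reflection_nonneg [NeZero D] (hR : 0 < R) (Y : HarmonicBasis D R) (j : Fin D)
    {J : Type} [Fintype J] {u : J → Ambient D → ℝ} (hu : ∀ k, ContDiff ℝ ∞ (u k))
    (hu0 : ∀ k v, v j.castSucc ≤ 0 → u k v = 0) {g : (J → ℝ) → ℝ} (hg : Measurable g) {M : ℝ}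
    (hM : ∀ x, |g x| ≤ M) :
    0 ≤ ∫ φ, g (fun k => pair Y φ (u k)) *
      g (fun k => pair Y φ fun v => u k (sphereIso R (flip j) v)) ∂freeMeasure D R := by
  classical
  let u' : J → Ambient D → ℝ := fun k v => u k (sphereIso R (flip j) v)
  have hu' : ∀ k, ContDiff ℝ ∞ (u' k) := fun k => (hu k).comp (contDiff_sphereIso R (flip j))
  have hc := fun k => isRapid_coeff hR Y (hu k)
  have hc' := fun k => isRapid_coeff hR Y (hu' k)
  let A : Matrix J J ℝ := fun k l => freeCov (coeff Y (u k)) (coeff Y (u l))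
  let B : Matrix J J ℝ := fun k l => freeCov (coeff Y (u k)) (coeff Y (u' l))
  have hA' : ∀ k l, freeCov (coeff Y (u' k)) (coeff Y (u' l)) = A k l := fun k l =>
    freeCov_comp_sphereIso hR Y (flip j) (hu k) (hu l)
  have hB' : ∀ k l, freeCov (coeff Y (u' k)) (coeff Y (u l)) = B k l := fun k l => by
    have h1 := freeCov_comp_sphereIso hR Y (flip j) (hu k) (hu' l)
    simp only [u', sphereIso_flip_flip] at h1
    exact h1
  have hBs : ∀ k l, B k l = B l k := fun k l => by rw [← hB' l k, freeCov_comm]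
  have hAs : ∀ k l, A k l = A l k := fun k l => freeCov_comm _ _
  let U : (J → ℝ) → Ambient D → ℝ := fun t v => ∑ k, t k * u k v
  have hU : ∀ t, ContDiff ℝ ∞ (U t) := fun t =>
    ContDiff.sum fun k _ => contDiff_const.mul (hu k)
  have hcU : ∀ t, coeff Y (U t) = fun i => ∑ k, t k * coeff Y (u k) i := fun t => funext fun i =>
    coeff_finsetSum hR Y Finset.univ (fun k => (hu k).continuous) t i
  have hcU' : ∀ t, coeff Y (fun v => U t (sphereIso R (flip j) v)) =
      fun i => ∑ k, t k * coeff Y (u' k) i := fun t => funext fun i =>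
    coeff_finsetSum hR Y Finset.univ (fun k => (hu' k).continuous) t i
  have hUB : ∀ t, freeCov (coeff Y (U t)) (coeff Y fun v => U t (sphereIso R (flip j) v)) =
      ∑ k, t k * ∑ l, t l * B k l := by
    intro t
    rw [hcU, hcU', freeCov_sum_left hc (IsRapid.sum hc' t)]
    refine Finset.sum_congr rfl fun k _ => ?_
    rw [freeCov_comm, freeCov_sum_left hc' (hc k)]
    exact congrArg _ (Finset.sum_congr rfl fun l _ => by rw [freeCov_comm])
  have hUA : ∀ t, freeCov (coeff Y (U t)) (coeff Y (U t)) = ∑ k, t k * ∑ l, t l * A k l := by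
    intro t
    rw [hcU, freeCov_sum_sum hc]
    simp only [Finset.mul_sum]
    rfl
  have hB0 : ∀ t : J → ℝ, 0 ≤ ∑ k, t k * ∑ l, t l * B k l := fun t => by
    rw [← hUB]
    exact freeCov_reflection_nonneg hR Y j (hU t) fun v hv =>
      Finset.sum_eq_zero fun k _ => by rw [hu0 k v hv, mul_zero]
  -- The covariance of `U - ΘU` with itself is nonnegative and equals twice this quadratic form.
  have hAB0 : ∀ t : J → ℝ, 0 ≤ ∑ k, t k * ∑ l, t l * (A k l - B k l) := fun t => by
    have h1 : ∑ k, t k * ∑ l, t l * (A k l - B k l) =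
        ∑ k, t k * ∑ l, t l * A k l - ∑ k, t k * ∑ l, t l * B k l := by
      simp only [← Finset.sum_sub_distrib, ← mul_sub]
    have hUt := (hU t).comp (contDiff_sphereIso R (flip j))
    have h2 : ∀ i, coeff Y (fun v => (-1) * U t (sphereIso R (flip j) v)) i =
      (-1) * coeff Y (fun v => U t (sphereIso R (flip j) v)) i := coeff_const_mul Y (-1) _
    have h3 := freeCov_add_self (isRapid_coeff hR Y (hU t))
      (isRapid_coeff hR Y (contDiff_const (c := (-1 : ℝ)) |>.mul hUt))
    have h4 := freeCov_self_nonneg (D := D) (R := R) fun i => coeff Y (U t) i +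
      coeff Y (fun v => (-1) * (U t ∘ sphereIso R (flip j)) v) i
    rw [h3] at h4
    have h5 : freeCov (coeff Y fun v => (-1) * (U t ∘ sphereIso R (flip j)) v)
        (coeff Y fun v => (-1) * (U t ∘ sphereIso R (flip j)) v) =
        freeCov (coeff Y (U t)) (coeff Y (U t)) := by
      rw [← freeCov_self_comp_sphereIso hR Y (flip j) (hU t)]
      refine tsum_congr fun i => ?_
      rw [show coeff Y (fun v => (-1) * (U t ∘ sphereIso R (flip j)) v) i = _ from h2 i]
      ring
    have h6 : freeCov (coeff Y (U t)) (coeff Y fun v => (-1) * (U t ∘ sphereIso R (flip j)) v) =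
        - freeCov (coeff Y (U t)) (coeff Y fun v => U t (sphereIso R (flip j) v)) := by
      rw [freeCov, freeCov, ← tsum_neg]
      refine tsum_congr fun i => ?_
      rw [show coeff Y (fun v => (-1) * (U t ∘ sphereIso R (flip j)) v) i = _ from h2 i]
      ring
    rw [h5, h6, hUA, hUB] at h4
    rw [h1]
    linarith
  have psd : ∀ S : Matrix J J ℝ, (∀ k l, S k l = S l k) →
      (∀ t : J → ℝ, 0 ≤ ∑ k, t k * ∑ l, t l * S k l) → S.PosSemidef := by
    intro S hS h
    refine Matrix.PosSemidef.of_dotProduct_mulVec_nonneg (Matrix.IsHermitian.ext fun k l => ?_)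
      fun t => ?_
    · simpa using hS l k
    · simpa [dotProduct, Matrix.mulVec, mul_comm] using h t
  have hPB := psd B hBs hB0
  have hPAB := psd (A - B) (fun k l => by simp [hAs k l, hBs k l]) hAB0
  let X : Field D R → EuclideanSpace ℝ (J ⊕ J) := fun φ => WithLp.toLp 2 fun k =>
    ∑' i, φ i * Sum.elim (fun k => coeff Y (u k)) (fun k => coeff Y (u' k)) k i
  have hX : Measurable X := (WithLp.measurable_toLp 2 _).comp
    (measurable_pi_lambda _ fun k => measurable_tsum_mul _)
  -- The joint covariance has diagonal blocks `A` and off-diagonal blocks `B`. It is that of a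
  -- common vector with covariance `B` plus two independent vectors with covariance `A - B`.
  have hlaw : (freeMeasure D R).map X = ((multivariateGaussian 0 B).prod
      ((multivariateGaussian 0 (A - B)).prod (multivariateGaussian 0 (A - B)))).map
        gaussianPair := by
    have := Measure.isProbabilityMeasure_map (μ := freeMeasure D R) hX.aemeasurable
    have := Measure.isProbabilityMeasure_map (μ := (multivariateGaussian 0 B).prod
      ((multivariateGaussian 0 (A - B)).prod (multivariateGaussian 0 (A - B))))
      (measurable_gaussianPair (J := J)).aemeasurable
    refine Measure.ext_of_charFun (funext fun t => ?_)
    have hcc : ∀ k : J ⊕ J,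
        IsRapid (Sum.elim (fun k => coeff Y (u k)) (fun k => coeff Y (u' k)) k) := by
      rintro (k | k)
      · exact hc k
      · exact hc' k
    rw [charFun_map_tsum hR hcc, charFun_map_gaussianPair, charFun_multivariateGaussian hPB,
      charFun_multivariateGaussian hPAB, charFun_multivariateGaussian hPAB, ← Complex.exp_add,
      ← Complex.exp_add, freeCov_sum_sum hcc]
    congr 1
    have e : (∑ k, ∑ l, t k * (t l * freeCov (Sum.elim (fun k => coeff Y (u k))
        (fun k => coeff Y (u' k)) k) (Sum.elim (fun k => coeff Y (u k))
        (fun k => coeff Y (u' k)) l))) =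
        (fun k => t (Sum.inl k) + t (Sum.inr k)) ⬝ᵥ
          B.mulVec (fun k => t (Sum.inl k) + t (Sum.inr k)) +
        ((fun k => t (Sum.inl k)) ⬝ᵥ (A - B).mulVec (fun k => t (Sum.inl k)) +
          (fun k => t (Sum.inr k)) ⬝ᵥ (A - B).mulVec (fun k => t (Sum.inr k))) := by
      simp only [Fintype.sum_sum_type, Sum.elim_inl, Sum.elim_inr, hA', hB', dotProduct,
        Matrix.mulVec, Finset.mul_sum, ← Finset.sum_add_distrib, Matrix.sub_apply]
      refine Finset.sum_congr rfl fun k _ => Finset.sum_congr rfl fun l _ => ?_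
      simp only [A, B]
      ring
    rw [e]
    push_cast
    simp only [inner_zero_right, Complex.ofReal_zero, zero_mul, zero_sub]
    ring
  have h1 := integral_gaussianPair_nonneg (multivariateGaussian 0 B)
    (multivariateGaussian 0 (A - B)) hg hM
  rw [← hlaw, integral_map hX.aemeasurable] at h1
  · exact h1
  · have hm1 : ∀ ι : J → J ⊕ J, Measurable fun (x : EuclideanSpace ℝ (J ⊕ J)) k => x (ι k) :=
      fun ι => measurable_pi_lambda _ fun k => by fun_prop
    exact ((hg.comp (hm1 _)).mul (hg.comp (hm1 _))).aestronglyMeasurable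

end

section

variable {R Λ : ℝ} {h : Space D → ℝ} {N : ℕ} {𝓛 : (Fin (N + 1) → ℝ) → ℝ}

/-! ### Reflection positivity of the regularized measure -/

/-- Bounded functions of finitely many smeared fields, smeared with functions which vanish on the
negative side of a coordinate hyperplane. -/
def IsPosCyl (Y : HarmonicBasis D R) (j : Fin D) (G : Field D R → ℝ) : Prop :=
  ∃ (J : Type) (_ : Fintype J) (u : J → Ambient D → ℝ) (g : (J → ℝ) → ℝ) (M : ℝ),
    (∀ k, ContDiff ℝ ∞ (u k)) ∧ (∀ k v, v j.castSucc ≤ 0 → u k v = 0) ∧ Measurable g ∧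
      (∀ x, |g x| ≤ M) ∧ ∀ φ, G φ = g fun k => pair Y φ (u k)

namespace IsPosCyl

variable {Y : HarmonicBasis D R} {j : Fin D} {G G' : Field D R → ℝ}

theorem measurable (hG : IsPosCyl Y j G) : Measurable G := by
  obtain ⟨J, _, u, g, M, -, -, hg, -, he⟩ := hG
  rw [funext he]
  exact hg.comp (measurable_pi_lambda _ fun k => measurable_pair Y _)

theorem exists_bound (hG : IsPosCyl Y j G) : ∃ M, ∀ φ, |G φ| ≤ M := by
  obtain ⟨J, _, u, g, M, -, -, -, hM, he⟩ := hG
  exact ⟨M, fun φ => by rw [he]; exact hM _⟩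

theorem comp₂ (hG : IsPosCyl Y j G) (hG' : IsPosCyl Y j G') {H : ℝ × ℝ → ℝ} (hH : Continuous H) :
    IsPosCyl Y j fun φ => H (G φ, G' φ) := by
  obtain ⟨J, _, u, g, M, hu, hu0, hg, hM, he⟩ := hG
  obtain ⟨J', _, u', g', M', hu', hu0', hg', hM', he'⟩ := hG'
  obtain ⟨C, hC⟩ := ((isCompact_Icc (a := -M) (b := M)).prod
    (isCompact_Icc (a := -M') (b := M'))).exists_bound_of_continuousOn hH.continuousOn
  refine ⟨J ⊕ J', inferInstance, Sum.elim u u',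
    fun x => H (g fun k => x (Sum.inl k), g' fun k => x (Sum.inr k)), C, ?_, ?_, ?_, fun x => ?_,
    fun φ => ?_⟩
  · rintro (k | k)
    exacts [hu k, hu' k]
  · rintro (k | k)
    exacts [hu0 k, hu0' k]
  · refine hH.measurable.comp ((hg.comp ?_).prodMk (hg'.comp ?_)) <;>
      exact measurable_pi_lambda _ fun k => measurable_pi_apply _
  · exact hC _ ⟨abs_le.1 (hM _), abs_le.1 (hM' _)⟩
  · simp only [he, he', Sum.elim_inl, Sum.elim_inr]

theorem zero (Y : HarmonicBasis D R) (j : Fin D) : IsPosCyl Y j fun _ => 0 :=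
  ⟨Empty, inferInstance, Empty.elim, fun _ => 0, 0, fun k => k.elim, fun k => k.elim,
    measurable_const, by simp, fun _ => rfl⟩

theorem reflection_nonneg [NeZero D] (hR : 0 < R) (hG : IsPosCyl Y j G) :
    0 ≤ ∫ φ, G φ * G (rotField hR Y (flip j) φ) ∂freeMeasure D R := by
  obtain ⟨J, _, u, g, M, hu, hu0, hg, hM, he⟩ := hG
  refine (integral_mul_reflection_nonneg hR Y j hu hu0 hg hM).trans_eq ?_
  refine integral_congr_ae ((ae_isTempered hR).mono fun φ hφ => ?_)
  simp only [he, pair_rotField hR Y _ hφ (hu _)]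

end IsPosCyl

/-- The mollifier at `θ` reaches only to distance `2B/Λ`, and derivatives do not enlarge supports.
So the Lagrangian density at such a `θ` involves only the positive side. -/
theorem isPosCyl_lagrangian [NeZero D] (hR : 0 < R) (hΛ : 0 < Λ) (hh : IsRegulator h)
    (h𝓛 : IsLagrangian 𝓛) (Y : HarmonicBasis D R) (j : Fin D) {B : ℝ} (hB : 0 < B)
    (hB' : ∀ x, h x ≠ 0 → ‖x‖ ≤ B) {θ : Ambient D} (hθ : θ ∈ Metric.sphere (center D R) R)
    (hθj : 2 * B / Λ < θ j.castSucc) :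
    IsPosCyl Y j fun φ => 𝓛 (fun i => smoothed Y Λ h (laplacianPow (i : ℕ) φ) θ) := by
  obtain ⟨U, hU, hUe, hUs⟩ := exists_mollifierAt_ext hR hΛ hh.smooth hB hB' hθ
  obtain ⟨C, hC⟩ := h𝓛.exists_bound
  refine ⟨Fin (N + 1), inferInstance, fun i => (lap (1 / (2 * R)))^[(i : ℕ)] U, 𝓛, C,
    fun i => contDiff_lap_iterate hU _ _, fun i v hv => ?_, h𝓛.measurable, hC, fun φ => ?_⟩
  · refine image_eq_zero_of_notMem_tsupport fun h1 => ?_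
    have h2 := tsupport_lap_iterate_subset U _ _ h1
    have h3 : tsupport U ⊆ Metric.closedBall θ (2 * B / Λ) :=
      closure_minimal (fun v hv => by
        rw [Metric.mem_closedBall, dist_eq_norm]
        exact hUs v hv) Metric.isClosed_closedBall
    have h4 := h3 h2
    rw [Metric.mem_closedBall, dist_eq_norm] at h4
    have h5 := (PiLp.norm_apply_le (v - θ) j.castSucc).trans h4
    rw [PiLp.sub_apply, Real.norm_eq_abs, abs_le] at h5
    linarith
  · simp only [smoothed_laplacianPow_eq_pair hR Y _ φ hU hUe]

/-- The `L²`-classes of the functions `IsPosCyl`. -/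
def posCylL2 (Y : HarmonicBasis D R) (j : Fin D) : Submodule ℝ (Lp ℝ 2 (freeMeasure D R)) where
  carrier := {f | ∃ G, IsPosCyl Y j G ∧ f =ᵐ[freeMeasure D R] G}
  add_mem' := by
    rintro f f' ⟨G, hG, hf⟩ ⟨G', hG', hf'⟩
    refine ⟨_, hG.comp₂ hG' (H := fun p => p.1 + p.2) (by fun_prop), ?_⟩
    filter_upwards [Lp.coeFn_add f f', hf, hf'] with φ h1 h2 h3
    rw [h1, Pi.add_apply, h2, h3]
  zero_mem' := ⟨_, IsPosCyl.zero Y j, Lp.coeFn_zero _ _ _⟩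
  smul_mem' := by
    rintro c f ⟨G, hG, hf⟩
    refine ⟨_, hG.comp₂ hG (H := fun p => c * p.1) (by fun_prop), ?_⟩
    filter_upwards [Lp.coeFn_smul c f, hf] with φ h1 h2
    rw [h1, Pi.smul_apply, h2, smul_eq_mul]

theorem IsPosCyl.memLp [NeZero D] {Y : HarmonicBasis D R} {j : Fin D} {G : Field D R → ℝ}
    (hG : IsPosCyl Y j G) : MemLp G 2 (freeMeasure D R) := by
  obtain ⟨M, hM⟩ := hG.exists_bound
  exact MemLp.of_bound hG.measurable.aestronglyMeasurable M (Eventually.of_forall hM)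

/-- The action of a region on the positive side is approximated by cylinder functions. -/
theorem exists_isPosCyl_approx [NeZero D] (hR : 0 < R) (hΛ : 0 < Λ) (hh : IsRegulator h)
    (h𝓛 : IsLagrangian 𝓛) (Y : HarmonicBasis D R) (j : Fin D) {B : ℝ} (hB : 0 < B)
    (hB' : ∀ x, h x ≠ 0 → ‖x‖ ≤ B) {s : Set (Ambient D)} (hsm : MeasurableSet s)
    (hs : ∀ θ ∈ s, 2 * B / Λ < θ j.castSucc) {ε : ℝ} (hε : 0 < ε) :
    ∃ G, IsPosCyl Y j G ∧ ∫ φ, |actionOn Y Λ h 𝓛 s φ - G φ| ∂freeMeasure D R ≤ ε := by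
  obtain ⟨C, hC⟩ := h𝓛.exists_bound
  have hA : MemLp (actionOn Y Λ h 𝓛 s) 2 (freeMeasure D R) :=
    MemLp.of_bound (measurable_actionOn hR Y hh.measurable hh.radial h𝓛.measurable
      s).aestronglyMeasurable _ (Eventually.of_forall fun φ => abs_actionOn_le Y hC s φ)
  -- Membership in the closure is shown through the double orthogonal complement. If `ψ` is
  -- orthogonal to all cylinder functions, it is orthogonal to the density at every `θ`, hence by
  -- Fubini to the integral. This dispenses with Riemann sums, which would need more than
  -- measurability of `𝓛`.
  have h1 : hA.toLp ∈ (posCylL2 Y j)ᗮᗮ := by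
    rw [Submodule.mem_orthogonal]
    intro ψ hψ
    obtain ⟨X, hX, hXe⟩ := exists_measurable_lagrangian (Λ := Λ) hR Y hh.measurable hh.radial
      h𝓛.measurable
    have hXb : ∀ φ, ∀ θ ∈ Metric.sphere (center D R) R, |X (φ, θ)| ≤ C := fun φ θ hθ => by
      rw [← hXe φ θ hθ]
      exact hC _
    have hψ1 : Integrable ψ (freeMeasure D R) := (Lp.memLp ψ).integrable one_le_two
    have h2 : inner ℝ ψ hA.toLp =
        ∫ φ, ∫ θ in s, ψ φ * X (φ, θ) ∂surface D R ∂freeMeasure D R := by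
      rw [L2.inner_def]
      refine integral_congr_ae (hA.coeFn_toLp.mono fun φ hφ => ?_)
      simp only [hφ, RCLike.inner_apply, conj_trivial]
      rw [integral_const_mul, mul_comm, actionOn]
      congr 1
      exact integral_congr_ae (ae_restrict_of_ae ((ae_mem_sphere hR).mono fun θ hθ => hXe φ θ hθ))
    rw [h2, integral_integral_swap]
    · refine integral_eq_zero_of_ae ((ae_restrict_iff' hsm).2
        ((ae_mem_sphere hR).mono fun θ hθ hθs => ?_))
      have h3 := isPosCyl_lagrangian hR hΛ hh h𝓛 Y j hB hB' hθ (hs θ hθs)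
      have h4 : (h3.memLp.toLp : Lp ℝ 2 (freeMeasure D R)) ∈ posCylL2 Y j :=
        ⟨_, h3, h3.memLp.coeFn_toLp⟩
      have h5 := (Submodule.mem_orthogonal' _ _).1 hψ _ h4
      rw [L2.inner_def] at h5
      refine Eq.trans ?_ h5
      refine integral_congr_ae (h3.memLp.coeFn_toLp.mono fun φ hφ => ?_)
      simp only [hφ, RCLike.inner_apply, conj_trivial, hXe φ θ hθ, mul_comm]
    · have h6 : Integrable (fun p : Field D R × Ambient D => ψ p.1)
          ((freeMeasure D R).prod ((surface D R).restrict s)) := hψ1.comp_fst _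
      refine h6.mul_bdd (c := C) hX.aestronglyMeasurable ?_
      have h7 : ∀ᵐ p ∂((freeMeasure D R).prod ((surface D R).restrict s)),
          p.2 ∈ Metric.sphere (center D R) R :=
        Measure.quasiMeasurePreserving_snd.ae (ae_restrict_of_ae (ae_mem_sphere hR))
      exact h7.mono fun p hp => hXb p.1 p.2 hp
  rw [Submodule.orthogonal_orthogonal_eq_closure, ← SetLike.mem_coe,
    Submodule.topologicalClosure_coe, Metric.mem_closure_iff] at h1
  obtain ⟨f, ⟨G, hG, hfG⟩, hf⟩ := h1 ε hε
  refine ⟨G, hG, ?_⟩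
  have h8 : MemLp (fun φ => actionOn Y Λ h 𝓛 s φ - G φ) 2 (freeMeasure D R) := hA.sub hG.memLp
  have h9 : eLpNorm (fun φ => actionOn Y Λ h 𝓛 s φ - G φ) 2 (freeMeasure D R) ≤
      ENNReal.ofReal ε := by
    rw [dist_comm, dist_eq_norm, ← neg_sub, norm_neg, Lp.norm_def] at hf
    refine ENNReal.le_ofReal_iff_toReal_le h8.2.ne hε.le |>.2 (le_trans (le_of_eq ?_) hf.le)
    congr 1
    refine eLpNorm_congr_ae ?_
    filter_upwards [Lp.coeFn_sub hA.toLp f, hA.coeFn_toLp, hfG] with φ e1 e2 e3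
    rw [e1, Pi.sub_apply, e2, e3]
  have h10 := (eLpNorm_le_eLpNorm_of_exponent_le (p := 1) one_le_two h8.1).trans h9
  rw [eLpNorm_one_eq_lintegral_enorm] at h10
  have h11 := integral_norm_eq_lintegral_enorm h8.1
  simp only [Real.norm_eq_abs] at h11
  rw [h11]
  exact ENNReal.toReal_le_of_le_ofReal hε.le h10

/-- On functions with a common uniform bound the form `∫ G · (G ∘ T)` is continuous for the `L¹`
distance, as `T` preserves the measure. -/
theorem integral_mul_comp_nonneg_of_approx {X : Type*} [MeasurableSpace X] {μ : Measure X}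
    [IsProbabilityMeasure μ] {T : X → X} (hT : MeasurePreserving T μ μ) {G : X → ℝ} {M : ℝ}
    (hG : Measurable G) (hM : ∀ x, |G x| ≤ M)
    (happ : ∀ ε > 0, ∃ G' : X → ℝ, Measurable G' ∧ (∀ x, |G' x| ≤ M) ∧
      ∫ x, |G x - G' x| ∂μ ≤ ε ∧ 0 ≤ ∫ x, G' x * G' (T x) ∂μ) :
    0 ≤ ∫ x, G x * G (T x) ∂μ := by
  have hint : ∀ {f : X → ℝ} {c : ℝ}, Measurable f → (∀ x, |f x| ≤ c) → Integrable f μ :=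
    fun hf hc => Integrable.of_bound hf.aestronglyMeasurable _ (Eventually.of_forall hc)
  obtain ⟨x0⟩ : Nonempty X := μ.nonempty_of_neZero
  have hM0 : 0 ≤ M := (abs_nonneg _).trans (hM x0)
  refine le_of_forall_pos_le_add fun ε hε => ?_
  obtain ⟨G', hG', hM', h1, h2⟩ := happ (ε / (2 * M + 1)) (by positivity)
  have hD : Measurable fun x => |G x - G' x| := (hG.sub hG').abs
  have hDb : ∀ x, |(|G x - G' x|)| ≤ 2 * M := fun x => by
    rw [abs_abs]
    have := abs_sub (G x) (G' x)
    linarith [hM x, hM' x]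
  have hDi := hint hD hDb
  have hDT : ∫ x, |G (T x) - G' (T x)| ∂μ = ∫ x, |G x - G' x| ∂μ := by
    have := integral_map (μ := μ) hT.measurable.aemeasurable (f := fun x => |G x - G' x|)
      hD.aestronglyMeasurable
    rw [hT.map_eq] at this
    exact this.symm
  have hDTi : Integrable (fun x => |G (T x) - G' (T x)|) μ :=
    hint (hD.comp hT.measurable) fun x => hDb (T x)
  have hprod : ∀ {f : X → ℝ}, Measurable f → (∀ x, |f x| ≤ M) →
      Integrable (fun x => f x * f (T x)) μ := fun {f} hf hb =>
    hint (c := M * M) (hf.mul (hf.comp hT.measurable)) fun x => by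
      rw [abs_mul]
      exact mul_le_mul (hb _) (hb _) (abs_nonneg _) hM0
  have h3 : ∫ x, G' x * G' (T x) ∂μ ≤
      ∫ x, (G x * G (T x) + (M * |G (T x) - G' (T x)| + M * |G x - G' x|)) ∂μ := by
    refine integral_mono (hprod hG' hM') ((hprod hG hM).add
      ((hDTi.const_mul M).add (hDi.const_mul M))) fun x => ?_
    have e : G' x * G' (T x) = G x * G (T x) - G x * (G (T x) - G' (T x)) -
        (G x - G' x) * G' (T x) := by ring
    have e1 := neg_le_abs (G x * (G (T x) - G' (T x)))
    have e2 := neg_le_abs ((G x - G' x) * G' (T x))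
    rw [abs_mul] at e1 e2
    have e3 := mul_le_mul_of_nonneg_right (hM x) (abs_nonneg (G (T x) - G' (T x)))
    have e4 := mul_le_mul_of_nonneg_left (hM' (T x)) (abs_nonneg (G x - G' x))
    simp only
    linarith
  have hsum : Integrable (fun x => M * |G (T x) - G' (T x)| + M * |G x - G' x|) μ :=
    (hDTi.const_mul M).add (hDi.const_mul M)
  rw [integral_add (hprod hG hM) hsum, integral_add (hDTi.const_mul M) (hDi.const_mul M), integral_const_mul, integral_const_mul,
    hDT] at h3
  have h4 := mul_le_mul_of_nonneg_left h1 hM0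
  have h5 : 2 * (M * (ε / (2 * M + 1))) ≤ ε := by
    rw [← mul_div_assoc, ← mul_div_assoc, div_le_iff₀ (by positivity)]
    nlinarith
  linarith

theorem abs_exp_neg_sub_exp_neg_le {C x y : ℝ} (hx : |x| ≤ C) (hy : |y| ≤ C) :
    |Real.exp (-x) - Real.exp (-y)| ≤ Real.exp C * |x - y| := by
  have h := Convex.norm_image_sub_le_of_norm_deriv_le (f := fun t => Real.exp (-t))
    (C := Real.exp C) (s := Set.Icc (-C) C) (x := y) (y := x) (fun t _ => by fun_prop)
    (fun t ht => by
      have : deriv (fun t => Real.exp (-t)) t = - Real.exp (-t) := by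
        simpa using ((hasDerivAt_neg t).exp).deriv
      rw [this, norm_neg, Real.norm_eq_abs, Real.abs_exp, Real.exp_le_exp]
      linarith [ht.1]) (convex_Icc _ _) (abs_le.1 hy) (abs_le.1 hx)
  simpa using h

theorem measurePreserving_rotField [NeZero D] (hR : 0 < R) (Y : HarmonicBasis D R)
    (A : Ambient D ≃ₗᵢ[ℝ] Ambient D) :
    MeasurePreserving (rotField hR Y A) (freeMeasure D R) (freeMeasure D R) :=
  ⟨measurable_rotField hR Y A, map_rotField hR Y A⟩

theorem integral_mul_reflection_exp_nonneg [NeZero D] (hR : 0 < R) (hΛ : 0 < Λ)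
    (hh : IsRegulator h) (h𝓛 : IsLagrangian 𝓛) (Y : HarmonicBasis D R) (j : Fin D) {B : ℝ}
    (hB : 0 < B) (hB' : ∀ x, h x ≠ 0 → ‖x‖ ≤ B) {s : Set (Ambient D)} (hsm : MeasurableSet s)
    (hs : ∀ θ ∈ s, 2 * B / Λ < θ j.castSucc) {F : Field D R → ℝ} (hF : IsPosCyl Y j F) :
    0 ≤ ∫ φ, (F φ * Real.exp (-actionOn Y Λ h 𝓛 s φ)) * (F (rotField hR Y (flip j) φ) *
      Real.exp (-actionOn Y Λ h 𝓛 s (rotField hR Y (flip j) φ))) ∂freeMeasure D R := by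
  obtain ⟨C₀, hC₀⟩ := h𝓛.exists_bound
  obtain ⟨K, hK⟩ := hF.exists_bound
  have hK0 : 0 ≤ K := (abs_nonneg _).trans (hK fun _ => 0)
  set C := C₀ * (surface D R).real s
  have hC : ∀ φ, |actionOn Y Λ h 𝓛 s φ| ≤ C := abs_actionOn_le Y hC₀ s
  have hAm := measurable_actionOn (Λ := Λ) hR Y hh.measurable hh.radial h𝓛.measurable s
  have hC0 : 0 ≤ C := (abs_nonneg _).trans (hC fun _ => 0)
  have hb : ∀ {x a : ℝ}, |x| ≤ K → |a| ≤ C → |x * Real.exp (-a)| ≤ K * Real.exp C := by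
    intro x a hx ha
    rw [abs_mul, Real.abs_exp]
    exact mul_le_mul hx (Real.exp_le_exp.2 ((neg_le_abs a).trans ha)) (Real.exp_pos _).le hK0
  refine integral_mul_comp_nonneg_of_approx (measurePreserving_rotField hR Y (flip j))
    (G := fun φ => F φ * Real.exp (-actionOn Y Λ h 𝓛 s φ)) (M := K * Real.exp C)
    (hF.measurable.mul hAm.neg.exp) (fun φ => hb (hK φ) (hC φ)) fun ε hε => ?_
  obtain ⟨a, ha, hae⟩ := exists_isPosCyl_approx hR hΛ hh h𝓛 Y j hB hB' hsm hs
    (ε := ε / (K * Real.exp C + 1)) (by positivity)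
  -- Clamping to the range of the true action keeps the exponentials uniformly bounded and does not
  -- increase the distance to the action.
  let cl : ℝ → ℝ := fun t => max (-C) (min C t)
  have hcl : ∀ t, |cl t| ≤ C := fun t =>
    abs_le.2 ⟨le_max_left _ _, max_le (by linarith) (min_le_left _ _)⟩
  have hcl' : ∀ x t, |x| ≤ C → |x - cl t| ≤ |x - t| := by
    intro x t hx
    have hx' : cl x = x := by
      simp only [cl, min_eq_right (abs_le.1 hx).2, max_eq_right (abs_le.1 hx).1]
    calc |x - cl t| = |cl x - cl t| := by rw [hx']
      _ ≤ |min C x - min C t| := by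
        simpa using abs_max_sub_max_le_max (-C) (min C x) (-C) (min C t)
      _ ≤ |x - t| := by simpa using abs_min_sub_min_le_max C x C t
  have hG' : IsPosCyl Y j fun φ => F φ * Real.exp (-cl (a φ)) :=
    hF.comp₂ ha (H := fun p => p.1 * Real.exp (-cl p.2)) (by fun_prop)
  refine ⟨fun φ => F φ * Real.exp (-cl (a φ)), hG'.measurable, fun φ => hb (hK φ) (hcl _), ?_,
    hG'.reflection_nonneg hR⟩
  obtain ⟨Ma, hMa⟩ := ha.exists_bound
  have hi : Integrable (fun φ => |actionOn Y Λ h 𝓛 s φ - a φ|) (freeMeasure D R) := by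
    refine Integrable.of_bound (hAm.sub ha.measurable).abs.aestronglyMeasurable (C + Ma)
      (Eventually.of_forall fun φ => ?_)
    rw [Real.norm_eq_abs, abs_abs]
    exact (abs_sub _ _).trans (add_le_add (hC φ) (hMa φ))
  calc ∫ φ, |F φ * Real.exp (-actionOn Y Λ h 𝓛 s φ) - F φ * Real.exp (-cl (a φ))|
        ∂freeMeasure D R
      ≤ ∫ φ, K * Real.exp C * |actionOn Y Λ h 𝓛 s φ - a φ| ∂freeMeasure D R := by
        refine integral_mono_of_nonneg (Eventually.of_forall fun φ => abs_nonneg _)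
          (hi.const_mul _) (Eventually.of_forall fun φ => ?_)
        simp only
        rw [← mul_sub, abs_mul, mul_assoc]
        refine mul_le_mul (hK φ) ?_ (abs_nonneg _) hK0
        refine (abs_exp_neg_sub_exp_neg_le (hC φ) (hcl _)).trans ?_
        exact mul_le_mul_of_nonneg_left (hcl' _ _ (hC φ)) (Real.exp_pos _).le
    _ = K * Real.exp C * ∫ φ, |actionOn Y Λ h 𝓛 s φ - a φ| ∂freeMeasure D R :=
        integral_const_mul _ _
    _ ≤ K * Real.exp C * (ε / (K * Real.exp C + 1)) :=
        mul_le_mul_of_nonneg_left hae (by positivity)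
    _ ≤ ε := by
        rw [← mul_div_assoc, div_le_iff₀ (by positivity)]
        nlinarith

end

/-! ### Approximate reflection positivity: the error from the equatorial strip -/

section

variable {R Λ : ℝ} {h : Space D → ℝ} {N : ℕ} {𝓛 : (Fin (N + 1) → ℝ) → ℝ}

theorem IsLagrangian.iInf_le (h𝓛 : IsLagrangian 𝓛) (x : Fin (N + 1) → ℝ) : (⨅ y, 𝓛 y) ≤ 𝓛 x := by
  obtain ⟨C, hC⟩ := h𝓛.exists_bound
  exact ciInf_le ⟨-C, by rintro _ ⟨y, rfl⟩; exact (abs_le.1 (hC y)).1⟩ x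

theorem IsLagrangian.le_iSup (h𝓛 : IsLagrangian 𝓛) (x : Fin (N + 1) → ℝ) : 𝓛 x ≤ ⨆ y, 𝓛 y := by
  obtain ⟨C, hC⟩ := h𝓛.exists_bound
  exact le_ciSup (f := 𝓛) ⟨C, by rintro _ ⟨y, rfl⟩; exact (abs_le.1 (hC y)).2⟩ x

theorem IsLagrangian.lagrangianSup_nonneg (h𝓛 : IsLagrangian 𝓛) : 0 ≤ lagrangianSup 𝓛 :=
  sub_nonneg.2 ((h𝓛.iInf_le 0).trans (h𝓛.le_iSup 0))

theorem abs_actionOn_sub_le [NeZero D] (hR : 0 < R) (hh : IsRegulator h)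
    (h𝓛 : IsLagrangian 𝓛) (Y : HarmonicBasis D R) (s : Set (Ambient D)) (φ : Field D R) :
    (⨅ x, 𝓛 x) * (surface D R).real s ≤ actionOn Y Λ h 𝓛 s φ ∧
      actionOn Y Λ h 𝓛 s φ - (⨅ x, 𝓛 x) * (surface D R).real s ≤
        lagrangianSup 𝓛 * (surface D R).real s := by
  obtain ⟨C, hC⟩ := h𝓛.exists_bound
  have hi := (integrable_lagrangian (Λ := Λ) hR Y hh.measurable hh.radial h𝓛.measurable hC
    φ).restrict (s := s)
  have hconst : ∀ c : ℝ, ∫ _ in s, c ∂surface D R = c * (surface D R).real s := fun c => by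
    rw [setIntegral_const, smul_eq_mul, mul_comm]
  rw [lagrangianSup, sub_mul, ← hconst, ← hconst]
  refine ⟨integral_mono (integrable_const _) hi fun θ => h𝓛.iInf_le _, sub_le_sub_right ?_ _⟩
  exact integral_mono hi (integrable_const _) fun θ => h𝓛.le_iSup _

/-- The action splits into a positive side, its mirror image and a strip. Without the strip the
integral is nonnegative. The strip contributes a factor which, after removal of the infimum of `𝓛`,
lies between 1 and the exponential in the statement. -/
theorem neg_le_expect_reflection [NeZero D] (hR : 0 < R) (hΛ : 0 < Λ)
    (hh : IsRegulator h) (h𝓛 : IsLagrangian 𝓛) (Y : HarmonicBasis D R) (j : Fin D) {B : ℝ}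
    (hB : 0 < B) (hB' : ∀ x, h x ≠ 0 → ‖x‖ ≤ B) {F : Field D R → ℝ} (hF : IsPosCyl Y j F)
    {K : ℝ} (hK : ∀ φ, |F φ| ≤ K) :
    -(K ^ 2 * (Real.exp (lagrangianSup 𝓛 *
      (surface D R).real {v | |v j.castSucc| ≤ 2 * B / Λ}) - 1)) ≤
      expect Y Λ h 𝓛 fun φ => F φ * F (rotField hR Y (flip j) φ) := by
  set δ := 2 * B / Λ with hδ
  have hδ0 : 0 < δ := by positivity
  set s₀ : Set (Ambient D) := {v | |v j.castSucc| ≤ δ} with hs₀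
  let sp : Set (Ambient D) := {v | δ < v j.castSucc}
  let sm : Set (Ambient D) := {v | v j.castSucc < -δ}
  have hmc : Measurable fun v : Ambient D => v j.castSucc := by fun_prop
  have hsp : MeasurableSet sp := measurableSet_lt measurable_const hmc
  have hsm : MeasurableSet sm := measurableSet_lt hmc measurable_const
  have hs0 : MeasurableSet s₀ := measurableSet_le hmc.abs measurable_const
  obtain ⟨C, hC⟩ := h𝓛.exists_bound
  have hsplit : ∀ φ, action Y Λ h 𝓛 φ =
      actionOn Y Λ h 𝓛 sp φ + actionOn Y Λ h 𝓛 sm φ + actionOn Y Λ h 𝓛 s₀ φ := by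
    intro φ
    have hi := integrable_lagrangian (Λ := Λ) hR Y hh.measurable hh.radial h𝓛.measurable hC φ
    have h1 : (Set.univ : Set (Ambient D)) = sp ∪ sm ∪ s₀ := by
      ext v
      simp only [Set.mem_univ, Set.mem_union, true_iff, sp, sm, s₀, Set.mem_ofPred_eq, abs_le]
      by_contra! hcon
      linarith [hcon.2 (by linarith [hcon.1.2]), hcon.1.1]
    rw [action_eq_actionOn, actionOn, h1, setIntegral_union _ hs0 hi.integrableOn hi.integrableOn,
      setIntegral_union _ hsm hi.integrableOn hi.integrableOn]
    · rfl
    · refine Set.disjoint_left.2 fun v hv hv' => ?_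
      simp only [sp, sm, Set.mem_ofPred_eq] at hv hv'
      linarith
    · refine Set.disjoint_left.2 fun v hv hv' => ?_
      simp only [sp, sm, s₀, Set.mem_union, Set.mem_ofPred_eq, abs_le] at hv hv'
      rcases hv with hv | hv <;> linarith [hv'.1, hv'.2]
  have h1 := integral_mul_reflection_exp_nonneg hR hΛ hh h𝓛 Y j hB hB' hsp (fun θ hθ => hθ) hF
  set V := (surface D R).real s₀
  set c := (⨅ x, 𝓛 x) * V
  set E := Real.exp (lagrangianSup 𝓛 * V)
  have hK0 : 0 ≤ K := (abs_nonneg _).trans (hK fun _ => 0)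
  have hFm := hF.measurable
  have hΘm := measurable_rotField hR Y (flip j)
  have hexp := integrable_exp_action (Λ := Λ) hR hh h𝓛 Y
  have hFF : Integrable (fun φ => F φ * F (rotField hR Y (flip j) φ) *
      Real.exp (-action Y Λ h 𝓛 φ)) (freeMeasure D R) := by
    refine hexp.bdd_mul (c := K * K) (hFm.mul (hFm.comp hΘm)).aestronglyMeasurable
      (Eventually.of_forall fun φ => ?_)
    rw [norm_mul]
    exact mul_le_mul (hK _) (hK _) (norm_nonneg _) hK0
  -- With `x` the product of `F` and its reflection, `|x| ≤ K²`, and `1 ≤ exp (a - c) ≤ E`, the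
  -- inequality is `x exp (a - c) ≤ x + K² (E - 1)`.
  have h2 : ∀ᵐ φ ∂freeMeasure D R, (F φ * Real.exp (-actionOn Y Λ h 𝓛 sp φ)) *
      (F (rotField hR Y (flip j) φ) *
        Real.exp (-actionOn Y Λ h 𝓛 sp (rotField hR Y (flip j) φ))) ≤
      Real.exp c * (F φ * F (rotField hR Y (flip j) φ) * Real.exp (-action Y Λ h 𝓛 φ) +
        K ^ 2 * (E - 1) * Real.exp (-action Y Λ h 𝓛 φ)) := by
    filter_upwards [ae_isTempered hR] with φ hφ
    have h3 : sphereIso R (flip j) ⁻¹' sp = sm := by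
      ext v
      simp only [Set.mem_preimage, sp, sm, Set.mem_ofPred_eq, sphereIso_flip_same]
      constructor <;> intro <;> linarith
    rw [actionOn_rotField hR hΛ hh Y (flip j) hφ hsp, h3]
    obtain ⟨h4, h5⟩ := abs_actionOn_sub_le (Λ := Λ) hR hh h𝓛 Y s₀ φ
    set a := actionOn Y Λ h 𝓛 s₀ φ
    have h6 : F φ * Real.exp (-actionOn Y Λ h 𝓛 sp φ) * (F (rotField hR Y (flip j) φ) *
        Real.exp (-actionOn Y Λ h 𝓛 sm φ)) = Real.exp c * (F φ * F (rotField hR Y (flip j) φ) *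
          Real.exp (-action Y Λ h 𝓛 φ) * Real.exp (a - c)) := by
      have : Real.exp c * (Real.exp (-action Y Λ h 𝓛 φ) * Real.exp (a - c)) =
          Real.exp (-actionOn Y Λ h 𝓛 sp φ) * Real.exp (-actionOn Y Λ h 𝓛 sm φ) := by
        rw [← Real.exp_add, ← Real.exp_add, ← Real.exp_add, hsplit φ]
        congr 1
        ring
      linear_combination (-(F φ * F (rotField hR Y (flip j) φ))) * this
    rw [h6]
    refine mul_le_mul_of_nonneg_left ?_ (Real.exp_pos _).le
    have h7 : 1 ≤ Real.exp (a - c) := Real.one_le_exp (sub_nonneg.2 h4)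
    have h8 : Real.exp (a - c) ≤ E := Real.exp_le_exp.2 h5
    have h9 : F φ * F (rotField hR Y (flip j) φ) ≤ K ^ 2 := by
      refine (le_abs_self _).trans ?_
      rw [abs_mul, sq]
      exact mul_le_mul (hK _) (hK _) (abs_nonneg _) hK0
    have h10 : F φ * F (rotField hR Y (flip j) φ) * (Real.exp (a - c) - 1) ≤ K ^ 2 * (E - 1) := by
      refine (mul_le_mul_of_nonneg_right h9 (by linarith)).trans ?_
      exact mul_le_mul_of_nonneg_left (by linarith) (sq_nonneg K)
    nlinarith [mul_le_mul_of_nonneg_right h10 (Real.exp_pos (-action Y Λ h 𝓛 φ)).le]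
  have h11 : Integrable (fun φ => F φ * F (rotField hR Y (flip j) φ) *
      Real.exp (-action Y Λ h 𝓛 φ) + K ^ 2 * (E - 1) * Real.exp (-action Y Λ h 𝓛 φ))
      (freeMeasure D R) := hFF.add (hexp.const_mul _)
  have h12 := h1.trans (integral_mono_ae (hf := ?_) (hg := h11.const_mul _) h2)
  · rw [integral_const_mul, integral_add hFF (hexp.const_mul _), integral_const_mul] at h12
    have h13 := nonneg_of_mul_nonneg_right h12 (Real.exp_pos c)
    have h14 : 0 < ∫ φ, Real.exp (-action Y Λ h 𝓛 φ) ∂freeMeasure D R :=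
      integral_exp_pos hexp
    rw [expect, le_div_iff₀ h14]
    linarith
  · have hAm := measurable_actionOn (Λ := Λ) hR Y hh.measurable hh.radial h𝓛.measurable sp
    have hGm : Measurable fun φ => F φ * Real.exp (-actionOn Y Λ h 𝓛 sp φ) :=
      hFm.mul hAm.neg.exp
    have hGb : ∀ φ, |F φ * Real.exp (-actionOn Y Λ h 𝓛 sp φ)| ≤
        K * Real.exp (C * (surface D R).real sp) := fun φ => by
      rw [abs_mul, Real.abs_exp]
      exact mul_le_mul (hK φ) (Real.exp_le_exp.2 ((neg_le_abs _).trans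
        (abs_actionOn_le Y hC sp φ))) (Real.exp_pos _).le hK0
    refine Integrable.of_bound (hGm.mul (hGm.comp hΘm)).aestronglyMeasurable
      ((K * Real.exp (C * (surface D R).real sp)) * (K * Real.exp (C * (surface D R).real sp)))
      (Eventually.of_forall fun φ => ?_)
    rw [norm_mul]
    exact mul_le_mul (hGb _) (hGb _) (norm_nonneg _) (by positivity)

end

section

/-! ### Generalized limits -/

open Classical in
/-- The generalized limit of a bounded sequence. -/
def genLim (L : StrongDual ℝ (lp (fun _ : ℕ => ℝ) ∞)) (a : ℕ → ℝ) : ℝ :=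
  if ha : Memℓp a ∞ then L ⟨a, ha⟩ else 0

section genLim

variable {L : StrongDual ℝ (lp (fun _ : ℕ => ℝ) ∞)}

theorem memℓp_of_bound {a : ℕ → ℝ} {C : ℝ} (ha : ∀ n, |a n| ≤ C) : Memℓp a ∞ :=
  memℓp_infty ⟨C, by rintro _ ⟨n, rfl⟩; exact ha n⟩

theorem genLim_add {a b : ℕ → ℝ} {C C' : ℝ} (ha : ∀ n, |a n| ≤ C) (hb : ∀ n, |b n| ≤ C') :
    genLim L (fun n => a n + b n) = genLim L a + genLim L b := by
  have hab : ∀ n, |a n + b n| ≤ C + C' := fun n =>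
    (abs_add_le _ _).trans (add_le_add (ha n) (hb n))
  rw [genLim, genLim, genLim, dif_pos (memℓp_of_bound ha), dif_pos (memℓp_of_bound hb),
    dif_pos (memℓp_of_bound hab), ← map_add]
  rfl

theorem genLim_const_mul {a : ℕ → ℝ} {C : ℝ} (ha : ∀ n, |a n| ≤ C) (c : ℝ) :
    genLim L (fun n => c * a n) = c * genLim L a := by
  have hab : ∀ n, |c * a n| ≤ |c| * C := fun n => by
    rw [abs_mul]
    exact mul_le_mul_of_nonneg_left (ha n) (abs_nonneg c)
  rw [genLim, genLim, dif_pos (memℓp_of_bound ha), dif_pos (memℓp_of_bound hab)]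
  exact map_smul L c (⟨a, memℓp_of_bound ha⟩ : lp (fun _ : ℕ => ℝ) ∞)

theorem genLim_sub {a b : ℕ → ℝ} {C C' : ℝ} (ha : ∀ n, |a n| ≤ C) (hb : ∀ n, |b n| ≤ C') :
    genLim L (fun n => a n - b n) = genLim L a - genLim L b := by
  have h1 := genLim_add (L := L) ha (b := fun n => (-1) * b n) (C' := C') fun n => by simpa using hb n
  rw [genLim_const_mul hb] at h1
  simp only [neg_one_mul, ← sub_eq_add_neg] at h1
  exact h1

theorem genLim_eq_of_tendsto (hL : IsGeneralizedLimit L) {a : ℕ → ℝ} {C : ℝ}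
    (ha : ∀ n, |a n| ≤ C) {x : ℝ} (hx : Tendsto a atTop (𝓝 x)) : genLim L a = x := by
  rw [genLim, dif_pos (memℓp_of_bound ha)]
  exact hL.eq_lim _ x hx

theorem genLim_nonneg (hL : IsGeneralizedLimit L) {a : ℕ → ℝ} {C : ℝ}
    (ha : ∀ n, |a n| ≤ C) (h0 : ∀ n, 0 ≤ a n) : 0 ≤ genLim L a := by
  rw [genLim, dif_pos (memℓp_of_bound ha)]
  exact hL.nonneg _ h0

/-- The negative part of `b - a` vanishes eventually, so the functional, which extends the limit,
annihilates it. What remains is nonnegative. -/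
theorem genLim_mono_of_eventually (hL : IsGeneralizedLimit L) {a b : ℕ → ℝ} {C C' : ℝ}
    (ha : ∀ n, |a n| ≤ C) (hb : ∀ n, |b n| ≤ C') (hab : ∀ᶠ n in atTop, a n ≤ b n) :
    genLim L a ≤ genLim L b := by
  have hd : ∀ n, |b n - a n| ≤ C' + C := fun n =>
    (abs_sub _ _).trans (add_le_add (hb n) (ha n))
  have hp : ∀ n, |max (b n - a n) 0| ≤ C' + C := fun n => by
    rw [abs_of_nonneg (le_max_right _ _)]
    exact max_le ((le_abs_self _).trans (hd n)) ((abs_nonneg _).trans (hd n))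
  have h1 := genLim_nonneg hL hp fun n => le_max_right _ _
  have h2 : genLim L (fun n => max (b n - a n) 0 - (b n - a n)) = 0 := by
    refine genLim_eq_of_tendsto hL (C := (C' + C) + (C' + C)) (fun n =>
      (abs_sub _ _).trans (add_le_add (hp n) (hd n))) ?_
    refine tendsto_const_nhds.congr' (hab.mono fun n hn => ?_)
    beta_reduce
    rw [max_eq_left (sub_nonneg.2 hn), sub_self]
  rw [genLim_sub hp hd, genLim_sub hb ha] at h2
  linarith

end genLim

/-! ### Fields as points of the compactification -/

/-- The Dirac distribution. -/
def dirac (x : Space D) : Distr D :=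
  StrongDual.toWeakDual
    ({ toFun := fun f => f x
       map_add' := fun f g => by simp
       map_smul' := fun c f => by simp
       cont := continuous_eval_const x } : Test D →L[ℝ] ℝ)

/-- Every linear functional agrees with a distribution on finitely many test functions. -/
theorem exists_distr_eq (ℓ : Test D →ₗ[ℝ] ℝ) (s : Finset (Test D)) :
    ∃ T : Distr D, ∀ f ∈ s, T f = ℓ f := by
  classical
  let ev : Distr D →ₗ[ℝ] (s → ℝ) :=
    { toFun := fun T f => T f.1
      map_add' := fun T T' => rfl
      map_smul' := fun c T => rfl }
  by_cases hmem : (fun f : s => ℓ f.1) ∈ LinearMap.range ev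
  · obtain ⟨T, hT⟩ := hmem
    exact ⟨T, fun f hf => congrFun hT ⟨f, hf⟩⟩
  · exfalso
    -- A functional that vanishes on all value vectors of distributions but not on that of `ℓ`.
    -- Dirac distributions show that its coefficients form a linear relation between the test
    -- functions, which `ℓ` must respect.
    obtain ⟨a, ha, ha'⟩ := Submodule.exists_dual_map_eq_bot_of_notMem hmem inferInstance
    have hsum : ∀ v : s → ℝ, a v = ∑ f, v f * a (Pi.single f 1) := fun v => by
      rw [LinearMap.pi_apply_eq_sum_univ a v]
      refine Finset.sum_congr rfl fun f _ => ?_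
      rw [smul_eq_mul]
      congr 2
      funext g
      simp [Pi.single_apply, eq_comm]
    have h0 : ∑ f : s, a (Pi.single f 1) • f.1 = 0 := by
      refine DFunLike.ext _ _ fun x => ?_
      have h1 : a (ev (dirac x)) = 0 := by
        have : a (ev (dirac x)) ∈ (LinearMap.range ev).map a :=
          Submodule.mem_map_of_mem ⟨_, rfl⟩
        rwa [ha', Submodule.mem_bot] at this
      rw [hsum] at h1
      have h2 : (∑ f : s, a (Pi.single f 1) • f.1 : Test D) x =
          ∑ f : s, a (Pi.single f 1) * f.1 x := by
        have := map_sum (dirac x : Test D →L[ℝ] ℝ) (fun f : s => a (Pi.single f 1) • f.1)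
          Finset.univ
        refine this.trans (Finset.sum_congr rfl fun f _ => ?_)
        exact map_smul (dirac x : Test D →L[ℝ] ℝ) _ _
      rw [h2]
      refine Eq.trans ?_ h1
      exact Finset.sum_congr rfl fun f _ => mul_comm _ _
    refine ha ?_
    rw [hsum]
    have h3 := congrArg ℓ h0
    rw [map_sum, map_zero] at h3
    refine Eq.trans (Finset.sum_congr rfl fun f _ => ?_) h3
    rw [map_smul, smul_eq_mul, mul_comm]

/-- Distributions agreeing with `ℓ` on larger and larger finite sets accumulate, by compactness, at
a point. Along the ultrafilter the values of a cylindrical function are eventually constant. No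
continuity of `ℓ` is required. -/
theorem IsCylCompactification.exists_point {K : Type*} [TopologicalSpace K] {ι : Distr D → K}
    (hι : IsCylCompactification ι) (ℓ : Test D →ₗ[ℝ] ℝ) :
    ∃ x : K, ∀ (m : ℕ) (f : Fin m → Test D) (F : (Fin m → ℝ) →ᵇ ℝ) (Φ : C(K, ℝ)),
      (∀ T, Φ (ι T) = cyl f F T) → Φ x = F fun i => ℓ (f i) := by
  classical
  have := hι.compactSpace
  choose T hT using exists_distr_eq ℓ
  let 𝒰 : Ultrafilter (Finset (Test D)) := Ultrafilter.of atTop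
  obtain ⟨x, -, hx⟩ := isCompact_univ.ultrafilter_le_nhds (𝒰.map fun s => ι (T s)) (by simp)
  refine ⟨x, fun m f F Φ hΦ => ?_⟩
  have h1 : Tendsto (fun s => Φ (ι (T s))) 𝒰 (𝓝 (Φ x)) :=
    (Φ.continuous.tendsto x).comp hx
  have h2 : ∀ᶠ s in (𝒰 : Filter (Finset (Test D))), Φ (ι (T s)) = F fun i => ℓ (f i) := by
    refine (Ultrafilter.of_le atTop) ?_
    filter_upwards [eventually_ge_atTop (Finset.univ.image f)] with s hs
    rw [hΦ, cyl]
    congr 1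
    funext i
    exact hT s _ (hs (Finset.mem_image_of_mem f (Finset.mem_univ i)))
  exact tendsto_nhds_unique (h1.congr' h2) tendsto_const_nhds |>.symm ▸ rfl

section

variable {R : ℝ}

theorem exists_test_radius (f : Test D) : ∃ B : ℝ, 0 < B ∧ ∀ x, f x ≠ 0 → ‖x‖ ≤ B :=
  exists_radius f.hasCompactSupport

theorem exists_pull_test_ext (hR : 0 < R) (f : Test D) :
    ∃ U : Ambient D → ℝ, ContDiff ℝ ∞ U ∧
      (∀ v ∈ Metric.sphere (center D R) R, pull R f v = U v) ∧
      ∀ v, U v ≠ 0 → ∃ c : ℝ, 0 < c ∧ f (c • horiz v) ≠ 0 := by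
  obtain ⟨B, hB, hfB⟩ := exists_test_radius f
  obtain ⟨U, h1, h2, -, h3⟩ := exists_pull_ext hR f.contDiff hB (lt_add_one B) hfB
  exact ⟨U, h1, h2, h3⟩

/-- The functional on test functions given by a field on the sphere. -/
def fieldFunctional [NeZero D] (hR : 0 < R) (Y : HarmonicBasis D R) {φ : Field D R}
    (hφ : IsTempered φ) : Test D →ₗ[ℝ] ℝ where
  toFun f := pair Y φ (pull R f)
  map_add' f g := by
    obtain ⟨U, hU, hUe, -⟩ := exists_pull_test_ext hR f
    obtain ⟨V, hV, hVe, -⟩ := exists_pull_test_ext hR g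
    rw [pair_congr hR Y φ hUe, pair_congr hR Y φ hVe,
      pair_congr hR Y φ (w := fun v => U v + V v) fun v hv => by
        rw [← hUe v hv, ← hVe v hv, pull, pull, pull]
        split_ifs <;> simp]
    rw [pair, pair, pair, ← Summable.tsum_add (hφ.summable_mul (isRapid_coeff hR Y hU))
      (hφ.summable_mul (isRapid_coeff hR Y hV))]
    refine tsum_congr fun i => ?_
    rw [coeff_add hR Y hU.continuous hV.continuous, mul_add]
  map_smul' c f := by
    have h1 : pull R (c • f : Test D) = fun v => c * pull R f v := by
      funext v
      rw [pull, pull]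
      split_ifs <;> simp
    rw [h1, pair, pair, RingHom.id_apply, smul_eq_mul, ← tsum_mul_left]
    refine tsum_congr fun i => ?_
    rw [coeff_const_mul]
    ring

end

end

section

/-! ### Density of the cylindrical functions -/

theorem isCylindrical_const (c : ℝ) : IsCylindrical fun _ : Distr D => c :=
  ⟨0, Fin.elim0, BoundedContinuousFunction.const _ c, rfl⟩

/-- The part of a bounded continuous function of the first variables. -/
def extendLeft {m m' : ℕ} (F : (Fin m → ℝ) →ᵇ ℝ) : (Fin (m + m') → ℝ) →ᵇ ℝ :=
  F.compContinuous ⟨fun x i => x (Fin.castAdd m' i), by fun_prop⟩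

/-- The part of a bounded continuous function of the last variables. -/
def extendRight {m m' : ℕ} (F : (Fin m' → ℝ) →ᵇ ℝ) : (Fin (m + m') → ℝ) →ᵇ ℝ :=
  F.compContinuous ⟨fun x i => x (Fin.natAdd m i), by fun_prop⟩

theorem extendLeft_apply {m m' : ℕ} (F : (Fin m → ℝ) →ᵇ ℝ) (x : Fin (m + m') → ℝ) :
    extendLeft F x = F fun i => x (Fin.castAdd m' i) := rfl

theorem extendRight_apply {m m' : ℕ} (F : (Fin m' → ℝ) →ᵇ ℝ) (x : Fin (m + m') → ℝ) :
    extendRight F x = F fun i => x (Fin.natAdd m i) := rfl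

theorem cyl_mul_cyl {m m' : ℕ} (f : Fin m → Test D) (f' : Fin m' → Test D)
    (F : (Fin m → ℝ) →ᵇ ℝ) (F' : (Fin m' → ℝ) →ᵇ ℝ) (T : Distr D) :
    cyl (Fin.append f f') (extendLeft F * extendRight F') T = cyl f F T * cyl f' F' T := by
  simp [cyl, extendLeft_apply, extendRight_apply]

theorem cyl_add_cyl {m m' : ℕ} (f : Fin m → Test D) (f' : Fin m' → Test D)
    (F : (Fin m → ℝ) →ᵇ ℝ) (F' : (Fin m' → ℝ) →ᵇ ℝ) (T : Distr D) :
    cyl (Fin.append f f') (extendLeft F + extendRight F') T = cyl f F T + cyl f' F' T := by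
  simp [cyl, extendLeft_apply, extendRight_apply]

section

variable {K : Type*} [TopologicalSpace K] {ι : Distr D → K}

/-- The algebra of the continuous functions that are cylindrical on distributions. -/
def cylSubalgebra (ι : Distr D → K) : Subalgebra ℝ C(K, ℝ) where
  carrier := {Φ | IsCylindrical fun T => Φ (ι T)}
  mul_mem' := by
    rintro Φ Ψ ⟨m, f, F, h⟩ ⟨m', f', F', h'⟩
    refine ⟨m + m', Fin.append f f', extendLeft F * extendRight F', funext fun T => ?_⟩
    rw [cyl_mul_cyl, ← h, ← h', ContinuousMap.mul_apply]
  add_mem' := by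
    rintro Φ Ψ ⟨m, f, F, h⟩ ⟨m', f', F', h'⟩
    refine ⟨m + m', Fin.append f f', extendLeft F + extendRight F', funext fun T => ?_⟩
    rw [cyl_add_cyl, ← h, ← h', ContinuousMap.add_apply]
  algebraMap_mem' c := isCylindrical_const c

theorem IsCylCompactification.dense_cylSubalgebra (hι : IsCylCompactification ι)
    (Φ : C(K, ℝ)) : Φ ∈ closure (cylSubalgebra ι : Set C(K, ℝ)) := by
  have := hι.compactSpace
  have h := ContinuousMap.subalgebra_topologicalClosure_eq_top_of_separatesPoints
    (cylSubalgebra ι) fun x y hxy => by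
      obtain ⟨Ψ, hΨ, hne⟩ := hι.separates x y hxy
      exact ⟨Ψ, ⟨Ψ, hΨ, rfl⟩, hne⟩
  have h2 : Φ ∈ (cylSubalgebra ι).topologicalClosure := h ▸ Algebra.mem_top
  exact h2

theorem IsCylCompactification.measure_ext (hι : IsCylCompactification ι) [MeasurableSpace K]
    [BorelSpace K] {μ ν : Measure K} [IsProbabilityMeasure μ] [IsProbabilityMeasure ν]
    [μ.Regular] [ν.Regular]
    (h : ∀ Φ : C(K, ℝ), IsCylindrical (fun T => Φ (ι T)) → ∫ x, Φ x ∂μ = ∫ x, Φ x ∂ν) : μ = ν := by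
  have := hι.compactSpace
  have := hι.t2Space
  have hc : ∀ (ρ : Measure K) [IsProbabilityMeasure ρ],
      Continuous fun Φ : C(K, ℝ) => ∫ x, Φ x ∂ρ := by
    intro ρ _
    have hi : ∀ Φ : C(K, ℝ), Integrable Φ ρ := fun Φ =>
      Integrable.of_bound Φ.continuous.aestronglyMeasurable ‖Φ‖
        (Eventually.of_forall fun x => Φ.norm_coe_le_norm x)
    refine (LipschitzWith.of_dist_le_mul (K := 1) fun Φ Ψ => ?_).continuous
    rw [dist_eq_norm, ← integral_sub (hi Φ) (hi Ψ), NNReal.coe_one, one_mul, dist_eq_norm]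
    refine (norm_integral_le_of_norm_le_const (C := ‖Φ - Ψ‖) (Eventually.of_forall fun x =>
      (Φ - Ψ).norm_coe_le_norm x)).trans ?_
    simp
  refine Measure.ext_of_integral_eq_on_compactlySupported fun f => ?_
  have hcl : IsClosed {Φ : C(K, ℝ) | ∫ x, Φ x ∂μ = ∫ x, Φ x ∂ν} := isClosed_eq (hc μ) (hc ν)
  exact closure_minimal (fun Φ hΦ => h Φ hΦ) hcl (hι.dense_cylSubalgebra f.toContinuousMap)

end

/-! ### The limit measure -/

/-- The standing hypotheses on the regularized theories. -/
structure IsTheory (L : StrongDual ℝ (lp (fun _ : ℕ => ℝ) ∞)) (R Λ : ℕ → ℝ) (h : Space D → ℝ)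
    {N : ℕ → ℕ} (𝓛 : ∀ n, (Fin (N n + 1) → ℝ) → ℝ) : Prop where
  generalizedLimit : IsGeneralizedLimit L
  radius_pos : ∀ n, 0 < R n
  cutoff_pos : ∀ n, 0 < Λ n
  regulator : IsRegulator h
  lagrangian : ∀ n, IsLagrangian (𝓛 n)

section

variable {L : StrongDual ℝ (lp (fun _ : ℕ => ℝ) ∞)} {R Λ : ℕ → ℝ} {h : Space D → ℝ}
  {N : ℕ → ℕ} {𝓛 : ∀ n, (Fin (N n + 1) → ℝ) → ℝ} {Y : ∀ n, HarmonicBasis D (R n)}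

theorem limExpect_eq_genLim (G : ∀ n, Field D (R n) → ℝ) : limExpect L Y Λ h 𝓛 G =
    genLim L fun n => expect (Y n) (Λ n) h (𝓛 n) (G n) := rfl

/-- Uniformly bounded families of almost everywhere measurable functions. -/
structure IsBddFamily (G : ∀ n, Field D (R n) → ℝ) : Prop where
  aestronglyMeasurable : ∀ n, AEStronglyMeasurable (G n) (freeMeasure D (R n))
  exists_bound : ∃ C, ∀ n φ, |G n φ| ≤ C

theorem IsBddFamily.integrable [NeZero D] (ht : IsTheory L R Λ h 𝓛) {G : ∀ n, Field D (R n) → ℝ}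
    (hG : IsBddFamily G) (n : ℕ) : Integrable (G n) (gibbs (Y n) (Λ n) h (𝓛 n)) := by
  have := isProbabilityMeasure_gibbs (Λ := Λ n) (ht.radius_pos n) ht.regulator (ht.lagrangian n)
    (Y n)
  obtain ⟨C, hC⟩ := hG.exists_bound
  exact Integrable.of_bound ((hG.aestronglyMeasurable n).mono_ac
    (gibbs_absolutelyContinuous (Y n))) C (Eventually.of_forall (hC n))

theorem IsBddFamily.exists_expect_bound {G : ∀ n, Field D (R n) → ℝ} (hG : IsBddFamily G) :
    ∃ C, ∀ n, |expect (Y n) (Λ n) h (𝓛 n) (G n)| ≤ C := by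
  obtain ⟨C, hC⟩ := hG.exists_bound
  exact ⟨C, fun n => abs_expect_le _ _ _ _ _ (hC n)⟩

theorem limExpect_add [NeZero D] (ht : IsTheory L R Λ h 𝓛) {G G' : ∀ n, Field D (R n) → ℝ}
    (hG : IsBddFamily G) (hG' : IsBddFamily G') :
    limExpect L Y Λ h 𝓛 (fun n φ => G n φ + G' n φ) =
      limExpect L Y Λ h 𝓛 G + limExpect L Y Λ h 𝓛 G' := by
  obtain ⟨C, hC⟩ := hG.exists_expect_bound (Y := Y) (Λ := Λ) (h := h) (𝓛 := 𝓛)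
  obtain ⟨C', hC'⟩ := hG'.exists_expect_bound (Y := Y) (Λ := Λ) (h := h) (𝓛 := 𝓛)
  simp only [limExpect_eq_genLim]
  rw [← genLim_add hC hC']
  congr 1
  funext n
  simp only [expect_eq_integral]
  exact integral_add (hG.integrable ht n) (hG'.integrable ht n)

theorem limExpect_const_mul {G : ∀ n, Field D (R n) → ℝ} (hG : IsBddFamily G) (c : ℝ) :
    limExpect L Y Λ h 𝓛 (fun n φ => c * G n φ) = c * limExpect L Y Λ h 𝓛 G := by
  obtain ⟨C, hC⟩ := hG.exists_expect_bound (Y := Y) (Λ := Λ) (h := h) (𝓛 := 𝓛)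
  simp only [limExpect_eq_genLim]
  rw [← genLim_const_mul hC]
  congr 1
  funext n
  simp only [expect_eq_integral]
  exact integral_const_mul _ _

theorem limExpect_nonneg (ht : IsTheory L R Λ h 𝓛) {G : ∀ n, Field D (R n) → ℝ}
    (hG : IsBddFamily G) (h0 : ∀ n φ, 0 ≤ G n φ) : 0 ≤ limExpect L Y Λ h 𝓛 G := by
  obtain ⟨C, hC⟩ := hG.exists_expect_bound (Y := Y) (Λ := Λ) (h := h) (𝓛 := 𝓛)
  refine genLim_nonneg ht.generalizedLimit hC fun n => ?_
  rw [expect_eq_integral]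
  exact integral_nonneg (h0 n)

theorem limExpect_one [NeZero D] (ht : IsTheory L R Λ h 𝓛) :
    limExpect L Y Λ h 𝓛 (fun _ _ => 1) = 1 := by
  refine genLim_eq_of_tendsto ht.generalizedLimit (C := 1) (fun n =>
    abs_expect_le _ _ _ _ _ fun φ => by simp) (tendsto_const_nhds.congr fun n => ?_)
  have := isProbabilityMeasure_gibbs (Λ := Λ n) (ht.radius_pos n) ht.regulator (ht.lagrangian n)
    (Y n)
  rw [expect_eq_integral]
  simp

theorem measurable_breve {r : ℝ} (Y : HarmonicBasis D r) {m : ℕ} (f : Fin m → Test D)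
    (F : (Fin m → ℝ) →ᵇ ℝ) : Measurable (breve Y f F) :=
  F.continuous.measurable.comp (measurable_pi_lambda _ fun _ => measurable_pair Y _)

theorem isBddFamily_breve {m : ℕ} (f : Fin m → Test D) (F : (Fin m → ℝ) →ᵇ ℝ) :
    IsBddFamily fun n => breve (Y n) f F :=
  ⟨fun n => (measurable_breve (Y n) f F).aestronglyMeasurable,
    ‖F‖, fun _ _ => F.norm_coe_le_norm _⟩

theorem limExpect_congr_ae (G G' : ∀ n, Field D (R n) → ℝ)
    (hGG' : ∀ n, G n =ᵐ[freeMeasure D (R n)] G' n) :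
    limExpect L Y Λ h 𝓛 G = limExpect L Y Λ h 𝓛 G' := by
  simp only [limExpect_eq_genLim]
  congr 1
  funext n
  rw [expect_eq_integral, expect_eq_integral]
  exact integral_congr_ae ((gibbs_absolutelyContinuous (Y n)).ae_le (hGG' n))

variable {K : Type*} [TopologicalSpace K] {ι : Distr D → K}

/-- The fields of the regularized theories as points of the compactification. -/
theorem IsCylCompactification.exists_fieldPoint [NeZero D] (hι : IsCylCompactification ι)
    (hR : ∀ n, 0 < R n) (Y : ∀ n, HarmonicBasis D (R n)) :
    ∃ κ : ∀ n, Field D (R n) → K, ∀ n φ, IsTempered φ → ∀ (m : ℕ) (f : Fin m → Test D)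
      (F : (Fin m → ℝ) →ᵇ ℝ) (Φ : C(K, ℝ)), (∀ T, Φ (ι T) = cyl f F T) →
        Φ (κ n φ) = breve (Y n) f F φ := by
  classical
  refine ⟨fun n φ => if hφ : IsTempered φ then
    (hι.exists_point (fieldFunctional (hR n) (Y n) hφ)).choose else ι 0, fun n φ hφ => ?_⟩
  simp only [dif_pos hφ]
  exact (hι.exists_point (fieldFunctional (hR n) (Y n) hφ)).choose_spec

/-- Measurability is clear almost everywhere for extensions of cylindrical functions. It passes to
all continuous functions, which are uniform limits of sequences of these. -/
theorem isBddFamily_comp_fieldPoint [NeZero D] (hι : IsCylCompactification ι)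
    (hR : ∀ n, 0 < R n) {κ : ∀ n, Field D (R n) → K}
    (hκ : ∀ n φ, IsTempered φ → ∀ (m : ℕ) (f : Fin m → Test D)
      (F : (Fin m → ℝ) →ᵇ ℝ) (Φ : C(K, ℝ)), (∀ T, Φ (ι T) = cyl f F T) →
        Φ (κ n φ) = breve (Y n) f F φ) (Φ : C(K, ℝ)) : IsBddFamily fun n φ => Φ (κ n φ) := by
  have := hι.compactSpace
  refine ⟨fun n => ?_, ‖Φ‖, fun n φ => Φ.norm_coe_le_norm _⟩
  obtain ⟨Ψ, hΨ, hlim⟩ := mem_closure_iff_seq_limit.1 (hι.dense_cylSubalgebra Φ)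
  refine aestronglyMeasurable_of_tendsto_ae atTop (f := fun k φ => Ψ k (κ n φ)) (fun k => ?_)
    (Eventually.of_forall fun φ => ?_)
  · obtain ⟨m, f, F, h⟩ := hΨ k
    refine (measurable_breve (Y n) f F).aestronglyMeasurable.congr ?_
    filter_upwards [ae_isTempered (hR n)] with φ hφ
    exact (hκ n φ hφ m f F (Ψ k) (congrFun h)).symm
  · exact ((continuous_eval_const (F := C(K, ℝ)) (κ n φ)).tendsto Φ).comp hlim

/-- Riesz-Markov-Kakutani for the positive functional obtained by evaluating continuous functions at
the points that represent the fields. For a cylindrical function these evaluations are `breve`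
almost surely. -/
theorem exists_represents [NeZero D] [MeasurableSpace K] [BorelSpace K]
    (hι : IsCylCompactification ι) (ht : IsTheory L R Λ h 𝓛) (Y : ∀ n, HarmonicBasis D (R n)) :
    ∃ μ : Measure K, Represents ι μ L Y Λ h 𝓛 := by
  have := hι.compactSpace
  have := hι.t2Space
  obtain ⟨κ, hκ⟩ := hι.exists_fieldPoint ht.radius_pos Y
  have hfam := isBddFamily_comp_fieldPoint hι ht.radius_pos hκ
  let J : CompactlySupportedContinuousMap K ℝ →ₗ[ℝ] ℝ :=
    { toFun := fun Φ => limExpect L Y Λ h 𝓛 fun n φ => Φ (κ n φ)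
      map_add' := fun Φ Ψ => limExpect_add ht (hfam Φ.toContinuousMap) (hfam Ψ.toContinuousMap)
      map_smul' := fun c Φ => limExpect_const_mul (hfam Φ.toContinuousMap) c }
  let J' : CompactlySupportedContinuousMap K ℝ →ₚ[ℝ] ℝ := PositiveLinearMap.mk₀ J fun Φ hΦ =>
    limExpect_nonneg ht (hfam Φ.toContinuousMap) fun n φ => hΦ _
  have hJ : ∀ Φ : C(K, ℝ), ∫ x, Φ x ∂(RealRMK.rieszMeasure J') =
      limExpect L Y Λ h 𝓛 fun n φ => Φ (κ n φ) := fun Φ =>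
    RealRMK.integral_rieszMeasure J' (CompactlySupportedContinuousMap.continuousMapEquiv Φ)
  have hfin : IsFiniteMeasure (RealRMK.rieszMeasure J') := inferInstance
  refine ⟨RealRMK.rieszMeasure J', ?_, inferInstance, fun m f F Φ hΦ => ?_⟩
  · have h1 := hJ 1
    rw [show (fun n φ => (1 : C(K, ℝ)) (κ n φ)) = fun n (φ : Field D (R n)) => (1 : ℝ) from rfl,
      limExpect_one ht] at h1
    simp only [ContinuousMap.one_apply, integral_const, smul_eq_mul, mul_one] at h1
    refine ⟨?_⟩
    rw [← ENNReal.toReal_eq_one_iff]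
    exact h1
  · rw [hJ]
    exact limExpect_congr_ae _ _ fun n => (ae_isTempered (ht.radius_pos n)).mono
      fun φ hφ => hκ n φ hφ m f F Φ hΦ

theorem existsUnique_represents [NeZero D] [MeasurableSpace K] [BorelSpace K]
    (hι : IsCylCompactification ι) (ht : IsTheory L R Λ h 𝓛) (Y : ∀ n, HarmonicBasis D (R n)) :
    ∃! μ : Measure K, Represents ι μ L Y Λ h 𝓛 := by
  obtain ⟨μ, hμ⟩ := exists_represents hι ht Y
  refine ⟨μ, hμ, fun ν hν => ?_⟩
  have := hμ.isProbabilityMeasure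
  have := hν.isProbabilityMeasure
  have := hμ.regular
  have := hν.regular
  refine hι.measure_ext fun Φ ⟨m, f, F, hΦ⟩ => ?_
  rw [hν.integral_eq m f F Φ (congrFun hΦ), hμ.integral_eq m f F Φ (congrFun hΦ)]

end

end

section

/-! ### Rotations -/

section

variable {R : ℝ}

/-- The point `(x, y)` of `ℝ^D × ℝ`. -/
def joinVec (x : Space D) (y : ℝ) : Ambient D :=
  WithLp.toLp 2 (Fin.snoc (α := fun _ => ℝ) (fun i => x i) y)

@[simp] theorem joinVec_castSucc (x : Space D) (y : ℝ) (i : Fin D) :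
    joinVec x y i.castSucc = x i := by simp [joinVec]

@[simp] theorem joinVec_last (x : Space D) (y : ℝ) : joinVec x y (Fin.last D) = y := by
  simp [joinVec]

@[simp] theorem horiz_apply (v : Ambient D) (i : Fin D) : horiz v i = v i.castSucc := rfl

@[simp] theorem horiz_joinVec (x : Space D) (y : ℝ) : horiz (joinVec x y) = x := by
  ext i
  simp

theorem joinVec_horiz (v : Ambient D) : joinVec (horiz v) (v (Fin.last D)) = v := by
  ext i
  refine Fin.lastCases ?_ (fun i => ?_) i <;> simp

theorem ambient_ext {v w : Ambient D} (h : horiz v = horiz w)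
    (hl : v (Fin.last D) = w (Fin.last D)) : v = w := by
  rw [← joinVec_horiz v, ← joinVec_horiz w, h, hl]

/-- The isometry `O ⊕ 1` of `ℝ^D × ℝ`. -/
def suspend (O : Space D ≃ₗᵢ[ℝ] Space D) : Ambient D ≃ₗᵢ[ℝ] Ambient D where
  toFun v := joinVec (O (horiz v)) (v (Fin.last D))
  invFun v := joinVec (O.symm (horiz v)) (v (Fin.last D))
  left_inv v := by simp [joinVec_horiz]
  right_inv v := by simp [joinVec_horiz]
  map_add' v w := by
    refine ambient_ext ?_ (by simp)
    have : horiz (v + w) = horiz v + horiz w := rfl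
    rw [horiz_joinVec, this, map_add]
    ext i
    simp
  map_smul' c v := by
    refine ambient_ext ?_ (by simp)
    have : horiz (c • v) = c • horiz v := rfl
    rw [horiz_joinVec, this, map_smul]
    ext i
    simp
  norm_map' v := by
    show ‖joinVec (O (horiz v)) (v (Fin.last D))‖ = ‖v‖
    refine (sq_eq_sq₀ (norm_nonneg _) (norm_nonneg _)).1 ?_
    rw [norm_sq_horiz_add, norm_sq_horiz_add v, horiz_joinVec, joinVec_last, O.norm_map]

theorem horiz_sphereIso_suspend (R : ℝ) (O : Space D ≃ₗᵢ[ℝ] Space D) (v : Ambient D) :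
    horiz (sphereIso R (suspend O) v) = O (horiz v) := by
  have h1 : horiz (v - center D R) = horiz v := by
    ext i
    simp [center, Fin.castSucc_ne_last]
  have h2 : suspend O (v - center D R) =
      joinVec (O (horiz (v - center D R))) ((v - center D R) (Fin.last D)) := rfl
  ext i
  rw [sphereIso, h2, h1]
  simp [center, Fin.castSucc_ne_last]

theorem sphereIso_suspend_last (R : ℝ) (O : Space D ≃ₗᵢ[ℝ] Space D) (v : Ambient D) :
    sphereIso R (suspend O) v (Fin.last D) = v (Fin.last D) := by
  have h2 : suspend O (v - center D R) =
      joinVec (O (horiz (v - center D R))) ((v - center D R) (Fin.last D)) := rfl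
  rw [sphereIso, h2]
  simp

theorem pull_eq_pull (R : ℝ) {f f' : Space D → ℝ} {v w : Ambient D}
    (h : v (Fin.last D) = w (Fin.last D))
    (hf : ∀ c : ℝ, f (c • horiz v) = f' (c • horiz w)) : pull R f v = pull R f' w := by
  have hs : ∀ u : Ambient D, stereo R u = (2 * R / (2 * R - u (Fin.last D))) • horiz u :=
    fun u => by
      ext i
      simp [stereo]
  rw [pull, pull, h, hs, hs, hf, h]

theorem move_apply (E : Space D ≃ᵃⁱ[ℝ] Space D) (f : Test D) (x : Space D) :
    move E f x = f (E.symm x) := rfl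

theorem breve_rotField [NeZero D] (hR : 0 < R) (Y : HarmonicBasis D R) {φ : Field D R}
    (hφ : IsTempered φ) (A : Ambient D ≃ₗᵢ[ℝ] Ambient D) {m : ℕ} {f f' : Fin m → Test D}
    (F : (Fin m → ℝ) →ᵇ ℝ) (hA : ∀ i, ∀ v ∈ Metric.sphere (center D R) R,
      pull R (f' i) v = pull R (f i) (sphereIso R A v)) :
    breve Y f F (rotField hR Y A φ) = breve Y f' F φ := by
  rw [breve, breve]
  congr 1
  funext i
  obtain ⟨U, hU, hUe, -⟩ := exists_pull_test_ext hR (f i)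
  rw [pair_congr hR Y _ hUe, pair_rotField hR Y A hφ hU]
  exact pair_congr hR Y _ fun v hv => by rw [hA i v hv, hUe _ (sphereIso_mem A hv)]

end

section

variable {L : StrongDual ℝ (lp (fun _ : ℕ => ℝ) ∞)} {R Λ : ℕ → ℝ} {h : Space D → ℝ}
  {N : ℕ → ℕ} {𝓛 : ∀ n, (Fin (N n + 1) → ℝ) → ℝ} {Y : ∀ n, HarmonicBasis D (R n)}
  {K : Type*} [TopologicalSpace K] [MeasurableSpace K] {ι : Distr D → K} {μ : Measure K}

/-- The isometry `O ⊕ 1` preserves heights and so commutes with stereographic projection. The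
invariance already holds exactly for each regularized theory. The inverse of `O` appears because
test functions are moved by `E⁻¹`. -/
theorem Represents.invariantUnder_linear [NeZero D] (ht : IsTheory L R Λ h 𝓛)
    (hμ : Represents ι μ L Y Λ h 𝓛) (O : Space D ≃ₗᵢ[ℝ] Space D) :
    InvariantUnder ι μ O.toAffineIsometryEquiv := by
  intro m f F Φ Φ' hΦ hΦ'
  rw [hμ.integral_eq m f F Φ hΦ, hμ.integral_eq m _ F Φ' hΦ', limExpect_eq_genLim,
    limExpect_eq_genLim]
  congr 1
  funext n
  have hR := ht.radius_pos n
  rw [← expect_comp_rotField hR (ht.cutoff_pos n) ht.regulator (ht.lagrangian n) (Y n)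
    (suspend O.symm) (measurable_breve (Y n) f F), expect_eq_integral, expect_eq_integral]
  refine integral_congr_ae ((gibbs_absolutelyContinuous (Y n)).ae_le ?_)
  filter_upwards [ae_isTempered hR] with φ hφ
  refine (breve_rotField hR (Y n) hφ (suspend O.symm) F fun i v hv => ?_).symm
  refine pull_eq_pull (R n) (sphereIso_suspend_last (R n) O.symm v).symm fun c => ?_
  rw [horiz_sphereIso_suspend, ← map_smul]
  rfl

/-! ### Reflection positivity -/

theorem theta_symm_apply [NeZero D] (x : Space D) : (theta D).symm x =
    x - (2 * x (lastIdx D)) • (EuclideanSpace.single (lastIdx D) (1 : ℝ) : Space D) := by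
  have h : (theta D).symm x = Submodule.reflection
    (ℝ ∙ (EuclideanSpace.single (lastIdx D) (1 : ℝ) : Space D))ᗮ x := rfl
  rw [h, Submodule.reflection_orthogonal_apply, Submodule.reflection_singleton_apply]
  simp [EuclideanSpace.inner_single_left, two_smul, two_mul, add_smul]

theorem pull_move_theta [NeZero D] (r : ℝ) (f : Test D) (v : Ambient D) :
    pull r (move (theta D) f) v = pull r f (sphereIso r (flip (lastIdx D)) v) := by
  refine pull_eq_pull r ?_ fun c => ?_
  · rw [sphereIso_flip]
    simp [(Fin.castSucc_ne_last _).symm]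
  · rw [move_apply, theta_symm_apply]
    congr 1
    ext i
    rw [sphereIso_flip]
    simp only [PiLp.smul_apply, PiLp.sub_apply, PiLp.single_apply, horiz_apply, smul_eq_mul,
      Fin.castSucc_inj]
    split_ifs <;> ring

theorem isPosCyl_breve [NeZero D] {r : ℝ} (hr : 0 < r) (Y : HarmonicBasis D r) (j : Fin D)
    {m : ℕ} {f : Fin m → Test D} (F : (Fin m → ℝ) →ᵇ ℝ)
    (hf : ∀ i, tsupport (f i) ⊆ {x | 0 < x j}) : IsPosCyl Y j (breve Y f F) := by
  choose U hU hUe hUp using fun i => exists_pull_test_ext hr (f i)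
  refine ⟨Fin m, inferInstance, U, F, ‖F‖, hU, fun i v hv => ?_, F.continuous.measurable,
    F.norm_coe_le_norm, fun φ => ?_⟩
  · by_contra hc
    obtain ⟨c, hc0, hc⟩ := hUp i v hc
    have h1 : 0 < (c • horiz v) j := hf i (subset_tsupport _ hc)
    rw [PiLp.smul_apply, horiz_apply, smul_eq_mul] at h1
    exact absurd h1 (not_lt.2 (mul_nonpos_of_nonneg_of_nonpos hc0.le hv))
  · rw [breve]
    congr 1
    funext i
    exact pair_congr hr Y φ (hUe i)

theorem Represents.reflectionPositive [NeZero D] [OpensMeasurableSpace K]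
    (ht : IsTheory L R Λ h 𝓛)
    (hRlim : Tendsto R atTop atTop) (hμ : Represents ι μ L Y Λ h 𝓛)
    (hlim : Tendsto (fun n => lagrangianSup (𝓛 n) * R n ^ D / Λ n) atTop (𝓝 0)) :
    ReflectionPositive ι μ := by
  intro m f F Φ Φ' hf hΦ hΦ'
  -- The product of a cylindrical function with its reflection is again cylindrical, over the
  -- concatenated list of test functions.
  have h1 := hμ.integral_eq (m + m) (Fin.append f fun i => move (theta D) (f i))
    (extendLeft F * extendRight F) (Φ * Φ') fun T => by
      rw [cyl_mul_cyl, ← hΦ, ← hΦ', ContinuousMap.mul_apply]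
  simp only [ContinuousMap.mul_apply] at h1
  rw [h1, limExpect_congr_ae _ (fun n φ => breve (Y n) f F φ *
    breve (Y n) f F (rotField (ht.radius_pos n) (Y n) (flip (lastIdx D)) φ)) fun n => ?_]
  swap
  · filter_upwards [ae_isTempered (ht.radius_pos n)] with φ hφ
    rw [breve_rotField (ht.radius_pos n) (Y n) hφ (flip (lastIdx D)) F
      fun i v _ => pull_move_theta (R n) (f i) v]
    rw [breve, BoundedContinuousFunction.mul_apply, extendLeft_apply, extendRight_apply]
    simp only [Fin.append_left, Fin.append_right]
    rfl
  obtain ⟨B, hB, hB'⟩ := exists_radius ht.regulator.hasCompactSupport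
  set e : ℕ → ℝ := fun n => ‖F‖ ^ 2 * (Real.exp (lagrangianSup (𝓛 n) *
      (surface D (R n)).real {v | |v (lastIdx D).castSucc| ≤ 2 * B / Λ n}) - 1) with he
  have hle : ∀ n, -e n ≤ expect (Y n) (Λ n) h (𝓛 n) fun φ => breve (Y n) f F φ *
      breve (Y n) f F (rotField (ht.radius_pos n) (Y n) (flip (lastIdx D)) φ) := fun n =>
    neg_le_expect_reflection (ht.radius_pos n) (ht.cutoff_pos n) ht.regulator (ht.lagrangian n)
      (Y n) (lastIdx D) hB hB' (isPosCyl_breve (ht.radius_pos n) (Y n) (lastIdx D) F hf)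
      fun φ => F.norm_coe_le_norm _
  have hvol : ∀ᶠ n in atTop, lagrangianSup (𝓛 n) *
      (surface D (R n)).real {v | |v (lastIdx D).castSucc| ≤ 2 * B / Λ n} ≤
      ((D + 1) * 2 ^ (D + 1) * (2 * B)) * (lagrangianSup (𝓛 n) * R n ^ D / Λ n) := by
    -- The strip estimate carries an extra factor `1 / R`, which is dropped once `R ≥ 1` to match
    -- the hypothesis.
    filter_upwards [hRlim.eventually_ge_atTop 1] with n hn
    have h2 := surface_strip_le (D := D) (ht.radius_pos n) (2 * B / Λ n) (lastIdx D)
    have h3 : surface D (R n) {v | |v (lastIdx D).castSucc| ≤ 2 * B / Λ n} =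
        surface D (R n) {v | v ∈ Metric.sphere (center D (R n)) (R n) ∧
          |v (lastIdx D).castSucc| ≤ 2 * B / Λ n} := by
      refine measure_congr ?_
      filter_upwards [ae_mem_sphere (D := D) (ht.radius_pos n)] with v hv
      exact propext ⟨fun h => ⟨hv, h⟩, fun h => h.2⟩
    have hΛ := ht.cutoff_pos n
    have hR := ht.radius_pos n
    have h4 : (surface D (R n)).real {v | |v (lastIdx D).castSucc| ≤ 2 * B / Λ n} ≤
        (D + 1) * 2 ^ (D + 1) * (R n ^ D * (2 * B / Λ n)) := by
      refine ENNReal.toReal_le_of_le_ofReal (by positivity) (h3 ▸ h2.trans ?_)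
      refine ENNReal.ofReal_le_ofReal ?_
      gcongr
      exact div_le_self (by positivity) hn
    refine (mul_le_mul_of_nonneg_left h4 (ht.lagrangian n).lagrangianSup_nonneg).trans
      (le_of_eq ?_)
    field_simp
  have hvol0 : Tendsto (fun n => lagrangianSup (𝓛 n) *
      (surface D (R n)).real {v | |v (lastIdx D).castSucc| ≤ 2 * B / Λ n}) atTop (𝓝 0) := by
    refine squeeze_zero' (Eventually.of_forall fun n =>
      mul_nonneg (ht.lagrangian n).lagrangianSup_nonneg measureReal_nonneg) hvol ?_
    simpa using hlim.const_mul ((D + 1) * 2 ^ (D + 1) * (2 * B))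
  have he0 : Tendsto e atTop (𝓝 0) := by
    have := ((Real.continuous_exp.tendsto 0).comp hvol0).sub_const 1
    simpa using this.const_mul (‖F‖ ^ 2)
  have hbd : ∀ n, |expect (Y n) (Λ n) h (𝓛 n) fun φ => breve (Y n) f F φ *
      breve (Y n) f F (rotField (ht.radius_pos n) (Y n) (flip (lastIdx D)) φ)| ≤ ‖F‖ * ‖F‖ :=
    fun n => abs_expect_le _ _ _ _ _ fun φ => by
      rw [abs_mul]
      exact mul_le_mul (F.norm_coe_le_norm _) (F.norm_coe_le_norm _) (abs_nonneg _)
        (norm_nonneg _)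
  obtain ⟨C, hC⟩ := he0.abs.bddAbove_range
  have hC' : ∀ n, |-e n| ≤ C := fun n => by
    rw [abs_neg]
    exact hC ⟨n, rfl⟩
  refine (genLim_eq_of_tendsto ht.generalizedLimit hC' (x := 0) (by simpa using he0.neg)).ge.trans ?_
  exact genLim_mono_of_eventually ht.generalizedLimit hC' hbd (Eventually.of_forall hle)

end

end

section

/-! ### Fields of finite Sobolev norm -/

section

variable {R : ℝ}

/-- Cauchy-Schwarz between the weights `(eig + 1)^(-k)` and `(eig + 1)^(2j)`. Their product is at
least 1, as `eig + 1 ≥ 1` and `k ≤ 2j`. -/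
theorem abs_pair_le_of_sobolevNorm_le [NeZero D] (hR : 0 < R) (Y : HarmonicBasis D R)
    {U : Ambient D → ℝ} (hU : ContDiff ℝ ∞ U) {k : ℝ} {j : ℕ} (hj : k ≤ 2 * j) {φ : Field D R}
    {M : ℝ} (hM : 0 ≤ M) (hφ : sobolevNorm k φ ≤ ENNReal.ofReal M) :
    |pair Y φ U| ≤ M * √(∫ v, ((oneSubLap (1 / (2 * R)))^[j] U v) ^ 2 ∂surface D R) := by
  have hw : ∀ i : Modes D R, 1 ≤ eig D R i.1 + 1 := fun i => one_le_eig_add_one R i.1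
  have hw0 : ∀ i : Modes D R, 0 < eig D R i.1 + 1 := fun i => eig_add_one_pos R i.1
  have hnn : ∀ i : Modes D R, 0 ≤ (eig D R i.1 + 1) ^ (-k) * φ i ^ 2 := fun i =>
    mul_nonneg (Real.rpow_nonneg (hw0 i).le _) (sq_nonneg _)
  have htop : ∑' i : Modes D R, ENNReal.ofReal ((eig D R i.1 + 1) ^ (-k) * φ i ^ 2) ≤
      ENNReal.ofReal (M ^ 2) := by
    rw [sobolevNorm, one_div, ENNReal.rpow_inv_le_iff two_pos] at hφ
    refine hφ.trans (le_of_eq ?_)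
    rw [ENNReal.ofReal_rpow_of_nonneg hM (by norm_num), Real.rpow_two]
  have hsum : Summable fun i : Modes D R => (eig D R i.1 + 1) ^ (-k) * φ i ^ 2 := by
    have := ENNReal.summable_toReal (ne_top_of_le_ne_top ENNReal.ofReal_ne_top htop)
    exact this.congr fun i => ENNReal.toReal_ofReal (hnn i)
  have hA : ∑' i : Modes D R, (eig D R i.1 + 1) ^ (-k) * φ i ^ 2 ≤ M ^ 2 := by
    rw [← ENNReal.ofReal_tsum_of_nonneg hnn hsum] at htop
    exact (ENNReal.ofReal_le_ofReal_iff (sq_nonneg M)).1 htop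
  have hB := hasSum_coeff_sq hR Y hU j
  set f : Modes D R → ℝ := fun i => √((eig D R i.1 + 1) ^ (-k)) * |φ i| with hf
  set g : Modes D R → ℝ := fun i => (eig D R i.1 + 1) ^ j * |coeff Y U i| with hg
  have hf2 : ∀ i, f i ^ (2 : ℝ) = (eig D R i.1 + 1) ^ (-k) * φ i ^ 2 := fun i => by
    rw [Real.rpow_two, hf, mul_pow, Real.sq_sqrt (Real.rpow_nonneg (hw0 i).le _), sq_abs]
  have hg2 : ∀ i, g i ^ (2 : ℝ) = (eig D R i.1 + 1) ^ (2 * j) * coeff Y U i ^ 2 := fun i => by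
    rw [Real.rpow_two, hg, mul_pow, sq_abs, ← pow_mul, mul_comm j]
  have h := Real.summable_and_inner_le_Lp_mul_Lq_tsum_of_nonneg Real.HolderConjugate.two_two
    (f := f) (g := g) (fun i => by positivity)
    (fun i => mul_nonneg (pow_nonneg (hw0 i).le _) (abs_nonneg _))
    (by simpa only [hf2] using hsum) (by simpa only [hg2] using hB.summable)
  simp only [hf2, hg2, hB.tsum_eq] at h
  rw [← Real.sqrt_eq_rpow, ← Real.sqrt_eq_rpow] at h
  have hle : ∀ i, ‖φ i * coeff Y U i‖ ≤ f i * g i := fun i => by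
    have h1 : 1 ≤ √((eig D R i.1 + 1) ^ (-k)) * (eig D R i.1 + 1) ^ j := by
      rw [Real.sqrt_eq_rpow, ← Real.rpow_mul (hw0 i).le, ← Real.rpow_natCast,
        ← Real.rpow_add (hw0 i)]
      exact Real.one_le_rpow (hw i) (by linarith)
    rw [norm_mul, Real.norm_eq_abs, Real.norm_eq_abs]
    calc |φ i| * |coeff Y U i| = 1 * (|φ i| * |coeff Y U i|) := (one_mul _).symm
      _ ≤ √((eig D R i.1 + 1) ^ (-k)) * (eig D R i.1 + 1) ^ j * (|φ i| * |coeff Y U i|) :=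
        mul_le_mul_of_nonneg_right h1 (by positivity)
      _ = f i * g i := by rw [hf, hg]; ring
  rw [pair, ← Real.norm_eq_abs]
  refine (tsum_of_norm_bounded h.1.hasSum hle).trans (h.2.trans ?_)
  refine mul_le_mul_of_nonneg_right ?_ (Real.sqrt_nonneg _)
  exact Real.sqrt_le_iff.2 ⟨hM, hA⟩

/-- Differential operators do not enlarge the support, and the part of the sphere within the
cylinder of radius `C` around the vertical axis has area bounded independently of `R`. -/
theorem integral_oneSubLap_sq_le (hR : 0 < R) {U : Ambient D → ℝ} {C : ℝ}
    (hUC : ∀ v, U v ≠ 0 → ‖v‖ ≤ C) (ε : ℝ) (j : ℕ) {s : ℝ}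
    (hs : ∀ v, ‖v‖ ≤ C → |(oneSubLap ε)^[j] U v| ≤ s) :
    ∫ v, ((oneSubLap ε)^[j] U v) ^ 2 ∂surface D R ≤ s ^ 2 * (2 * (D + 1) * |2 * C| ^ D) := by
  set S : Set (Ambient D) :=
    {v | v ∈ Metric.sphere (center D R) R ∧ ∀ i : Fin D, |v i.castSucc| ≤ C} with hS
  have hSm : MeasurableSet S := by
    have h1 : MeasurableSet {v : Ambient D | ∀ i : Fin D, |v i.castSucc| ≤ C} :=
      measurableSet_setOfPred.2 (Measurable.forall fun i => measurableSet_setOfPred.1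
        (isClosed_le (f := fun v : Ambient D => |v i.castSucc|) (by fun_prop)
          continuous_const).measurableSet)
    exact (Metric.isClosed_sphere (x := center D R) (ε := R)).measurableSet.inter h1
  have hts : tsupport ((oneSubLap ε)^[j] U) ⊆ Metric.closedBall 0 C := by
    refine (tsupport_oneSubLap_iterate_subset U ε j).trans
      (closure_minimal (fun v hv => ?_) Metric.isClosed_closedBall)
    exact mem_closedBall_zero_iff.2 (hUC v hv)
  have hle : ∀ᵐ v ∂surface D R, ((oneSubLap ε)^[j] U v) ^ 2 ≤ S.indicator (fun _ => s ^ 2) v := by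
    filter_upwards [ae_mem_sphere (D := D) hR] with v hv
    by_cases h0 : (oneSubLap ε)^[j] U v = 0
    · rw [h0, zero_pow two_ne_zero]
      exact Set.indicator_nonneg (fun _ _ => sq_nonneg s) v
    · have hvC := mem_closedBall_zero_iff.1 (hts (subset_tsupport _ h0))
      have hvS : v ∈ S := ⟨hv, fun i => (PiLp.norm_apply_le v i.castSucc).trans hvC⟩
      rw [Set.indicator_of_mem hvS, ← sq_abs]
      exact pow_le_pow_left₀ (abs_nonneg _) (hs v hvC) 2
  refine (integral_mono_of_nonneg (Eventually.of_forall fun v => sq_nonneg _)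
    ((integrable_const _).indicator hSm) hle).trans ?_
  rw [integral_indicator_const _ hSm, smul_eq_mul, mul_comm]
  refine mul_le_mul_of_nonneg_left ?_ (sq_nonneg s)
  refine ENNReal.toReal_le_of_le_ofReal (by positivity) ((surface_axis_le hR C).trans ?_)
  refine ENNReal.ofReal_le_ofReal ?_
  rw [← abs_pow]
  gcongr
  exact le_abs_self _

theorem exists_pair_bound_of_jointSmooth [NeZero D] {V : ℝ → Ambient D → ℝ} (hV : JointSmooth V)
    {ε₀ C : ℝ} (hVC : ∀ ε, 0 < ε → ε ≤ ε₀ → ∀ v, V ε v ≠ 0 → ‖v‖ ≤ C) (k : ℝ) :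
    ∃ c : ℝ, 0 ≤ c ∧ ∀ {R : ℝ} (_ : 0 < R) (_ : 1 / (2 * R) ≤ ε₀) (Y : HarmonicBasis D R)
      (φ : Field D R) (M : ℝ), 0 ≤ M → sobolevNorm k φ ≤ ENNReal.ofReal M →
        |pair Y φ (V (1 / (2 * R)))| ≤ M * c := by
  obtain ⟨j, hj⟩ := exists_nat_ge (k / 2)
  have hG := hV.oneSubLap_iterate j
  obtain ⟨s, hs⟩ := (isCompact_Icc.prod (isCompact_closedBall (0 : Ambient D)
    C)).exists_bound_of_continuousOn (s := Set.Icc 0 ε₀ ×ˢ Metric.closedBall 0 C)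
    (f := fun p : ℝ × Ambient D => (oneSubLap p.1)^[j] (V p.1) p.2) hG.continuous.continuousOn
  refine ⟨√(s ^ 2 * (2 * (D + 1) * |2 * C| ^ D)), Real.sqrt_nonneg _,
    fun {R} hR hε Y φ M hM hφ => ?_⟩
  have hε0 : 0 < 1 / (2 * R) := by positivity
  refine (abs_pair_le_of_sobolevNorm_le hR Y (hV.slice _) (j := j) (by linarith) hM hφ).trans ?_
  refine mul_le_mul_of_nonneg_left (Real.sqrt_le_sqrt ?_) hM
  exact integral_oneSubLap_sq_le hR (hVC _ hε0 hε) _ j fun v hv =>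
    hs (1 / (2 * R), v) ⟨⟨hε0.le, hε⟩, mem_closedBall_zero_iff.2 hv⟩

theorem eventually_pair_le_of_jointSmooth [NeZero D] {V : ℝ → Ambient D → ℝ} (hV : JointSmooth V)
    (hV0 : ∀ v, V 0 v = 0) {ε₀ C : ℝ} (hε₀ : 0 < ε₀)
    (hVC : ∀ ε, 0 < ε → ε ≤ ε₀ → ∀ v, V ε v ≠ 0 → ‖v‖ ≤ C) (k : ℝ)
    {η : ℝ} (hη : 0 < η) :
    ∀ᶠ R : ℝ in atTop, ∀ (Y : HarmonicBasis D R)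
      (φ : Field D R) (M : ℝ), 0 ≤ M → sobolevNorm k φ ≤ ENNReal.ofReal M →
        |pair Y φ (V (1 / (2 * R)))| ≤ M * η := by
  obtain ⟨j, hj⟩ := exists_nat_ge (k / 2)
  have hG := hV.oneSubLap_iterate j
  set K := 2 * ((D : ℝ) + 1) * |2 * C| ^ D with hK
  have hK0 : 0 ≤ K := by positivity
  set s := η / √(K + 1) with hs
  have hs0 : 0 < s := by positivity
  have hsK : √(s ^ 2 * K) ≤ η := by
    rw [Real.sqrt_mul (sq_nonneg s), Real.sqrt_sq hs0.le, hs, div_mul_eq_mul_div]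
    refine div_le_of_le_mul₀ (Real.sqrt_nonneg _) hη.le ?_
    gcongr
    linarith
  have hopen : IsOpen {p : ℝ × Ambient D | |(oneSubLap p.1)^[j] (V p.1) p.2| < s} :=
    isOpen_lt hG.continuous.abs continuous_const
  have hz : ∀ v, (oneSubLap 0)^[j] (V 0) v = 0 := by
    have h0 : V 0 = 0 := funext hV0
    rw [h0]
    intro v
    by_contra hc
    have := tsupport_oneSubLap_iterate_subset (0 : Ambient D → ℝ) 0 j (subset_tsupport _ hc)
    simp [tsupport] at this
  -- The tube lemma turns vanishing at `ε = 0` into uniform smallness over the compact ball for all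
  -- small `ε`.
  obtain ⟨u, w, hu, -, h0u, hCw, huw⟩ := generalized_tube_lemma (isCompact_singleton (x := (0 : ℝ)))
    (isCompact_closedBall (0 : Ambient D) C) hopen (by
      rintro ⟨ε, v⟩ ⟨rfl, -⟩
      show |(oneSubLap 0)^[j] (V 0) v| < s
      rw [hz, abs_zero]
      exact hs0)
  have hlim : Tendsto (fun R : ℝ => 1 / (2 * R)) atTop (𝓝 0) :=
    tendsto_const_nhds.div_atTop (tendsto_id.const_mul_atTop two_pos)
  filter_upwards [hlim.eventually (hu.mem_nhds (h0u rfl)), hlim.eventually (ge_mem_nhds hε₀),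
    eventually_gt_atTop 0] with R h1 h2 hR Y φ M hM hφ
  refine (abs_pair_le_of_sobolevNorm_le hR Y (hV.slice _) (j := j) (by linarith) hM hφ).trans ?_
  refine mul_le_mul_of_nonneg_left ((Real.sqrt_le_sqrt ?_).trans hsK) hM
  exact integral_oneSubLap_sq_le hR (hVC _ (by positivity) h2) _ j fun v hv =>
    (huw (Set.mk_mem_prod h1 (hCw (mem_closedBall_zero_iff.2 hv)))).le

end

/-! ### Extensions of test functions with uniform support -/

/-- A smooth extension of `f ∘ 𝔰` to the ambient space, smooth also in the curvature
`ε = 1 / (2R)` and compactly supported uniformly in `ε`. -/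
def localExt (f : Space D → ℝ) (ε : ℝ) (v : Ambient D) : ℝ :=
  Real.smoothTransition (2 - v (Fin.last D) ^ 2) * pullExt (1 / 2) f ε v

theorem jointSmooth_localExt {f : Space D → ℝ} (hf : ContDiff ℝ ∞ f) :
    JointSmooth (localExt f) := by
  refine ContDiff.mul (Real.smoothTransition.contDiff.comp ?_)
    (jointSmooth_pullExt (by norm_num) hf)
  fun_prop

theorem norm_le_of_localExt_ne_zero {f : Space D → ℝ} {B : ℝ} (hf : ∀ x, f x ≠ 0 → ‖x‖ ≤ B)
    {ε : ℝ} (hε : 0 < ε) (hε' : ε ≤ 1 / 4) {v : Ambient D} (h : localExt f ε v ≠ 0) :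
    ‖v‖ ≤ 2 * B + 2 := by
  have h1 : v (Fin.last D) ^ 2 < 2 := by
    by_contra! hc
    exact h (by rw [localExt, Real.smoothTransition.zero_of_nonpos (by linarith), zero_mul])
  have h2 : f ((1 - ε * v (Fin.last D))⁻¹ • horiz v) ≠ 0 := fun h0 =>
    h (by rw [localExt, pullExt, h0, mul_zero, mul_zero])
  obtain ⟨h3, h4⟩ := abs_lt_of_sq_lt_sq' (show v (Fin.last D) ^ 2 < 2 ^ 2 by linarith) two_pos.le
  have h5 : 0 < 1 - ε * v (Fin.last D) := by nlinarith
  have h6 : 1 - ε * v (Fin.last D) ≤ 2 := by nlinarith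
  have h7 := hf _ h2
  rw [norm_smul, Real.norm_eq_abs, abs_of_pos (inv_pos.2 h5), inv_mul_le_iff₀ h5] at h7
  have hB : 0 ≤ B := (norm_nonneg _).trans (hf _ h2)
  have h8 : ‖horiz v‖ ≤ 2 * B := h7.trans (mul_le_mul_of_nonneg_right h6 hB)
  refine abs_le_of_sq_le_sq' (b := 2 * B + 2) ?_ (by linarith) |>.2
  rw [norm_sq_horiz_add]
  nlinarith [norm_nonneg (horiz v)]

/-- For `B² ≤ 2R` the support reaches at most height 1, where the vertical cutoff equals 1; `B ≤ R`
puts it in the range of the other cutoff. -/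
theorem pull_eq_localExt {R : ℝ} (hR : 0 < R) {f : Space D → ℝ} {B : ℝ} (hB : 0 < B)
    (hf : ∀ x, f x ≠ 0 → ‖x‖ ≤ B) (h1 : B ≤ R) (h2 : B ^ 2 ≤ 2 * R) {v : Ambient D}
    (hv : v ∈ Metric.sphere (center D R) R) : pull R f v = localExt f (1 / (2 * R)) v := by
  have h3 := pull_eq_pullExt hR hf (a := 1 / 2) (by norm_num) (by nlinarith) hv
  rw [localExt, ← h3]
  by_cases h0 : pull R f v = 0
  · rw [h0, mul_zero]
  · have h4 := last_le_of_pull_ne_zero hR hf hv h0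
    have h5 := last_nonneg hR hv
    have h6 : v (Fin.last D) ≤ 1 := by
      by_contra! hc
      nlinarith [sq_nonneg B]
    rw [Real.smoothTransition.one_of_one_le (by nlinarith), one_mul]

theorem localExt_zero_eq {f f' : Space D → ℝ} {v w : Ambient D}
    (h : v (Fin.last D) = w (Fin.last D)) (hf : f (horiz v) = f' (horiz w)) :
    localExt f 0 v = localExt f' 0 w := by
  simp [localExt, pullExt, h, hf]

end

section

/-! ### Invariance under limits of rotations of the sphere -/

section

variable {R : ℝ}

theorem pair_sub [NeZero D] (hR : 0 < R) (Y : HarmonicBasis D R) {φ : Field D R}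
    (hφ : IsTempered φ) {U V : Ambient D → ℝ} (hU : ContDiff ℝ ∞ U) (hV : ContDiff ℝ ∞ V) :
    pair Y φ (fun v => U v - V v) = pair Y φ U - pair Y φ V := by
  rw [pair, pair, pair, ← (hφ.summable_mul (isRapid_coeff hR Y hU)).tsum_sub
    (hφ.summable_mul (isRapid_coeff hR Y hV))]
  simp only [coeff_sub hR Y hU.continuous hV.continuous, mul_sub]

/-- A smooth family of maps of the ambient space which are isometries of the spheres of
curvature `ε = 1 / (2R)`, and which tends to `E⁻¹` as `ε → 0`. -/
structure IsDeformation (S : ℝ → Ambient D → Ambient D) (E : Space D ≃ᵃⁱ[ℝ] Space D) : Prop where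
  contDiff : ContDiff ℝ ∞ fun p : ℝ × Ambient D => S p.1 p.2
  horiz_zero : ∀ v, horiz (S 0 v) = E.symm (horiz v)
  last_zero : ∀ v, S 0 v (Fin.last D) = v (Fin.last D)
  exists_isometry : ∀ R : ℝ, 0 < R → ∃ A : Ambient D ≃ₗᵢ[ℝ] Ambient D,
    ∀ v, S (1 / (2 * R)) v = sphereIso R A v

variable {S : ℝ → Ambient D → Ambient D} {E : Space D ≃ᵃⁱ[ℝ] Space D}

/-- Each `S ε` with `ε > 0` preserves distances and moves the origin by a bounded amount. Pull-backs
of functions with bounded support hence have uniformly bounded support. -/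
theorem IsDeformation.exists_norm_le (hS : IsDeformation S E) :
    ∃ C : ℝ, ∀ ε, 0 < ε → ε ≤ 1 / 4 → ∀ v, ‖v‖ ≤ ‖S ε v‖ + C := by
  obtain ⟨C, hC⟩ := (isCompact_Icc (a := (0 : ℝ)) (b := 1 / 4)).exists_bound_of_continuousOn
    (f := fun ε => S ε 0)
    (hS.contDiff.continuous.comp (Continuous.prodMk_left (0 : Ambient D))).continuousOn
  refine ⟨C, fun ε h0 h1 v => ?_⟩
  obtain ⟨A, hA⟩ := hS.exists_isometry (1 / (2 * ε)) (by positivity)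
  have hε : 1 / (2 * (1 / (2 * ε))) = ε := by field_simp
  rw [hε] at hA
  have h2 : ‖v‖ = ‖S ε v - S ε 0‖ := by
    rw [hA, hA, sphereIso, sphereIso, add_sub_add_left_eq_sub, ← map_sub, A.norm_map]
    congr 1
    abel
  rw [h2]
  exact (norm_sub_le _ _).trans (add_le_add le_rfl (hC ε ⟨h0.le, h1⟩))

theorem IsDeformation.jointSmooth_localExt (hS : IsDeformation S E) {f : Space D → ℝ}
    (hf : ContDiff ℝ ∞ f) : JointSmooth fun ε v => localExt f ε (S ε v) :=
  ContDiff.comp (g := fun p : ℝ × Ambient D => localExt f p.1 p.2)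
    (SphereQFT.jointSmooth_localExt hf) (contDiff_fst.prodMk hS.contDiff)

theorem IsDeformation.eventually_pair_sub_le [NeZero D] (hS : IsDeformation S E) (k : ℝ)
    {f f' : Space D → ℝ} (hf : ContDiff ℝ ∞ f) (hf' : ContDiff ℝ ∞ f')
    (hff' : ∀ x, f' x = f (E.symm x)) {B B' : ℝ} (hfB : ∀ x, f x ≠ 0 → ‖x‖ ≤ B)
    (hfB' : ∀ x, f' x ≠ 0 → ‖x‖ ≤ B') {η : ℝ} (hη : 0 < η) :
    ∀ᶠ R : ℝ in atTop, ∀ (Y : HarmonicBasis D R) (φ : Field D R) (M : ℝ), 0 ≤ M →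
      sobolevNorm k φ ≤ ENNReal.ofReal M → |pair Y φ fun v =>
        localExt f' (1 / (2 * R)) v - localExt f (1 / (2 * R)) (S (1 / (2 * R)) v)| ≤ M * η := by
  obtain ⟨C, hC⟩ := hS.exists_norm_le
  refine eventually_pair_le_of_jointSmooth (ε₀ := 1 / 4) (C := max (2 * B' + 2) (2 * B + 2 + C))
    ((SphereQFT.jointSmooth_localExt hf').sub (hS.jointSmooth_localExt hf))
    (fun v => ?_) (by norm_num) (fun ε h0 h1 v hv => ?_) k hη
  · rw [sub_eq_zero]
    exact localExt_zero_eq (hS.last_zero v).symm (by rw [hS.horiz_zero, hff'])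
  · by_cases h2 : localExt f' ε v = 0
    · have h3 : localExt f ε (S ε v) ≠ 0 := fun h3 => hv (by rw [h2, h3, sub_zero])
      exact le_max_of_le_right ((hC ε h0 h1 v).trans
        (add_le_add_left (norm_le_of_localExt_ne_zero hfB h0 h1 h3) C))
    · exact le_max_of_le_left (norm_le_of_localExt_ne_zero hfB' h0 h1 h2)

theorem IsDeformation.exists_pair_bound_of_contDiff [NeZero D] (hS : IsDeformation S E) (k : ℝ)
    {f f' : Space D → ℝ} (hf : ContDiff ℝ ∞ f) (hf' : ContDiff ℝ ∞ f')
    (hff' : ∀ x, f' x = f (E.symm x)) {B B' : ℝ} (hB : 0 < B) (hB' : 0 < B')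
    (hfB : ∀ x, f x ≠ 0 → ‖x‖ ≤ B) (hfB' : ∀ x, f' x ≠ 0 → ‖x‖ ≤ B') :
    ∃ c : ℝ, 0 ≤ c ∧ ∀ η : ℝ, 0 < η → ∀ᶠ R : ℝ in atTop, ∀ (hR : 0 < R) (Y : HarmonicBasis D R)
      (A : Ambient D ≃ₗᵢ[ℝ] Ambient D), (∀ v, S (1 / (2 * R)) v = sphereIso R A v) →
      ∀ (φ : Field D R) (M : ℝ), IsTempered φ → 0 ≤ M → sobolevNorm k φ ≤ ENNReal.ofReal M →
        |pair Y φ (pull R f')| ≤ M * c ∧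
        |pair Y φ (pull R f') - pair Y (rotField hR Y A φ) (pull R f)| ≤ M * η := by
  have hV := SphereQFT.jointSmooth_localExt hf'
  have hU := SphereQFT.jointSmooth_localExt hf
  obtain ⟨c, hc0, hc⟩ := exists_pair_bound_of_jointSmooth (ε₀ := 1 / 4) hV
    (fun ε h0 h1 v => norm_le_of_localExt_ne_zero hfB' h0 h1) k
  refine ⟨c, hc0, fun η hη => ?_⟩
  filter_upwards [hS.eventually_pair_sub_le k hf hf' hff' hfB hfB' hη, eventually_ge_atTop B,
    eventually_ge_atTop B', eventually_ge_atTop (B ^ 2), eventually_ge_atTop (B' ^ 2),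
    eventually_ge_atTop 2] with R h1 h2 h3 h4 h5 h6 hR Y A hA φ M hφ hM hφM
  have hε : 1 / (2 * R) ≤ 1 / 4 := one_div_le_one_div_of_le (by norm_num) (by linarith)
  have h7 : pair Y φ (pull R f') = pair Y φ (localExt f' (1 / (2 * R))) :=
    pair_congr hR Y φ fun v hv => pull_eq_localExt hR hB' hfB' h3 (by linarith) hv
  have h8 : pair Y (rotField hR Y A φ) (pull R f) =
      pair Y φ fun v => localExt f (1 / (2 * R)) (S (1 / (2 * R)) v) := by
    rw [pair_congr hR Y _ fun v hv => pull_eq_localExt hR hB hfB h2 (by linarith) hv,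
      pair_rotField hR Y A hφ (hU.slice _)]
    simp only [hA]
  rw [h7, h8, ← pair_sub hR Y hφ (hV.slice _) ((hS.jointSmooth_localExt hf).slice _)]
  exact ⟨hc hR hε Y φ M hM hφM, h1 Y φ M hM hφM⟩

theorem IsDeformation.exists_pair_bound [NeZero D] (hS : IsDeformation S E) (k : ℝ) (f : Test D) :
    ∃ c : ℝ, 0 ≤ c ∧ ∀ η : ℝ, 0 < η → ∀ᶠ R : ℝ in atTop, ∀ (hR : 0 < R) (Y : HarmonicBasis D R)
      (A : Ambient D ≃ₗᵢ[ℝ] Ambient D), (∀ v, S (1 / (2 * R)) v = sphereIso R A v) →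
      ∀ (φ : Field D R) (M : ℝ), IsTempered φ → 0 ≤ M → sobolevNorm k φ ≤ ENNReal.ofReal M →
        |pair Y φ (pull R (move E f))| ≤ M * c ∧
        |pair Y φ (pull R (move E f)) - pair Y (rotField hR Y A φ) (pull R f)| ≤ M * η := by
  obtain ⟨B, hB, hfB⟩ := exists_test_radius f
  obtain ⟨B', hB', hfB'⟩ := exists_test_radius (move E f)
  exact hS.exists_pair_bound_of_contDiff k f.contDiff (move E f).contDiff (move_apply E f) hB hB'
    hfB hfB'

/-- Where the Sobolev norm is at most `M`, all pairings stay in a fixed ball, on which `F` is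
uniformly continuous. Elsewhere the trivial bound `2‖F‖` is written as a multiple of the truncated
norm, as in Markov's inequality. -/
theorem IsDeformation.eventually_breve_le [NeZero D] (hS : IsDeformation S E) (k : ℝ) {m : ℕ}
    (f : Fin m → Test D) (F : (Fin m → ℝ) →ᵇ ℝ) {δ M : ℝ} (hδ : 0 < δ) (hM : 0 < M) :
    ∀ᶠ R : ℝ in atTop, ∀ (hR : 0 < R) (Y : HarmonicBasis D R)
      (A : Ambient D ≃ₗᵢ[ℝ] Ambient D), (∀ v, S (1 / (2 * R)) v = sphereIso R A v) →
      ∀ φ : Field D R, IsTempered φ →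
        |breve Y (fun i => move E (f i)) F φ - breve Y f F (rotField hR Y A φ)| ≤
          δ + 2 * ‖F‖ / M * (min (sobolevNorm k φ) (ENNReal.ofReal M)).toReal := by
  choose c hc0 hc using fun i => hS.exists_pair_bound k (f i)
  set C := M * ∑ i, c i + 1 with hC
  have hF : UniformContinuousOn F (Metric.closedBall (0 : Fin m → ℝ) C) :=
    (isCompact_closedBall _ _).uniformContinuousOn_of_continuous F.continuous.continuousOn
  obtain ⟨ρ, hρ, hFρ⟩ := Metric.uniformContinuousOn_iff.1 hF δ hδ
  set η := min ρ 1 / (2 * M) with hη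
  have hη0 : 0 < η := by positivity
  have hMη : M * η < min ρ 1 := by
    have : M * η = min ρ 1 / 2 := by rw [hη]; field_simp
    rw [this]
    exact half_lt_self (by positivity)
  filter_upwards [eventually_all.2 fun i => hc i η hη0] with R h hR Y A hA φ hφ
  by_cases hsob : sobolevNorm k φ ≤ ENNReal.ofReal M
  · have h1 := fun i => h i hR Y A hA φ M hφ hM.le hsob
    have hci : ∀ i, M * c i ≤ M * ∑ i, c i := fun i => mul_le_mul_of_nonneg_left
      (Finset.single_le_sum (fun i _ => hc0 i) (Finset.mem_univ i)) hM.le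
    have hC0 : 0 ≤ C := by
      have := Finset.sum_nonneg fun i (_ : i ∈ Finset.univ) => hc0 i
      positivity
    have h2 := hFρ (fun i => pair Y φ (pull R (move E (f i)))) (by
      rw [mem_closedBall_zero_iff, pi_norm_le_iff_of_nonneg hC0]
      exact fun i => (h1 i).1.trans ((hci i).trans (by rw [hC]; linarith)))
      (fun i => pair Y (rotField hR Y A φ) (pull R (f i))) (by
      rw [mem_closedBall_zero_iff, pi_norm_le_iff_of_nonneg hC0]
      intro i
      have h3 := abs_le.1 (h1 i).1
      have h4 := abs_le.1 (h1 i).2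
      have h5 := hMη.trans_le (min_le_right ρ 1)
      rw [Real.norm_eq_abs, abs_le]
      constructor <;> linarith [hci i]) (by
      rw [dist_pi_lt_iff hρ]
      exact fun i => (h1 i).2.trans_lt (hMη.trans_le (min_le_left ρ 1)))
    exact h2.le.trans (le_add_of_nonneg_right (by positivity))
  · rw [min_eq_right (not_le.1 hsob).le, ENNReal.toReal_ofReal hM.le, div_mul_cancel₀ _ hM.ne']
    have h1 : ∀ x y, |F x - F y| ≤ 2 * ‖F‖ := fun x y => F.dist_le_two_norm x y
    exact (h1 _ _).trans (le_add_of_nonneg_left hδ.le)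

end

theorem measurable_sobolevNorm {R : ℝ} (k : ℝ) :
    Measurable (sobolevNorm k : Field D R → ℝ≥0∞) := by
  refine Measurable.pow_const (Measurable.tsum fun i => ?_) _
  exact ENNReal.measurable_ofReal.comp (((measurable_pi_apply i).pow_const 2).const_mul _)

section

variable {L : StrongDual ℝ (lp (fun _ : ℕ => ℝ) ∞)} {R Λ : ℕ → ℝ} {h : Space D → ℝ}
  {N : ℕ → ℕ} {𝓛 : ∀ n, (Fin (N n + 1) → ℝ) → ℝ} {Y : ∀ n, HarmonicBasis D (R n)}
  {K : Type*} [TopologicalSpace K] [MeasurableSpace K] {ι : Distr D → K} {μ : Measure K}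

theorem isBddFamily_const (c : ℝ) : IsBddFamily fun n (_ : Field D (R n)) => c :=
  ⟨fun _ => aestronglyMeasurable_const, |c|, fun _ _ => le_rfl⟩

theorem IsBddFamily.add {G G' : ∀ n, Field D (R n) → ℝ} (hG : IsBddFamily G)
    (hG' : IsBddFamily G') : IsBddFamily fun n φ => G n φ + G' n φ := by
  obtain ⟨C, hC⟩ := hG.exists_bound
  obtain ⟨C', hC'⟩ := hG'.exists_bound
  exact ⟨fun n => (hG.aestronglyMeasurable n).add (hG'.aestronglyMeasurable n), C + C',
    fun n φ => (abs_add_le _ _).trans (add_le_add (hC n φ) (hC' n φ))⟩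

theorem IsBddFamily.const_mul {G : ∀ n, Field D (R n) → ℝ} (hG : IsBddFamily G) (c : ℝ) :
    IsBddFamily fun n φ => c * G n φ := by
  obtain ⟨C, hC⟩ := hG.exists_bound
  refine ⟨fun n => (hG.aestronglyMeasurable n).const_mul c, |c| * C, fun n φ => ?_⟩
  rw [abs_mul]
  exact mul_le_mul_of_nonneg_left (hC n φ) (abs_nonneg c)

theorem limExpect_mono_of_eventually [NeZero D] (ht : IsTheory L R Λ h 𝓛)
    {G G' : ∀ n, Field D (R n) → ℝ} (hG : IsBddFamily G) (hG' : IsBddFamily G')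
    (hle : ∀ᶠ n in atTop, ∀ᵐ φ ∂freeMeasure D (R n), G n φ ≤ G' n φ) :
    limExpect L Y Λ h 𝓛 G ≤ limExpect L Y Λ h 𝓛 G' := by
  obtain ⟨C, hC⟩ := hG.exists_expect_bound (Y := Y) (Λ := Λ) (h := h) (𝓛 := 𝓛)
  obtain ⟨C', hC'⟩ := hG'.exists_expect_bound (Y := Y) (Λ := Λ) (h := h) (𝓛 := 𝓛)
  refine genLim_mono_of_eventually ht.generalizedLimit hC hC' ?_
  filter_upwards [hle] with n hn
  rw [expect_eq_integral, expect_eq_integral]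
  exact integral_mono_ae (hG.integrable ht n) (hG'.integrable ht n)
    ((gibbs_absolutelyContinuous (Y n)).ae_le hn)

theorem isBddFamily_min_sobolevNorm (k : ℝ) (M : ℕ) :
    IsBddFamily fun n (φ : Field D (R n)) => (min (sobolevNorm k φ) (M : ℝ≥0∞)).toReal := by
  refine ⟨fun n => ((measurable_sobolevNorm k).min
    measurable_const).ennreal_toReal.aestronglyMeasurable, M, fun n φ => ?_⟩
  rw [abs_of_nonneg ENNReal.toReal_nonneg]
  exact ENNReal.toReal_le_of_le_ofReal (Nat.cast_nonneg M) (by simp)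

theorem limExpect_min_le {G : ∀ n, Field D (R n) → ℝ≥0∞}
    (hfin : limExpectENN L Y Λ h 𝓛 G < ⊤) (M : ℕ) :
    limExpect L Y Λ h 𝓛 (fun n φ => (min (G n φ) (M : ℝ≥0∞)).toReal) ≤
      (limExpectENN L Y Λ h 𝓛 G).toReal := by
  rw [← ENNReal.ofReal_le_iff_le_toReal hfin.ne]
  exact le_iSup (fun M : ℕ => ENNReal.ofReal
    (limExpect L Y Λ h 𝓛 fun n φ => (min (G n φ) (M : ℝ≥0∞)).toReal)) M

theorem Represents.invariantUnder_of_isDeformation [NeZero D] (ht : IsTheory L R Λ h 𝓛)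
    (hRlim : Tendsto R atTop atTop) (hμ : Represents ι μ L Y Λ h 𝓛) {k : ℝ}
    (hfin : limExpectENN L Y Λ h 𝓛 (fun n => sobolevNorm (R := R n) k) < ⊤)
    {S : ℝ → Ambient D → Ambient D} {E : Space D ≃ᵃⁱ[ℝ] Space D} (hS : IsDeformation S E) :
    InvariantUnder ι μ E := by
  intro m f F Φ Φ' hΦ hΦ'
  rw [hμ.integral_eq m f F Φ hΦ, hμ.integral_eq m _ F Φ' hΦ']
  choose A hA using fun n => hS.exists_isometry (R n) (ht.radius_pos n)
  have hrot : limExpect L Y Λ h 𝓛 (fun n => breve (Y n) f F) = limExpect L Y Λ h 𝓛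
      (fun n φ => breve (Y n) f F (rotField (ht.radius_pos n) (Y n) (A n) φ)) := by
    rw [limExpect_eq_genLim, limExpect_eq_genLim]
    congr 1
    funext n
    exact (expect_comp_rotField (ht.radius_pos n) (ht.cutoff_pos n) ht.regulator
      (ht.lagrangian n) (Y n) (A n) (measurable_breve (Y n) f F)).symm
  rw [hrot]
  have hG1 := isBddFamily_breve (Y := Y) (fun i => move E (f i)) F
  have hG2 : IsBddFamily fun n φ =>
      breve (Y n) f F (rotField (ht.radius_pos n) (Y n) (A n) φ) :=
    ⟨fun n => ((measurable_breve (Y n) f F).comp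
      (measurable_rotField _ (Y n) (A n))).aestronglyMeasurable,
      ‖F‖, fun _ _ => F.norm_coe_le_norm _⟩
  set I := (limExpectENN L Y Λ h 𝓛 (fun n => sobolevNorm (R := R n) k)).toReal with hI
  have hI0 : 0 ≤ I := ENNReal.toReal_nonneg
  refine eq_of_abs_sub_le_all fun δ hδ => ?_
  -- `M` is so large that the Markov term, at most `2‖F‖ I / M`, is below `δ / 2`.
  obtain ⟨M, hM⟩ := exists_nat_gt (2 * ‖F‖ * I / (δ / 2))
  have hM0 : (0 : ℝ) < M := lt_of_le_of_lt (by positivity) hM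
  set c := 2 * ‖F‖ / M with hc
  have hc0 : 0 ≤ c := by positivity
  have hX := limExpect_min_le hfin M
  have hG3 := isBddFamily_min_sobolevNorm (D := D) (R := R) k M
  have hG4 := (isBddFamily_const (D := D) (R := R) (δ / 2)).add (hG3.const_mul c)
  have hev := hRlim.eventually (hS.eventually_breve_le k f F (half_pos hδ) hM0)
  rw [ENNReal.ofReal_natCast] at hev
  have h4 : limExpect L Y Λ h 𝓛 (fun n (φ : Field D (R n)) => δ / 2 +
      c * (min (sobolevNorm k φ) (M : ℝ≥0∞)).toReal) ≤ δ := by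
    have h1 : limExpect L Y Λ h 𝓛 (fun n (_ : Field D (R n)) => δ / 2) = δ / 2 := by
      have := limExpect_const_mul (L := L) (Y := Y) (Λ := Λ) (h := h) (𝓛 := 𝓛)
        (isBddFamily_const (D := D) (R := R) 1) (δ / 2)
      rw [limExpect_one ht, mul_one] at this
      simpa only [mul_one] using this
    rw [limExpect_add ht (isBddFamily_const _) (hG3.const_mul c), h1, limExpect_const_mul hG3]
    have h2 := mul_le_mul_of_nonneg_left hX hc0
    have h3 : c * I ≤ δ / 2 := by
      rw [div_lt_iff₀ (half_pos hδ)] at hM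
      rw [hc, div_mul_eq_mul_div, div_le_iff₀ hM0]
      linarith
    linarith
  have h5 := limExpect_mono_of_eventually (Y := Y) ht hG1 (hG2.add hG4) (by
    filter_upwards [hev] with n hn
    filter_upwards [ae_isTempered (ht.radius_pos n)] with φ hφ
    have := (abs_le.1 (hn (ht.radius_pos n) (Y n) (A n) (hA n) φ hφ)).2
    linarith)
  have h6 := limExpect_mono_of_eventually (Y := Y) ht hG2 (hG1.add hG4) (by
    filter_upwards [hev] with n hn
    filter_upwards [ae_isTempered (ht.radius_pos n)] with φ hφ
    have := (abs_le.1 (hn (ht.radius_pos n) (Y n) (A n) (hA n) φ hφ)).1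
    linarith)
  rw [limExpect_add ht hG2 hG4] at h5
  rw [limExpect_add ht hG1 hG4] at h6
  rw [abs_le]
  constructor <;> linarith

end

end

section

/-! ### Translations -/

theorem inner_joinVec (x : Space D) (a : ℝ) (v : Ambient D) :
    inner ℝ (joinVec x a) v = inner ℝ x (horiz v) + a * v (Fin.last D) := by
  simp only [PiLp.inner_apply, Fin.sum_univ_castSucc, joinVec_castSucc, joinVec_last, horiz_apply,
    RCLike.inner_apply, conj_trivial]
  ring

theorem norm_sq_joinVec (x : Space D) (a : ℝ) : ‖joinVec x a‖ ^ 2 = ‖x‖ ^ 2 + a ^ 2 := by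
  rw [norm_sq_horiz_add, horiz_joinVec, joinVec_last]

/-- The composition of the reflection of `ℝ^D` with normal `t` and the translation by `-t`. -/
def glide (t : Space D) : Space D ≃ᵃⁱ[ℝ] Space D :=
  (Submodule.reflection (ℝ ∙ t)ᗮ).toAffineIsometryEquiv.trans
    (AffineIsometryEquiv.constVAdd ℝ (Space D) (-t))

theorem glide_symm_apply {t : Space D} (ht : t ≠ 0) (x : Space D) :
    (glide t).symm x = x - (2 * (inner ℝ t x / ‖t‖ ^ 2 + 1 / 2)) • t := by
  have h1 : (glide t).symm x = Submodule.reflection (ℝ ∙ t)ᗮ (- -t + x) := rfl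
  have h2 : ‖t‖ ^ 2 ≠ 0 := pow_ne_zero 2 (norm_ne_zero_iff.2 ht)
  rw [h1, neg_neg, Submodule.reflection_orthogonal_apply, Submodule.reflection_singleton_apply,
    inner_add_right, real_inner_self_eq_norm_sq]
  simp only [RCLike.ofReal_real_eq_id, id_eq, add_div, div_self h2]
  module

/-- The reflections of the spheres that deform the reflection followed by a translation. -/
def glideDeformation (t : Space D) (ε : ℝ) (v : Ambient D) : Ambient D :=
  v - (2 * ((inner ℝ t (horiz v) / ‖t‖ ^ 2 - ε * v (Fin.last D) + 1 / 2) /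
    (1 + ε ^ 2 * ‖t‖ ^ 2))) • joinVec t (-(ε * ‖t‖ ^ 2))

/-- `glide t` is the reflection in the hyperplane `t·x = -‖t‖²/2`. The normal `(t, -ε‖t‖²)` is
chosen so that the hyperplane through the centre `(0, R)` reads `t·x - ε‖t‖² y + ‖t‖²/2 = 0`,
because `ε R = 1/2`. At `ε = 0` this is the Euclidean mirror. -/
theorem isDeformation_glideDeformation {t : Space D} (ht : t ≠ 0) :
    IsDeformation (glideDeformation t) (glide t) where
  contDiff := by
    have h1 : ContDiff ℝ ∞ fun p : ℝ × Ambient D => horiz p.2 := contDiff_horiz.comp contDiff_snd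
    have h2 : ContDiff ℝ ∞ fun p : ℝ × Ambient D => p.2 (Fin.last D) := by fun_prop
    have h3 : ContDiff ℝ ∞ fun p : ℝ × Ambient D => joinVec t (-(p.1 * ‖t‖ ^ 2)) := by
      rw [contDiff_euclidean]
      intro i
      refine Fin.lastCases ?_ (fun i => ?_) i
      · simp only [joinVec_last]
        fun_prop
      · simp only [joinVec_castSucc]
        exact contDiff_const
    refine contDiff_snd.sub (ContDiff.smul (contDiff_const.mul (ContDiff.div ?_ ?_ ?_)) h3)
    · exact (((contDiff_const.inner ℝ h1).div_const _).sub (contDiff_fst.mul h2)).add contDiff_const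
    · exact contDiff_const.add ((contDiff_fst.pow 2).mul contDiff_const)
    · intro p
      positivity
  horiz_zero v := by
    rw [glide_symm_apply ht]
    ext i
    simp [glideDeformation]
  last_zero v := by simp [glideDeformation]
  exists_isometry R hR := by
    have h2 : ‖t‖ ^ 2 ≠ 0 := pow_ne_zero 2 (norm_ne_zero_iff.2 ht)
    refine ⟨Submodule.reflection (ℝ ∙ joinVec t (-(1 / (2 * R) * ‖t‖ ^ 2)))ᗮ, fun v => ?_⟩
    rw [sphereIso_reflection, glideDeformation, norm_sq_joinVec, inner_joinVec]
    have h1 : horiz (v - center D R) = horiz v := by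
      ext i
      simp [center, Fin.castSucc_ne_last]
    have h3 : (v - center D R) (Fin.last D) = v (Fin.last D) - R := by simp [center]
    rw [h1, h3]
    congr 3
    rw [div_eq_div_iff (by positivity) (by positivity)]
    field_simp
    ring

section

variable {L : StrongDual ℝ (lp (fun _ : ℕ => ℝ) ∞)} {R Λ : ℕ → ℝ} {h : Space D → ℝ}
  {N : ℕ → ℕ} {𝓛 : ∀ n, (Fin (N n + 1) → ℝ) → ℝ} {Y : ∀ n, HarmonicBasis D (R n)}
  {K : Type*} [TopologicalSpace K] [MeasurableSpace K] {ι : Distr D → K} {μ : Measure K}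

theorem InvariantUnder.trans (hι : IsCylCompactification ι) {E E' : Space D ≃ᵃⁱ[ℝ] Space D}
    (hE : InvariantUnder ι μ E) (hE' : InvariantUnder ι μ E') :
    InvariantUnder ι μ (E.trans E') := by
  intro m f F Φ Φ' hΦ hΦ'
  obtain ⟨Ψ, hΨ⟩ := hι.exists_extension (cyl (fun i => move E (f i)) F) ⟨m, _, F, rfl⟩
  rw [← hE m f F Φ Ψ hΦ hΨ]
  refine hE' m (fun i => move E (f i)) F Ψ Φ' hΨ fun T => (hΦ' T).trans ?_
  congr 1

theorem Represents.invariantUnder_translation [NeZero D] (hι : IsCylCompactification ι)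
    (ht : IsTheory L R Λ h 𝓛)
    (hRlim : Tendsto R atTop atTop) (hμ : Represents ι μ L Y Λ h 𝓛) {k : ℝ}
    (hfin : limExpectENN L Y Λ h 𝓛 (fun n => sobolevNorm (R := R n) k) < ⊤) (t : Space D) :
    InvariantUnder ι μ (AffineIsometryEquiv.constVAdd ℝ (Space D) t) := by
  by_cases h0 : t = 0
  · have h1 : AffineIsometryEquiv.constVAdd ℝ (Space D) t =
        (LinearIsometryEquiv.refl ℝ (Space D)).toAffineIsometryEquiv := by
      ext1 x
      simp [h0]
    rw [h1]
    exact hμ.invariantUnder_linear ht _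
  · have h1 : AffineIsometryEquiv.constVAdd ℝ (Space D) t =
        (Submodule.reflection (ℝ ∙ (-t))ᗮ).toAffineIsometryEquiv.trans (glide (-t)) := by
      ext1 x
      show t + x = - -t + Submodule.reflection (ℝ ∙ (-t))ᗮ (Submodule.reflection (ℝ ∙ (-t))ᗮ x)
      rw [Submodule.reflection_reflection, neg_neg]
    rw [h1]
    exact (hμ.invariantUnder_linear ht _).trans hι (hμ.invariantUnder_of_isDeformation ht hRlim
      hfin (isDeformation_glideDeformation (neg_ne_zero.2 h0)))

theorem Represents.invariantUnder_motion [NeZero D] (hι : IsCylCompactification ι)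
    (ht : IsTheory L R Λ h 𝓛)
    (hRlim : Tendsto R atTop atTop) (hμ : Represents ι μ L Y Λ h 𝓛) {k : ℝ}
    (hfin : limExpectENN L Y Λ h 𝓛 (fun n => sobolevNorm (R := R n) k) < ⊤)
    (E : Space D ≃ᵃⁱ[ℝ] Space D) : InvariantUnder ι μ E := by
  have h1 : E = E.linearIsometryEquiv.toAffineIsometryEquiv.trans
      (AffineIsometryEquiv.constVAdd ℝ (Space D) (E 0)) := by
    ext1 x
    show E x = E 0 + E.linearIsometryEquiv x
    have := E.map_vadd 0 x
    rw [vadd_eq_add, add_zero, vadd_eq_add] at this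
    rw [this, add_comm]
  rw [h1]
  exact (hμ.invariantUnder_linear ht _).trans hι
    (hμ.invariantUnder_translation hι ht hRlim hfin _)

end

/-! ### Cutoffs -/

theorem exists_cutoffs (D : ℕ) (𝔐 : ℕ → ℝ) :
    ∃ R Λ : ℕ → ℝ, (∀ n, 0 < R n) ∧ (∀ n, 0 < Λ n) ∧ Tendsto R atTop atTop ∧
      Tendsto Λ atTop atTop ∧ Tendsto (fun n => 𝔐 n * R n ^ D / Λ n) atTop (𝓝 0) := by
  have hR : Tendsto (fun n : ℕ => (n : ℝ) + 1) atTop atTop :=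
    tendsto_atTop_add_const_right _ _ tendsto_natCast_atTop_atTop
  have h1 : ∀ n : ℕ, 1 ≤ 1 + |𝔐 n * ((n : ℝ) + 1) ^ D| := fun n =>
    le_add_of_nonneg_right (abs_nonneg _)
  -- With this choice of `Λ` the ratio is at most `1 / (n + 1)` in absolute value.
  refine ⟨fun n => n + 1, fun n => (n + 1) * (1 + |𝔐 n * ((n : ℝ) + 1) ^ D|),
    fun n => by positivity, fun n => by positivity, hR, ?_, ?_⟩
  · exact tendsto_atTop_mono (fun n => le_mul_of_one_le_right (by positivity) (h1 n)) hR
  · refine squeeze_zero_norm (fun n => ?_) (tendsto_inv_atTop_zero.comp hR)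
    have h2 : (0 : ℝ) < n + 1 := by positivity
    have h3 : 0 < 1 + |𝔐 n * ((n : ℝ) + 1) ^ D| := by positivity
    rw [norm_div, Real.norm_eq_abs, Real.norm_eq_abs, abs_of_pos (mul_pos h2 h3),
      div_le_iff₀ (mul_pos h2 h3), Function.comp_apply, inv_mul_cancel_left₀ h2.ne']
    linarith

end

end SphereQFT

end

theorem mainTheorem1 (D : ℕ) [NeZero D]
    -- the order of the Sobolev space, large enough for the Gaussian measure to live on `H^{-k}`
    (k : ℝ) (hk : (D : ℝ) / 2 < k + 1)
    -- the ultraviolet regulator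
    (h : Space D → ℝ) (h_smooth : ContDiff ℝ ∞ h) (h_supp : HasCompactSupport h)
    (h_nonneg : ∀ x, 0 ≤ h x) (h_ne : h ≠ 0)
    (h_radial : ∀ (O : Space D ≃ₗᵢ[ℝ] Space D) (x : Space D), h (O x) = h x)
    -- the generalized limit
    (L : StrongDual ℝ (lp (fun _ : ℕ => ℝ) ∞)) (hL : IsGeneralizedLimit L)
    -- the bounded Lagrangians
    (N : ℕ → ℕ) (𝓛 : ∀ n, (Fin (N n + 1) → ℝ) → ℝ) (h𝓛_meas : ∀ n, Measurable (𝓛 n))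
    (h𝓛_bdd : ∀ n, ∃ C : ℝ, ∀ x, |𝓛 n x| ≤ C) :
    -- existence of the compactification
    (∃ (K : Type) (_ : TopologicalSpace K) (ι : Distr D → K), IsCylCompactification ι) ∧
    -- its uniqueness
    (∀ (K₁ : Type*) (K₂ : Type*) [TopologicalSpace K₁] [TopologicalSpace K₂]
      (ι₁ : Distr D → K₁) (ι₂ : Distr D → K₂),
      IsCylCompactification ι₁ → IsCylCompactification ι₂ →
        ∃! e : K₁ ≃ₜ K₂, ∀ T, e (ι₁ T) = ι₂ T) ∧
    -- unique extension of cylindrical functions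
    (∀ (K : Type*) [TopologicalSpace K] (ι : Distr D → K), IsCylCompactification ι →
      ∀ G : Distr D → ℝ, IsCylindrical G → ∃! Φ : C(K, ℝ), ∀ T, Φ (ι T) = G T) ∧
    -- the measure, for all sequences of cutoffs
    (∀ (K : Type*) [TopologicalSpace K] [MeasurableSpace K] [BorelSpace K] (ι : Distr D → K),
      IsCylCompactification ι →
      ∀ (R Λ : ℕ → ℝ), (∀ n, 0 < R n) → (∀ n, 0 < Λ n) →
        Tendsto R atTop atTop → Tendsto Λ atTop atTop →
      ∀ Y : ∀ n, HarmonicBasis D (R n),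
        (∃! μ : Measure K, Represents ι μ L Y Λ h 𝓛) ∧
        ∀ μ : Measure K, Represents ι μ L Y Λ h 𝓛 →
          -- rotational invariance
          (∀ O : Space D ≃ₗᵢ[ℝ] Space D, InvariantUnder ι μ O.toAffineIsometryEquiv) ∧
          -- reflection positivity
          (Tendsto (fun n => lagrangianSup (𝓛 n) * R n ^ D / Λ n) atTop (𝓝 0) →
            ReflectionPositive ι μ) ∧
          -- translation invariance, and hence Euclidean invariance
          (limExpectENN L Y Λ h 𝓛 (fun n => sobolevNorm (R := R n) k) < ⊤ →
            (∀ t : Space D, InvariantUnder ι μ (AffineIsometryEquiv.constVAdd ℝ (Space D) t)) ∧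
            ∀ E : Space D ≃ᵃⁱ[ℝ] Space D, InvariantUnder ι μ E)) ∧
    -- cutoffs as required for reflection positivity do exist
    (∃ R Λ : ℕ → ℝ, (∀ n, 0 < R n) ∧ (∀ n, 0 < Λ n) ∧
      Tendsto R atTop atTop ∧ Tendsto Λ atTop atTop ∧
      Tendsto (fun n => lagrangianSup (𝓛 n) * R n ^ D / Λ n) atTop (𝓝 0)) := by
  have ht : ∀ {R Λ : ℕ → ℝ}, (∀ n, 0 < R n) → (∀ n, 0 < Λ n) → IsTheory L R Λ h 𝓛 :=
    fun hR hΛ => ⟨hL, hR, hΛ, ⟨h_smooth, h_supp, h_radial⟩, fun n => ⟨h𝓛_meas n, h𝓛_bdd n⟩⟩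
  refine ⟨exists_isCylCompactification D, fun K₁ K₂ _ _ ι₁ ι₂ h₁ h₂ => existsUnique_homeomorph h₁ h₂,
    fun K _ ι hι G hG => hι.existsUnique_extension hG, ?_, exists_cutoffs D _⟩
  intro K _ _ _ ι hι R Λ hR hΛ hRlim hΛlim Y
  refine ⟨existsUnique_represents hι (ht hR hΛ) Y, fun μ hμ => ⟨fun O => ?_, fun hlim => ?_,
    fun hfin => ⟨fun t => ?_, fun E => ?_⟩⟩⟩
  · exact hμ.invariantUnder_linear (ht hR hΛ) O
  · exact hμ.reflectionPositive (ht hR hΛ) hRlim hlim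
  · exact hμ.invariantUnder_translation hι (ht hR hΛ) hRlim hfin t
  · exact hμ.invariantUnder_motion hι (ht hR hΛ) hRlim hfin E
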